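/- Let $\kappa>0$, $\beta\in\mathbb R\setminus\{0\}$, $r_0>0$, $n\ge 2$, $\varepsilon_r=r_0/n$, $\varepsilon_\theta=\pi/n$, $\varepsilon_\varphi=2\pi/n$, and $\tau_I=-\tfrac i2\sigma_I$. Consider the edges $e=(v,i)$ labelled by $v=(v_r,v_\theta,v_\varphi)=(j_r\varepsilon_r,(j_\theta-1)\varepsilon_\theta,j_\varphi\varepsilon_\varphi)$ with $1\le j_r,j_\varphi\le n$, $1\le j_\theta\le n+1$, and $i\in\{r,\theta,\varphi\}$. On $\prod_e SU(2)\times\mathfrak{su}(2)\ni(h_e,P_e)$ take the holonomy-flux symplectic form $$\omega_\gamma=\frac{2}{\kappa\beta}\sum_e\Big(\delta_{IJ}\Theta_e^I\wedge\delta P_e^J+\tfrac12\epsilon_{IJK}P_e^I\,\Theta_e^J\wedge\Theta_e^K\Big),\qquad \Theta_e=h_e^\dagger\delta h_e .$$ The physically relevant spherically symmetric subspace is coordinatized by real numbers $a_\varepsilon(v_r),b_\varepsilon(v_r),p_a^\varepsilon(v_r),p_b^\varepsilon(v_r)$ with $p_b^\varepsilon(v_r)\ne0$, through $$h_r=e^{\varepsilon_r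 a_\varepsilon\tau_1},\quad h_\theta=e^{\varepsilon_\theta(b_\varepsilon\tau_2+\Pi_\varepsilon\tau_3)},\quad h_\varphi=e^{\varepsilon_\varphi(\cos v_\theta\,\tau_1-(\Pi_\varepsilon\tau_2-b_\varepsilon\tau_3)\sin v_\theta)},$$ $$P_r=\varepsilon_\theta\varepsilon_\varphi\,\mathrm{sinc}(\tfrac{\varepsilon_\theta}2)\,p_a^\varepsilon\sin v_\theta\,\tau_1,\quad P_\theta=\varepsilon_\varphi\varepsilon_r\,p_b^\varepsilon\sin(v_\theta+\tfrac{\varepsilon_\theta}2)\,\tau_2,\quad P_\varphi=\varepsilon_r\varepsilon_\theta\,p_b^\varepsilon\,\tau_3,$$ where $\Pi_\varepsilon=\Delta_rp_a^\varepsilon/(2p_b^\varepsilon)$ and $\Delta_rf(v_r)=\frac{1}{2\varepsilon_r}[f(v_r+\varepsilon_r)-f(v_r-\varepsilon_r)]$; the values of $p_a^\varepsilon$ at the two radii $0$ and $r_0+\varepsilon_r$ next to the lattice are arbitrary fixed real numbers (so that $\delta p_a^\varepsilon=0$ there). With $\bar\lambda_\theta^2=b^2+\Pi^2$ and $\bar\lambda_\varphi^2=\cos^2v_\theta+\bar\lambda_\theta^2\sin^2v_\theta$,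 put $$\mathcal F_\Omega(b,\Pi)=\varepsilon_\theta\Big(\tfrac{b^2+\Pi^2\mathrm{sinc}(\varepsilon_\theta\bar\lambda_\theta)}{\bar\lambda_\theta^2}\cos\tfrac{\varepsilon_\theta}2\cot\tfrac{\varepsilon_\theta}2+\sum_{v_\theta}\tfrac{b^2\sin^2v_\theta+(\cos^2v_\theta+\Pi^2\sin^2v_\theta)\,\mathrm{sinc}(\varepsilon_\varphi\bar\lambda_\varphi)}{\bar\lambda_\varphi^2}\sin v_\theta\Big),$$ $$\mathcal G_\Omega(b,\Pi)=\varepsilon_\theta\Big(\tfrac{1-\mathrm{sinc}(\varepsilon_\theta\bar\lambda_\theta)}{\bar\lambda_\theta^2}\cos\tfrac{\varepsilon_\theta}2\cot\tfrac{\varepsilon_\theta}2+\sum_{v_\theta}\tfrac{1-\mathrm{sinc}(\varepsilon_\varphi\bar\lambda_\varphi)}{\bar\lambda_\varphi^2}\sin^3v_\theta\Big),$$ $$\mathcal H_\Omega(b,\Pi)=\tfrac{\varepsilon_\theta}2\Big[\varepsilon_\theta^2\,\mathrm{sinc}^2(\tfrac{\varepsilon_\theta}2\bar\lambda_\theta)\cos\tfrac{\varepsilon_\theta}2\cot\tfrac{\varepsilon_\theta}2+\varepsilon_\varphi^2\sum_{v_\theta}\mathrm{sinc}^2(\tfrac{\varepsilon_\varphi}2\bar\lambda_\varphi)\sin^3v_\theta\Big],$$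 where quotients are given their limit values at $\bar\lambda_\theta=0$ or $\bar\lambda_\varphi=0$ (namely $1$ in $\mathcal F_\Omega$, and $\varepsilon_\theta^2/6$, $\varepsilon_\varphi^2/6$ in $\mathcal G_\Omega$). On the lattice these functions are evaluated at $(b_\varepsilon(v_r),\Pi_\varepsilon(v_r))$. Then: 1. For $\Pi\neq0$, the derivatives below exist and $\mathcal H_\Omega=\mathcal G_\Omega+b\,\partial_b\mathcal G_\Omega-\frac1\Pi\,\partial_\Pi\mathcal F_\Omega$. 2. The above parametrization takes values in $\prod_eSU(2)\times\mathfrak{su}(2)$, and the restriction (pull-back) of $\omega_\gamma$ along it is $$\overline\omega=\frac{4\pi}{\kappa\beta}\sum_{v_r}\varepsilon_r\Big[2\cos(\tfrac{\varepsilon_\theta}2)\,\delta a_\varepsilon\wedge\delta p_a^\varepsilon+(\mathcal F_\Omega+\mathcal H_\Omega\Pi_\varepsilon^2)\,\delta b_\varepsilon\wedge\delta p_b^\varepsilon+\tfrac12\mathcal H_\Omega\Pi_\varepsilon\,\Delta_r(\delta p_a^\varepsilon)\wedge\delta b_\varepsilon+\tfrac12\mathcal G_\Omega\Pi_\varepsilon\tfrac{b_\varepsilon}{p_b^\varepsilon}\,\Delta_r(\delta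 p_a^\varepsilon)\wedge\delta p_b^\varepsilon\Big].$$ 3. Let $F^b_{p_b}=\frac{4\pi}{\kappa\beta}\varepsilon_r(\mathcal F_\Omega+\mathcal H_\Omega\Pi_\varepsilon^2)$. At every point where $F^b_{p_b}(v_r)\ne0$ for all $v_r$, the form $\overline\omega$ is non-degenerate, every differentiable function $f$ has a unique Hamiltonian vector $X_f$ ($\iota_{X_f}\overline\omega=\delta f$), and the brackets $\{f,g\}=\iota_{X_g}\iota_{X_f}\overline\omega$ are $$\{a_\varepsilon(v_r),p_a^\varepsilon(v_r')\}=\frac{\kappa\beta}{8\pi\varepsilon_r}\sec(\tfrac{\varepsilon_\theta}2)\,\delta_{v_r,v_r'},\qquad \{b_\varepsilon(v_r),p_b^\varepsilon(v_r')\}=\frac{\kappa\beta}{4\pi\varepsilon_r}\,\frac{\delta_{v_r,v_r'}}{\mathcal F_\Omega(v_r)+\mathcal H_\Omega(v_r)\Pi_\varepsilon(v_r)^2},$$ $$\{a_\varepsilon(v_r),p_b^\varepsilon(v_r')\}=\frac{\kappa\beta}{32\pi\varepsilon_r^2}\sec(\tfrac{\varepsilon_\theta}2)\,\frac{\mathcal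 H_\Omega(v_r')\Pi_\varepsilon(v_r')}{\mathcal F_\Omega(v_r')+\mathcal H_\Omega(v_r')\Pi_\varepsilon(v_r')^2}\,\big(\delta_{v_r,v_r'+\varepsilon_r}-\delta_{v_r,v_r'-\varepsilon_r}\big),$$ $$\{a_\varepsilon(v_r),b_\varepsilon(v_r')\}=\frac{\kappa\beta}{32\pi\varepsilon_r^2}\sec(\tfrac{\varepsilon_\theta}2)\,\frac{\mathcal G_\Omega(v_r')\Pi_\varepsilon(v_r')}{\mathcal F_\Omega(v_r')+\mathcal H_\Omega(v_r')\Pi_\varepsilon(v_r')^2}\,\frac{b_\varepsilon(v_r')}{p_b^\varepsilon(v_r')}\,\big(\delta_{v_r,v_r'-\varepsilon_r}-\delta_{v_r,v_r'+\varepsilon_r}\big),$$ all other brackets between the coordinates being zero (up to antisymmetry). In particular the configuration variables do not commute: $\{a_\varepsilon(v_r),b_\varepsilon(v_r')\}\ne0$ exactly when $v_r'=v_r\pm\varepsilon_r$, $b_\varepsilon(v_r')\neq0$ and $\Pi_\varepsilon(v_r')\ne0$; and for every $n\ge2$ and every choice of the boundary values this occurs at some point at which $F^b_{p_b}(v_r)\neq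 0$ for all $v_r$. 4. (Continuum limit.) As $n\to\infty$, $\mathcal F_\Omega\to4$, $\mathcal G_\Omega\to0$ and $\mathcal H_\Omega\to0$ uniformly for $(b,\Pi)$ in bounded sets. Let $R>r_0$, let $a,b,p_b$ be continuous and $p_a$ continuously differentiable on $(0,R)$, with $p_b$ nowhere zero there. For each $n$ consider the lattice point, with boundary values, given by $a_\varepsilon(v_r)=\int_0^1a(v_r+s\varepsilon_r)\,ds$, $b_\varepsilon(v_r)=b(v_r)$, $p_a^\varepsilon(v_r)=(\mathrm{sgn}(p_b)\,p_a)(v_r+\frac{\varepsilon_r}2)$, $p_b^\varepsilon(v_r)=\int_{-1/2}^{1/2}|p_b(v_r+s\varepsilon_r)|\,ds$, and suppose that for all large $n$ it satisfies $F^b_{p_b}(v_r)\ne0$ for all $v_r$. For continuous $f,g$ with support in $(0,r_0)$, let $\{c[f],c'[g]\}_n$ ($c,c'\in\{a,b,p_a,p_b\}$) be the bracket at this point of the smeared lattice functions $a[f]=\sum_{v_r}\varepsilon_rf(v_r)a_\varepsilon(v_r)$, $b[f]=\sum_{v_r}\varepsilon_rf(v_r)b_\varepsilon(v_r)$, $p_a[f]=\sum_{v_r}\varepsilon_rf(v_r)\,\mathrm{sgn}(p_b(v_r))\,p_a^\varepsilon(v_r)$,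 $p_b[f]=\sum_{v_r}\varepsilon_rf(v_r)\,\mathrm{sgn}(p_b(v_r))\,p_b^\varepsilon(v_r)$, the signs being those of the given continuum field. Then $$\{a[f],p_a[g]\}_n\to\frac{\kappa\beta}{8\pi}\int_0^{r_0}\mathrm{sgn}(p_b)\,fg\,dr,\qquad\{b[f],p_b[g]\}_n\to\frac{\kappa\beta}{16\pi}\int_0^{r_0}\mathrm{sgn}(p_b)\,fg\,dr,$$ and all other brackets (up to antisymmetry) tend to $0$; that is, one recovers the continuum algebra $\{a(r),p_a(r')\}=\frac{\kappa\beta}{8\pi}\mathrm{sgn}(p_b)\,\delta(r-r')=2\{b(r),p_b(r')\}$. -/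

import Mathlib

namespace SphericalLattice

open scoped Matrix

/-! ### The Lie algebra su(2) -/

/-- Complex `2 × 2` matrices. -/
abbrev Mat2 : Type := Matrix (Fin 2) (Fin 2) ℂ

/-- The basis `τ_I = -(i/2) σ_I` of `su(2)`; the index `I = 1, 2, 3` is shifted to `0, 1, 2`. -/
noncomputable def tau : Fin 3 → Mat2 :=
  ![(-(Complex.I / 2)) • !![0, 1; 1, 0],
    (-(Complex.I / 2)) • !![0, -Complex.I; Complex.I, 0],
    (-(Complex.I / 2)) • !![1, 0; 0, -1]]

/-- The element `u^I τ_I` of `su(2)`. -/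
noncomputable def su2 (u : Fin 3 → ℝ) : Mat2 := ∑ I, (u I : ℂ) • tau I

/-- The component `M^I = -2 tr (M τ_I)` of `M ∈ su(2)`. -/
noncomputable def suComp (M : Mat2) (I : Fin 3) : ℝ := (-2 * (M * tau I).trace).re

/-- The Levi-Civita symbol. -/
noncomputable def leviCivita (I J K : Fin 3) : ℝ :=
  (((J : ℕ) : ℝ) - ((I : ℕ) : ℝ)) * (((K : ℕ) : ℝ) - ((I : ℕ) : ℝ)) *
    (((K : ℕ) : ℝ) - ((J : ℕ) : ℝ)) / 2

/-! ### The spherical graph and its holonomy-flux phase space -/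

/-- The three positive edge directions. -/
inductive Dir : Type
  | radial
  | polar
  | azimuthal
  deriving DecidableEq

instance : Fintype Dir :=
  ⟨{.radial, .polar, .azimuthal}, by intro x; cases x <;> simp⟩

/-- Edge labels `(j_r, j_θ, j_φ, i)`. All three indices are counted from zero, so that the edge
starts at `r = (j_r + 1) ε_r`, `θ = j_θ ε_θ` and `φ = (j_φ + 1) ε_φ`. -/
abbrev Edge (n : ℕ) : Type := Fin n × Fin (n + 1) × Fin n × Dir

/-- A pair of matrices `(h_e, P_e)` for every edge. The holonomy-flux phase space is the subset
`holonomyFluxSpace`, and tangent vectors `(δh_e, δP_e)` to it have the same shape. -/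
abbrev EdgeData (n : ℕ) : Type := Edge n → Mat2 × Mat2

/-- `M_γ = ∏_e SU(2) × su(2)`. -/
def holonomyFluxSpace (n : ℕ) : Set (EdgeData n) :=
  {m | ∀ e, (m e).1 ∈ Matrix.specialUnitaryGroup (Fin 2) ℂ ∧
    (m e).2ᴴ = -(m e).2 ∧ (m e).2.trace = 0}

/-- The components `Θ_e^I = (h_e† δh_e)^I` of the left-invariant Maurer-Cartan form. -/
noncomputable def maurerCartan {n : ℕ} (m X : EdgeData n) (e : Edge n) (I : Fin 3) : ℝ :=
  suComp ((m e).1ᴴ * (X e).1) I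

/-- The holonomy-flux symplectic form
`ω_γ = (2/κβ) ∑_e (δ_IJ Θ_e^I ∧ δP_e^J + (1/2) ε_IJK P_e^I Θ_e^J ∧ Θ_e^K)` at `m`, evaluated on
two tangent vectors, with `(α ∧ β)(X, Y) = α(X) β(Y) - α(Y) β(X)`. -/
noncomputable def omegaGamma (κ β : ℝ) {n : ℕ} (m X Y : EdgeData n) : ℝ :=
  2 / (κ * β) * ∑ e : Edge n,
    (∑ I, (maurerCartan m X e I * suComp (Y e).2 I - maurerCartan m Y e I * suComp (X e).2 I) +
      1 / 2 * ∑ I, ∑ J, ∑ K, leviCivita I J K * suComp (m e).2 I *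
        (maurerCartan m X e J * maurerCartan m Y e K -
          maurerCartan m Y e J * maurerCartan m X e K))

/-! ### The spherically symmetric subspace -/

/-- The four kinds of coordinates `a_ε`, `b_ε`, `p_a^ε`, `p_b^ε`. -/
inductive Coord : Type
  | a
  | b
  | pa
  | pb
  deriving DecidableEq

instance : Fintype Coord :=
  ⟨{.a, .b, .pa, .pb}, by intro x; cases x <;> simp⟩

/-- Coordinates `x c v` of a point of the reduced phase space, one of each kind at each of the `n`
radial vertices; the vertex `v : Fin n` is at radius `(v + 1) ε_r`. -/
abbrev Phase (n : ℕ) : Type := Coord → Fin n → ℝ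

noncomputable def epsR (r₀ : ℝ) (n : ℕ) : ℝ := r₀ / n

noncomputable def epsTheta (n : ℕ) : ℝ := Real.pi / n

noncomputable def epsPhi (n : ℕ) : ℝ := 2 * Real.pi / n

/-- The radius of the vertex `v`. -/
noncomputable def radius (r₀ : ℝ) {n : ℕ} (v : Fin n) : ℝ := ((v : ℕ) + 1) * epsR r₀ n

/-- The polar angle of the vertices with index `j`. -/
noncomputable def polarAngle (n : ℕ) (j : Fin (n + 1)) : ℝ := (j : ℕ) * epsTheta n

/-- Extension of a lattice function to the indices `0, 1, …, n, n + 1`, where index `k` is the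
radius `k ε_r`: the value is `c₀` at radius `0` and `c₁` at radius `r₀ + ε_r`. -/
def extendLattice {n : ℕ} (c₀ c₁ : ℝ) (f : Fin n → ℝ) (k : ℕ) : ℝ :=
  if k = 0 then c₀ else if h : k - 1 < n then f ⟨k - 1, h⟩ else c₁

/-- The central difference `Δ_r f(v) = (f(v + ε_r) - f(v - ε_r)) / (2 ε_r)` with boundary values
`c₀` and `c₁`. -/
noncomputable def centralDiff (r₀ c₀ c₁ : ℝ) {n : ℕ} (f : Fin n → ℝ) (v : Fin n) : ℝ :=
  (extendLattice c₀ c₁ f ((v : ℕ) + 2) - extendLattice c₀ c₁ f (v : ℕ)) / (2 * epsR r₀ n)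

/-- `Π_ε = Δ_r p_a^ε / (2 p_b^ε)`, where `c₀` and `c₁` are the fixed values of `p_a^ε` at the two
radii next to the lattice. -/
noncomputable def capPi (r₀ c₀ c₁ : ℝ) {n : ℕ} (x : Phase n) (v : Fin n) : ℝ :=
  centralDiff r₀ c₀ c₁ (x .pa) v / (2 * x .pb v)

/-- The spherically symmetric holonomies. -/
noncomputable def holonomy (r₀ c₀ c₁ : ℝ) {n : ℕ} (x : Phase n) : Edge n → Mat2
  | (v, _, _, .radial) => NormedSpace.exp (su2 ![epsR r₀ n * x .a v, 0, 0])
  | (v, _, _, .polar) =>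
      NormedSpace.exp (su2 ![0, epsTheta n * x .b v, epsTheta n * capPi r₀ c₀ c₁ x v])
  | (v, j, _, .azimuthal) =>
      NormedSpace.exp (su2 ![epsPhi n * Real.cos (polarAngle n j),
        -(epsPhi n * (capPi r₀ c₀ c₁ x v * Real.sin (polarAngle n j))),
        epsPhi n * (x .b v * Real.sin (polarAngle n j))])

/-- The spherically symmetric fluxes. -/
noncomputable def flux (r₀ : ℝ) {n : ℕ} (x : Phase n) : Edge n → Mat2
  | (v, j, _, .radial) =>
      su2 ![epsTheta n * epsPhi n * Real.sinc (epsTheta n / 2) * x .pa v *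
        Real.sin (polarAngle n j), 0, 0]
  | (v, j, _, .polar) =>
      su2 ![0, epsPhi n * epsR r₀ n * x .pb v * Real.sin (polarAngle n j + epsTheta n / 2), 0]
  | (v, _, _, .azimuthal) => su2 ![0, 0, epsR r₀ n * epsTheta n * x .pb v]

/-- The parametrisation of the spherically symmetric subspace of the holonomy-flux phase space. -/
noncomputable def symEmbed (r₀ c₀ c₁ : ℝ) {n : ℕ} (x : Phase n) : EdgeData n :=
  fun e => (holonomy r₀ c₀ c₁ x e, flux r₀ x e)

/-- The push-forward of `X` under `symEmbed` at `x`, computed entry by entry. -/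
noncomputable def tangentEmbed (r₀ c₀ c₁ : ℝ) {n : ℕ} (x X : Phase n) : EdgeData n :=
  fun e =>
    (Matrix.of fun i j => fderiv ℝ (fun y : Phase n => (symEmbed r₀ c₀ c₁ y e).1 i j) x X,
      Matrix.of fun i j => fderiv ℝ (fun y : Phase n => (symEmbed r₀ c₀ c₁ y e).2 i j) x X)

/-- The restriction (pull-back) of `ω_γ` to the spherically symmetric subspace. -/
noncomputable def omegaSym (κ β r₀ c₀ c₁ : ℝ) {n : ℕ} (x X Y : Phase n) : ℝ :=
  omegaGamma κ β (symEmbed r₀ c₀ c₁ x) (tangentEmbed r₀ c₀ c₁ x X) (tangentEmbed r₀ c₀ c₁ x Y)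

/-! ### Structure functions -/

/-- `num / lam ^ 2`, with the value `lim` at `lam = 0`. It is used only for quotients that have the
limit `lim` there. -/
noncomputable def divSq (lim num lam : ℝ) : ℝ := if lam = 0 then lim else num / lam ^ 2

noncomputable def lamTheta (b P : ℝ) : ℝ := Real.sqrt (b ^ 2 + P ^ 2)

noncomputable def lamPhi (θ b P : ℝ) : ℝ :=
  Real.sqrt (Real.cos θ ^ 2 + (b ^ 2 + P ^ 2) * Real.sin θ ^ 2)

/-- The structure function `F_Ω(b, Π)`. -/
noncomputable def structF (n : ℕ) (b P : ℝ) : ℝ :=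
  epsTheta n *
    (divSq 1 (b ^ 2 + P ^ 2 * Real.sinc (epsTheta n * lamTheta b P)) (lamTheta b P) *
        Real.cos (epsTheta n / 2) * Real.cot (epsTheta n / 2) +
      ∑ j : Fin (n + 1),
        divSq 1
          (b ^ 2 * Real.sin (polarAngle n j) ^ 2 +
            (Real.cos (polarAngle n j) ^ 2 + P ^ 2 * Real.sin (polarAngle n j) ^ 2) *
              Real.sinc (epsPhi n * lamPhi (polarAngle n j) b P))
          (lamPhi (polarAngle n j) b P) * Real.sin (polarAngle n j))

/-- The structure function `G_Ω(b, Π)`. -/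
noncomputable def structG (n : ℕ) (b P : ℝ) : ℝ :=
  epsTheta n *
    (divSq (epsTheta n ^ 2 / 6) (1 - Real.sinc (epsTheta n * lamTheta b P)) (lamTheta b P) *
        Real.cos (epsTheta n / 2) * Real.cot (epsTheta n / 2) +
      ∑ j : Fin (n + 1),
        divSq (epsPhi n ^ 2 / 6) (1 - Real.sinc (epsPhi n * lamPhi (polarAngle n j) b P))
          (lamPhi (polarAngle n j) b P) * Real.sin (polarAngle n j) ^ 3)

/-- The structure function `H_Ω(b, Π)`, in closed form. -/
noncomputable def structH (n : ℕ) (b P : ℝ) : ℝ :=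
  epsTheta n / 2 *
    (epsTheta n ^ 2 * Real.sinc (epsTheta n * lamTheta b P / 2) ^ 2 *
        Real.cos (epsTheta n / 2) * Real.cot (epsTheta n / 2) +
      epsPhi n ^ 2 * ∑ j : Fin (n + 1),
        Real.sinc (epsPhi n / 2 * lamPhi (polarAngle n j) b P) ^ 2 *
          Real.sin (polarAngle n j) ^ 3)

/-- `F_Ω` at the vertex `v`. -/
noncomputable def FOm (r₀ c₀ c₁ : ℝ) {n : ℕ} (x : Phase n) (v : Fin n) : ℝ :=
  structF n (x .b v) (capPi r₀ c₀ c₁ x v)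

/-- `G_Ω` at the vertex `v`. -/
noncomputable def GOm (r₀ c₀ c₁ : ℝ) {n : ℕ} (x : Phase n) (v : Fin n) : ℝ :=
  structG n (x .b v) (capPi r₀ c₀ c₁ x v)

/-- `H_Ω` at the vertex `v`. -/
noncomputable def HOm (r₀ c₀ c₁ : ℝ) {n : ℕ} (x : Phase n) (v : Fin n) : ℝ :=
  structH n (x .b v) (capPi r₀ c₀ c₁ x v)

/-- The coefficient `F^b_{p_b} = (4π/κβ) ε_r (F_Ω + H_Ω Π_ε²)`. -/
noncomputable def Fbpb (κ β r₀ c₀ c₁ : ℝ) {n : ℕ} (x : Phase n) (v : Fin n) : ℝ :=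
  4 * Real.pi / (κ * β) * epsR r₀ n *
    (FOm r₀ c₀ c₁ x v + HOm r₀ c₀ c₁ x v * capPi r₀ c₀ c₁ x v ^ 2)

/-! ### Poisson brackets -/

/-- `X` is a Hamiltonian vector of `f` at `x`: `ι_X ω = δf`. -/
def IsHamiltonianVector {n : ℕ} (ω : Phase n → Phase n → Phase n → ℝ) (f : Phase n → ℝ)
    (x X : Phase n) : Prop :=
  ∀ Y, ω x X Y = fderiv ℝ f x Y

open Classical in
/-- The Hamiltonian vector of `f` at `x` if there is exactly one, and `0` otherwise. -/
noncomputable def hamiltonianVector {n : ℕ} (ω : Phase n → Phase n → Phase n → ℝ)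
    (f : Phase n → ℝ) (x : Phase n) : Phase n :=
  if h : ∃! X, IsHamiltonianVector ω f x X then h.choose else 0

/-- `{f, g} = ι_{X_g} ι_{X_f} ω`. -/
noncomputable def poissonBracket {n : ℕ} (ω : Phase n → Phase n → Phase n → ℝ)
    (f g : Phase n → ℝ) (x : Phase n) : ℝ :=
  ω x (hamiltonianVector ω f x) (hamiltonianVector ω g x)

/-- The bracket `{c(v), c'(v')}` of two coordinate functions for the restricted form. -/
noncomputable def coordBracket (κ β r₀ c₀ c₁ : ℝ) {n : ℕ} (x : Phase n) (c : Coord) (v : Fin n)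
    (c' : Coord) (v' : Fin n) : ℝ :=
  poissonBracket (omegaSym κ β r₀ c₀ c₁) (fun y => y c v) (fun y => y c' v') x

/-- The Kronecker symbol `δ_{v, v'}`. -/
def kron {n : ℕ} (v v' : Fin n) : ℝ := if v = v' then 1 else 0

/-- The Kronecker symbol `δ_{v, v' + ε_r}`. -/
def kronSucc {n : ℕ} (v v' : Fin n) : ℝ := if (v : ℕ) = (v' : ℕ) + 1 then 1 else 0

/-! ### Sampling of continuum fields -/

/-- Radial functions `a`, `b`, `p_a`, `p_b` of a spherically symmetric continuum configuration. -/
structure ContinuumFields : Type where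
  a : ℝ → ℝ
  b : ℝ → ℝ
  pa : ℝ → ℝ
  pb : ℝ → ℝ

/-- `a_ε(r) = ∫_0^1 a(r + s ε_r) ds`. -/
noncomputable def aEps (φ : ContinuumFields) (ε r : ℝ) : ℝ := ∫ s in (0 : ℝ)..1, φ.a (r + s * ε)

/-- `p_a^ε(r) = sgn(p_b(r + ε_r/2)) p_a(r + ε_r/2)`. -/
noncomputable def paEps (φ : ContinuumFields) (ε r : ℝ) : ℝ :=
  Real.sign (φ.pb (r + ε / 2)) * φ.pa (r + ε / 2)

/-- `p_b^ε(r) = ∫_{-1/2}^{1/2} |p_b(r + s ε_r)| ds`. -/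
noncomputable def pbEps (φ : ContinuumFields) (ε r : ℝ) : ℝ :=
  ∫ s in (-(1 / 2) : ℝ)..(1 / 2), |φ.pb (r + s * ε)|

/-- The point of the reduced phase space determined by a continuum configuration. -/
noncomputable def samplePoint (φ : ContinuumFields) (r₀ : ℝ) (n : ℕ) : Phase n
  | .a, v => aEps φ (epsR r₀ n) (radius r₀ v)
  | .b, v => φ.b (radius r₀ v)
  | .pa, v => paEps φ (epsR r₀ n) (radius r₀ v)
  | .pb, v => pbEps φ (epsR r₀ n) (radius r₀ v)

/-- The value of `p_a^ε` at radius `0`. -/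
noncomputable def innerValue (φ : ContinuumFields) (r₀ : ℝ) (n : ℕ) : ℝ := paEps φ (epsR r₀ n) 0

/-- The value of `p_a^ε` at radius `r₀ + ε_r`. -/
noncomputable def outerValue (φ : ContinuumFields) (r₀ : ℝ) (n : ℕ) : ℝ :=
  paEps φ (epsR r₀ n) (r₀ + epsR r₀ n)

/-- The lattice momenta `p_a^ε`, `p_b^ε` approximate `sgn(p_b) p_a` and `sgn(p_b) p_b`. This factor,
which is locally constant where `p_b` does not vanish, converts them back. -/
noncomputable def signFactor (φ : ContinuumFields) (c : Coord) (r : ℝ) : ℝ :=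
  match c with
  | .a => 1
  | .b => 1
  | .pa => Real.sign (φ.pb r)
  | .pb => Real.sign (φ.pb r)

/-- The lattice version of the smeared field `∫ f(r) c(r) dr`, for `c = a, b, p_a, p_b`. -/
noncomputable def smeared (φ : ContinuumFields) (r₀ : ℝ) {n : ℕ} (c : Coord) (f : ℝ → ℝ)
    (y : Phase n) : ℝ :=
  ∑ v : Fin n, epsR r₀ n * f (radius r₀ v) * (signFactor φ c (radius r₀ v) * y c v)

/-- The coefficient `k` in the continuum algebra `{c(r), c'(r')} = k sgn(p_b) δ(r - r')`. -/
noncomputable def continuumCoeff (κ β : ℝ) : Coord → Coord → ℝ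
  | .a, .pa => κ * β / (8 * Real.pi)
  | .pa, .a => -(κ * β / (8 * Real.pi))
  | .b, .pb => κ * β / (16 * Real.pi)
  | .pb, .b => -(κ * β / (16 * Real.pi))
  | _, _ => 0

end SphericalLattice

open SphericalLattice

/-!
# The symplectic structure of the spherically symmetric lattice

The vectors `u` with `h_e = exp (u^I τ_I)` turn everything into vector calculus on `ℝ³`. Writing
matrices as quaternions (`quat`), Euler's formula `exp_su2` gives the exponential in closed form,
and differentiating it gives the Maurer-Cartan form
`h⁻¹ δh = δu - C(|u|²) u × δu + D(|u|²) u × (u × δu)` (`mcForm`), with `C(x) = (1 - cos √x) / x` and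
`D(x) = (1 - sinc √x) / x`. The derivative exists at `u = 0` as well, which is why the structure
functions take their limit values there.

The structure functions are trigonometric sums of rescaled copies of `C` and `D` (`structF_eq`,
`structG_eq`, `structH_eq`), since `b² + Π² sinc = λ² - Π² (1 - sinc)`. The relation between
`H_Ω`, `G_Ω` and `F_Ω` then reduces to the differential equation `2 y D' + 3 D = C`, that is to
`d/dλ (λ³ D(λ²)) = 1 - cos λ` (`exists_hasDerivAt_mcDScaled`).

For the pull-back, the two-form of each kind of edge is computed in `edgeForm_radial`,
`edgeForm_polar` and `edgeForm_azimuthal`. The azimuthal edges contribute an additional part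
proportional to `cos θ`; it is odd under `θ ↦ π - θ` and cancels in the sum over the vertices
(`sum_cos_polarAngle_mul_eq_zero`). The remaining sums over the polar angles are telescoping, and
`omegaSym_eq_reducedForm` follows.

The restricted form is block triangular: the equation `ι_X ω = ℓ` determines first the components
`p_a` of `X`, then `b` and `p_b`, and finally `a`, where the central difference is moved to the
other factor by summation by parts. `blockSharp` is this solution; non-degeneracy, existence and
uniqueness of Hamiltonian vectors and all brackets are read off from it. The bracket of `a` with `b`
is non-zero between neighbours because `G_Ω > 0`.

In the continuum limit `F_Ω → 4`, while `G_Ω` and `H_Ω` are `O(1/n²)`. On the support of the test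
functions `b_ε`, `Π_ε` and `1 / p_b^ε` remain bounded, the diagonal brackets are Riemann sums with
uniformly convergent weights (`tendsto_weighted_riemann_sum`), and each off-diagonal bracket is a
sum of `n` terms of order `1/n²` (`tendsto_off_diagonal_sum`).
-/

namespace SphericalLattice

open scoped Matrix

/-! ### The exponential map of `SU(2)` -/

/-- The matrix `α + w^I τ_I`; the unit quaternions among these make up `SU(2)`. -/
noncomputable def quat (α : ℝ) (w : Fin 3 → ℝ) : Mat2 := (α : ℂ) • 1 + su2 w

theorem quat_eq (α : ℝ) (w : Fin 3 → ℝ) :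
    quat α w = !![(α : ℂ) - Complex.I / 2 * w 2, -(Complex.I / 2 * w 0) - w 1 / 2;
      -(Complex.I / 2 * w 0) + w 1 / 2, (α : ℂ) + Complex.I / 2 * w 2] := by
  ext i j
  fin_cases i <;> fin_cases j <;>
    simp [quat, su2, tau, Fin.sum_univ_three] <;> ring_nf <;> simp <;> ring

theorem su2_eq_quat (w : Fin 3 → ℝ) : su2 w = quat 0 w := by simp [quat]

theorem quat_mul (α β : ℝ) (u w : Fin 3 → ℝ) :
    quat α u * quat β w =
      quat (α * β - (u ⬝ᵥ w) / 4) (α • w + β • u + (1 / 2 : ℝ) • (crossProduct u w)) := by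
  have hI : (Complex.I : ℂ) ^ 2 = -1 := Complex.I_sq
  simp only [quat_eq, cross_apply]
  ext i j
  fin_cases i <;> fin_cases j <;>
    simp [Matrix.mul_apply, dotProduct, Fin.sum_univ_three]
  · linear_combination ((u 0 : ℂ) * w 0 + u 2 * w 2) / 4 * hI
  · linear_combination ((u 2 : ℂ) * w 0 - u 0 * w 2) / 4 * hI
  · linear_combination ((u 0 : ℂ) * w 2 - u 2 * w 0) / 4 * hI
  · linear_combination ((u 0 : ℂ) * w 0 + u 2 * w 2) / 4 * hI

theorem quat_conjTranspose (α : ℝ) (w : Fin 3 → ℝ) : (quat α w)ᴴ = quat α (-w) := by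
  simp only [quat_eq]
  ext i j
  fin_cases i <;> fin_cases j <;> simp [Matrix.conjTranspose_apply] <;> ring

theorem suComp_quat (α : ℝ) (w : Fin 3 → ℝ) (I : Fin 3) : suComp (quat α w) I = w I := by
  rw [suComp, quat_eq]
  fin_cases I <;>
    simp [tau, Matrix.trace_fin_two, Complex.mul_re, Complex.mul_im] <;> ring

theorem suComp_su2 (w : Fin 3 → ℝ) (I : Fin 3) : suComp (su2 w) I = w I := by
  rw [su2_eq_quat, suComp_quat]

theorem quat_one_zero : quat 1 0 = 1 := by simp [quat, su2]

theorem det_quat (α : ℝ) (w : Fin 3 → ℝ) :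
    (quat α w).det = ((α ^ 2 + (w ⬝ᵥ w) / 4 : ℝ) : ℂ) := by
  have hI : (Complex.I : ℂ) ^ 2 = -1 := Complex.I_sq
  rw [quat_eq, Matrix.det_fin_two]
  simp [dotProduct, Fin.sum_univ_three]
  linear_combination (-((w 0 : ℂ) * w 0 + w 2 * w 2) / 4) * hI

theorem quat_mem_specialUnitaryGroup {α : ℝ} {w : Fin 3 → ℝ} (h : α ^ 2 + (w ⬝ᵥ w) / 4 = 1) :
    quat α w ∈ Matrix.specialUnitaryGroup (Fin 2) ℂ := by
  rw [Matrix.mem_specialUnitaryGroup_iff, Matrix.mem_unitaryGroup_iff', det_quat, h]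
  refine ⟨?_, by simp⟩
  rw [Matrix.star_eq_conjTranspose, quat_conjTranspose, quat_mul, ← quat_one_zero, ← h]
  congr 1
  · simp; ring
  · simp

/-- The algebra embedding of the quaternions with `i, j, k ↦ 2 τ_1, 2 τ_2, 2 τ_3`. -/
noncomputable def quatHom : Quaternion ℝ →ₐ[ℝ] Mat2 :=
  QuaternionAlgebra.Basis.liftHom
    { i := quat 0 ![2, 0, 0]
      j := quat 0 ![0, 2, 0]
      k := quat 0 ![0, 0, 2]
      i_mul_i := by
        rw [quat_mul, quat_eq]
        ext i j
        fin_cases i <;> fin_cases j <;> simp [dotProduct, Fin.sum_univ_three] <;> norm_num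
      j_mul_j := by
        rw [quat_mul, quat_eq]
        ext i j
        fin_cases i <;> fin_cases j <;> simp [dotProduct, Fin.sum_univ_three] <;> norm_num
      i_mul_j := by
        rw [quat_mul]
        congr 1
        · simp [dotProduct, Fin.sum_univ_three]
        · ext i; fin_cases i <;> simp [cross_apply]
      j_mul_i := by
        simp only [zero_smul, zero_sub]
        rw [quat_mul, quat_eq, quat_eq]
        ext i j
        fin_cases i <;> fin_cases j <;> simp [dotProduct, Fin.sum_univ_three, cross_apply] }

theorem quatHom_apply (q : Quaternion ℝ) :
    quatHom q = quat q.re ((2 : ℝ) • ![q.imI, q.imJ, q.imK]) := by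
  have : quatHom q = algebraMap ℝ Mat2 q.re + q.imI • quat 0 ![2, 0, 0] +
    q.imJ • quat 0 ![0, 2, 0] + q.imK • quat 0 ![0, 0, 2] := rfl
  rw [this, quat_eq, quat_eq, quat_eq, quat_eq]
  ext i j
  fin_cases i <;> fin_cases j <;> simp [Matrix.algebraMap_matrix_apply] <;> ring

theorem dotProduct_self_nonneg_real {m : Type*} [Fintype m] (u : m → ℝ) : 0 ≤ u ⬝ᵥ u :=
  Finset.sum_nonneg fun i _ => mul_self_nonneg (u i)

/-- Euler's formula: the exponential of `u^I τ_I` is a unit quaternion. -/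
theorem exp_su2 (u : Fin 3 → ℝ) :
    NormedSpace.exp (su2 u) = quat (Real.cos (√(u ⬝ᵥ u) / 2)) (Real.sinc (√(u ⬝ᵥ u) / 2) • u) := by
  set q : Quaternion ℝ := ⟨0, u 0 / 2, u 1 / 2, u 2 / 2⟩ with hq
  have hs : su2 u = quatHom q := by
    rw [quatHom_apply, su2_eq_quat]
    congr 1
    ext i; fin_cases i <;> simp [hq] <;> ring
  have hn : ‖q‖ = √(u ⬝ᵥ u) / 2 := by
    rw [← Real.sqrt_sq (norm_nonneg q), sq, ← Quaternion.normSq_eq_norm_mul_self,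
      Quaternion.normSq_def', show √(u ⬝ᵥ u) / 2 = √(u ⬝ᵥ u) / √(2 ^ 2) by simp,
      ← Real.sqrt_div (dotProduct_self_nonneg_real u)]
    congr 1
    simp [hq, dotProduct, Fin.sum_univ_three]; ring
  have hc : Continuous (quatHom : Quaternion ℝ → Mat2) :=
    LinearMap.continuous_of_finiteDimensional quatHom.toLinearMap
  let _ := Matrix.linftyOpNormedRing (n := Fin 2) (α := ℂ)
  let _ := Matrix.linftyOpNormedAlgebra (n := Fin 2) (R := ℝ) (α := ℂ)
  let _ : NormedAlgebra ℚ (Quaternion ℝ) := .restrictScalars ℚ ℝ (Quaternion ℝ)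
  have hm := NormedSpace.map_exp quatHom hc q
  rw [hs]
  refine hm.symm.trans ?_
  have h0 : q.re = 0 := rfl
  have h1 : q.imI = u 0 / 2 := rfl
  have h2 : q.imJ = u 1 / 2 := rfl
  have h3 : q.imK = u 2 / 2 := rfl
  rw [Quaternion.exp_of_re_eq_zero q h0, hn, quatHom_apply]
  have hsc : ∀ i, Real.sin (√(u ⬝ᵥ u) / 2) / (√(u ⬝ᵥ u) / 2) * u i =
      Real.sinc (√(u ⬝ᵥ u) / 2) * u i := by
    intro i
    by_cases h : √(u ⬝ᵥ u) / 2 = 0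
    · have : u = 0 := dotProduct_self_eq_zero.1
        ((Real.sqrt_eq_zero (dotProduct_self_nonneg_real u)).1 (by linarith))
      simp [this]
    · rw [Real.sinc_of_ne_zero h]
  clear_value q
  congr 1
  · simp [h0]
  · ext i
    fin_cases i
    · simp [h1]; linear_combination hsc 0
    · simp [h2]; linear_combination hsc 1
    · simp [h3]; linear_combination hsc 2

theorem exp_su2_mem_specialUnitaryGroup (u : Fin 3 → ℝ) :
    NormedSpace.exp (su2 u) ∈ Matrix.specialUnitaryGroup (Fin 2) ℂ := by
  rw [exp_su2]
  apply quat_mem_specialUnitaryGroup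
  have h : √(u ⬝ᵥ u) ^ 2 = u ⬝ᵥ u := Real.sq_sqrt (dotProduct_self_nonneg_real u)
  set ρ := √(u ⬝ᵥ u) with hρ
  rw [smul_dotProduct, dotProduct_smul, ← h]
  by_cases h0 : ρ = 0
  · simp [h0]
  · rw [Real.sinc_of_ne_zero (by positivity), ← Real.cos_sq_add_sin_sq (ρ / 2)]
    simp only [smul_eq_mul]; field_simp; ring

theorem su2_conjTranspose (w : Fin 3 → ℝ) : (su2 w)ᴴ = -su2 w := by
  rw [su2_eq_quat, quat_conjTranspose, quat_eq, quat_eq]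
  ext i j
  fin_cases i <;> fin_cases j <;> simp <;> ring

theorem su2_trace (w : Fin 3 → ℝ) : (su2 w).trace = 0 := by
  rw [su2_eq_quat, quat_eq, Matrix.trace_fin_two]; simp

/-! ### The Maurer-Cartan form in exponential coordinates -/

/-- The function `(1 - cos √x) / x`, in the form `sinc² (√x / 2) / 2`. -/
noncomputable def mcC (x : ℝ) : ℝ := Real.sinc (√x / 2) ^ 2 / 2

/-- The function `(1 - sinc √x) / x`, with value `1/6` at `x = 0`. -/
noncomputable def mcD (x : ℝ) : ℝ := divSq (1 / 6) (1 - Real.sinc √x) √x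

theorem mul_mcC {x : ℝ} (hx : 0 ≤ x) : x * mcC x = 1 - Real.cos √x := by
  have h : √x ^ 2 = x := Real.sq_sqrt hx
  have hc : Real.cos √x = 1 - 2 * Real.sin (√x / 2) ^ 2 := by
    rw [show √x = 2 * (√x / 2) by ring, Real.cos_two_mul, show 2 * (√x / 2) / 2 = √x / 2 by ring]
    linear_combination 2 * Real.cos_sq_add_sin_sq (√x / 2)
  rw [hc, mcC]
  by_cases h0 : √x = 0
  · have : x = 0 := by rw [← h, h0]; norm_num
    simp [this]
  · rw [Real.sinc_of_ne_zero (by positivity)]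
    nth_rewrite 1 [← h]
    field_simp; ring

theorem mul_mcD {x : ℝ} (hx : 0 ≤ x) : x * mcD x = 1 - Real.sinc √x := by
  have h : √x ^ 2 = x := Real.sq_sqrt hx
  rw [mcD, divSq]
  split_ifs with h0
  · have : x = 0 := by rw [← h, h0]; norm_num
    simp [this]
  · nth_rewrite 1 [← h]
    field_simp

/-- The left logarithmic derivative of `u ↦ exp (u^I τ_I)` in the direction `δ`. -/
noncomputable def mcForm (u δ : Fin 3 → ℝ) : Fin 3 → ℝ :=
  δ - mcC (u ⬝ᵥ u) • crossProduct u δ + mcD (u ⬝ᵥ u) • crossProduct u (crossProduct u δ)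

/-- A product whose second factor vanishes at the base point is differentiable there as soon as the
first factor is continuous. -/
theorem hasFDerivAt_smul_of_continuousAt {E F : Type*} [NormedAddCommGroup E] [NormedSpace ℝ E]
    [NormedAddCommGroup F] [NormedSpace ℝ F] {k : E → ℝ} {q : E → F} {q' : E →L[ℝ] F} {x : E}
    (hk : ContinuousAt k x) (hq : HasFDerivAt q q' x) (h0 : q x = 0) :
    HasFDerivAt (fun y => k y • q y) (k x • q') x := by
  rw [hasFDerivAt_iff_isLittleO] at hq ⊢
  have hO : q =O[nhds x] fun y => y - x := by
    simpa [h0] using (hasFDerivAt_iff_isLittleO.2 hq).isBigO_sub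
  have hk' : (fun y => k y - k x) =o[nhds x] fun _ => (1 : ℝ) := by
    rw [Asymptotics.isLittleO_one_iff]
    simpa using hk.tendsto.sub_const (k x)
  have h1 : (fun y => (k y - k x) • q y) =o[nhds x] fun y => y - x := by
    rw [← Asymptotics.isLittleO_norm_right]
    simpa using hk'.smul_isBigO hO.norm_right
  refine (h1.add (hq.const_smul_left (k x))).congr_left fun y => ?_
  simp [h0, sub_smul, smul_sub]

theorem hasFDerivAt_dotProduct_self (u : Fin 3 → ℝ) :
    HasFDerivAt (fun v : Fin 3 → ℝ => v ⬝ᵥ v)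
      (∑ i, (2 * u i) • ContinuousLinearMap.proj (R := ℝ) (φ := fun _ : Fin 3 => ℝ) i) u := by
  have : ∀ i ∈ (Finset.univ : Finset (Fin 3)), HasFDerivAt (fun v : Fin 3 → ℝ => v i * v i)
      ((2 * u i) • ContinuousLinearMap.proj (R := ℝ) (φ := fun _ : Fin 3 => ℝ) i) u := by
    intro i _
    refine ((hasFDerivAt_apply i u).mul (hasFDerivAt_apply i u)).congr_fderiv ?_
    ext δ; simp; ring
  exact HasFDerivAt.fun_sum this

theorem hasDerivAt_sinc {t : ℝ} (ht : t ≠ 0) :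
    HasDerivAt Real.sinc ((Real.cos t - Real.sinc t) / t) t := by
  have h := (Real.hasDerivAt_sin t).div (hasDerivAt_id t) ht
  have he : Real.sinc =ᶠ[nhds t] fun s => Real.sin s / id s := by
    filter_upwards [isOpen_ne.mem_nhds ht] with s hs using Real.sinc_of_ne_zero hs
  refine (h.congr_of_eventuallyEq he).congr_deriv ?_
  rw [Real.sinc_of_ne_zero ht]
  simp; field_simp

theorem sinc_mul_cos_half (t : ℝ) : Real.cos (t / 2) * Real.sinc (t / 2) = Real.sinc t := by
  by_cases h : t = 0
  · simp [h]
  · rw [Real.sinc_of_ne_zero h, Real.sinc_of_ne_zero (by positivity)]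
    have : Real.sin t = 2 * Real.sin (t / 2) * Real.cos (t / 2) := by
      rw [← Real.sin_two_mul]; ring_nf
    rw [this]; field_simp

theorem cos_half_sq_add (t : ℝ) :
    Real.cos (t / 2) ^ 2 + Real.sinc (t / 2) ^ 2 * t ^ 2 / 4 = 1 := by
  by_cases h : t = 0
  · simp [h]
  · rw [← Real.cos_sq_add_sin_sq (t / 2), Real.sinc_of_ne_zero (by positivity)]
    field_simp; ring

/-- The quaternion components of `exp (u^I τ_I)` are differentiable, also at `u = 0`, and `h⁻¹ δh`
has vector part `mcForm u δ`. -/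
theorem exists_hasFDerivAt_exp_components (u : Fin 3 → ℝ) :
    ∃ (α' : (Fin 3 → ℝ) →L[ℝ] ℝ) (w' : (Fin 3 → ℝ) →L[ℝ] (Fin 3 → ℝ)),
      HasFDerivAt (fun v : Fin 3 → ℝ => Real.cos (√(v ⬝ᵥ v) / 2)) α' u ∧
      HasFDerivAt (fun v : Fin 3 → ℝ => Real.sinc (√(v ⬝ᵥ v) / 2) • v) w' u ∧
      ∀ δ, Real.cos (√(u ⬝ᵥ u) / 2) • w' δ - α' δ • (Real.sinc (√(u ⬝ᵥ u) / 2) • u) -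
        (1 / 2 : ℝ) • crossProduct (Real.sinc (√(u ⬝ᵥ u) / 2) • u) (w' δ) = mcForm u δ := by
  have hcont : Continuous fun v : Fin 3 → ℝ => v ⬝ᵥ v := by fun_prop
  by_cases hu : u = 0
  · subst hu
    refine ⟨0, ContinuousLinearMap.id ℝ _, ?_, ?_, ?_⟩
    · -- `cos (t / 2) = 1 - sinc² (t / 4) t² / 8`, and `t² = v ⬝ᵥ v` is differentiable at `0`
      have hq := hasFDerivAt_dotProduct_self 0
      have hk : ContinuousAt (fun v : Fin 3 → ℝ => -(Real.sinc (√(v ⬝ᵥ v) / 4) ^ 2 / 8)) 0 := by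
        fun_prop
      have h := (hasFDerivAt_smul_of_continuousAt hk hq (by simp)).add_const (1 : ℝ)
      refine (h.congr_of_eventuallyEq (.of_forall fun v => ?_)).congr_fderiv (by ext; simp)
      have h1 := Real.sq_sqrt (dotProduct_self_nonneg_real v)
      have h2 := cos_half_sq_add (√(v ⬝ᵥ v) / 2)
      have h3 := Real.cos_two_mul (√(v ⬝ᵥ v) / 4)
      rw [show √(v ⬝ᵥ v) / 2 / 2 = √(v ⬝ᵥ v) / 4 by ring] at h2
      simp only [smul_eq_mul]
      rw [show √(v ⬝ᵥ v) / 2 = 2 * (√(v ⬝ᵥ v) / 4) by ring, h3]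
      linear_combination 2 * h2 - Real.sinc (√(v ⬝ᵥ v) / 4) ^ 2 / 8 * h1
    · have hk : ContinuousAt (fun v : Fin 3 → ℝ => Real.sinc (√(v ⬝ᵥ v) / 2)) 0 := by fun_prop
      exact (hasFDerivAt_smul_of_continuousAt hk (hasFDerivAt_id 0) rfl).congr_fderiv
        (by ext; simp)
    · intro δ; simp [mcForm]
  · have hx : 0 < u ⬝ᵥ u := lt_of_le_of_ne (dotProduct_self_nonneg_real u)
      (fun h => hu (dotProduct_self_eq_zero.1 h.symm))
    have hs := ((hasFDerivAt_dotProduct_self u).sqrt hx.ne').const_mul (1 / 2)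
    have hρ : 0 < √(u ⬝ᵥ u) := Real.sqrt_pos.2 hx
    have hsq := Real.sq_sqrt hx.le
    have hs' : HasFDerivAt (fun v : Fin 3 → ℝ => √(v ⬝ᵥ v) / 2)
        ((1 / (2 * √(u ⬝ᵥ u))) •
          ∑ i, u i • ContinuousLinearMap.proj (R := ℝ) (φ := fun _ : Fin 3 => ℝ) i) u := by
      refine (hs.congr_of_eventuallyEq (.of_forall fun v => by ring)).congr_fderiv ?_
      ext δ; simp [Finset.mul_sum]
      refine Finset.sum_congr rfl fun i _ => by ring
    have hα := (Real.hasDerivAt_cos (√(u ⬝ᵥ u) / 2)).comp_hasFDerivAt u hs'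
    have hσ := (hasDerivAt_sinc (t := √(u ⬝ᵥ u) / 2) (by positivity)).comp_hasFDerivAt u hs'
    have hw := hσ.smul (hasFDerivAt_id u)
    refine ⟨_, _, hα, hw, fun δ => ?_⟩
    have h1 := sinc_mul_cos_half √(u ⬝ᵥ u)
    have h2 := cos_half_sq_add √(u ⬝ᵥ u)
    have h3 : Real.sin (√(u ⬝ᵥ u) / 2) = Real.sinc (√(u ⬝ᵥ u) / 2) * (√(u ⬝ᵥ u) / 2) := by
      rw [Real.sinc_of_ne_zero (by positivity)]; field_simp
    have hC' : mcC (u ⬝ᵥ u) = Real.sinc (√(u ⬝ᵥ u) / 2) ^ 2 / 2 := rfl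
    have hD' : mcD (u ⬝ᵥ u) = (1 - Real.sinc √(u ⬝ᵥ u)) / √(u ⬝ᵥ u) ^ 2 := by
      rw [mcD, divSq, if_neg hρ.ne']
    rw [mcForm, hC', hD', h3, ← h1]
    have hm : √(u ⬝ᵥ u) ^ 2 = u 0 * u 0 + u 1 * u 1 + u 2 * u 2 := by
      rw [hsq]; simp [dotProduct, Fin.sum_univ_three]
    have hr : √(u ⬝ᵥ u) ≠ 0 := hρ.ne'
    clear hC' hD' h1 h3 hs hs' hα hσ hw hsq hρ hx hu hcont
    generalize hρ : √(u ⬝ᵥ u) = ρ at *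
    generalize hS : Real.sinc (ρ / 2) = S at *
    generalize Real.cos (ρ / 2) = A at *
    ext i
    fin_cases i <;>
      simp [cross_apply, Fin.sum_univ_three, hρ, hS, Matrix.vecHead, Matrix.vecTail] <;> field_simp
    · linear_combination 4 * (u 0 * (u 0 * δ 0 + u 1 * δ 1 + u 2 * δ 2)) * h2 -
        4 * (1 - A * S) * δ 0 * hm
    · linear_combination 4 * (u 1 * (u 0 * δ 0 + u 1 * δ 1 + u 2 * δ 2)) * h2 -
        4 * (1 - A * S) * δ 1 * hm
    · linear_combination 4 * (u 2 * (u 0 * δ 0 + u 1 * δ 1 + u 2 * δ 2)) * h2 -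
        4 * (1 - A * S) * δ 2 * hm

/-! ### The symplectic form of one edge -/

section Entries

variable {E : Type*} [NormedAddCommGroup E] [NormedSpace ℝ E]

theorem fderiv_quat_entry {α : E → ℝ} {w : E → Fin 3 → ℝ} {α' : E →L[ℝ] ℝ}
    {w' : E →L[ℝ] (Fin 3 → ℝ)} {x : E} (hα : HasFDerivAt α α' x) (hw : HasFDerivAt w w' x)
    (X : E) :
    (Matrix.of fun i j => fderiv ℝ (fun y => quat (α y) (w y) i j) x X) =
      quat (α' X) (w' X) := by
  ext i j
  let Q : (ℝ × (Fin 3 → ℝ)) →ₗ[ℝ] ℂ :=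
    { toFun := fun z => quat z.1 z.2 i j
      map_add' := fun y z => by
        rw [quat_eq, quat_eq, quat_eq]
        fin_cases i <;> fin_cases j <;> simp <;> ring
      map_smul' := fun c z => by
        rw [quat_eq, quat_eq]
        fin_cases i <;> fin_cases j <;> simp <;> ring }
  have h := Q.toContinuousLinearMap.hasFDerivAt.comp x (hα.prodMk hw)
  have h' : HasFDerivAt (fun y => quat (α y) (w y) i j) _ x := h
  rw [Matrix.of_apply, h'.fderiv]
  rfl

theorem suComp_fderiv_su2 {w : E → Fin 3 → ℝ} {w' : Fin 3 → E →L[ℝ] ℝ} {x : E}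
    (hw : ∀ i, HasFDerivAt (fun y => w y i) (w' i) x) (X : E) (I : Fin 3) :
    suComp (Matrix.of fun i j => fderiv ℝ (fun y => su2 (w y) i j) x X) I = w' I X := by
  simp_rw [su2_eq_quat]
  rw [fderiv_quat_entry (hasFDerivAt_const 0 x) (hasFDerivAt_pi.2 hw), suComp_quat]
  rfl

theorem suComp_exp_mul_fderiv_exp {u : E → Fin 3 → ℝ} {u' : Fin 3 → E →L[ℝ] ℝ} {x : E}
    (hu : ∀ i, HasFDerivAt (fun y => u y i) (u' i) x) (X : E) (I : Fin 3) :
    suComp ((NormedSpace.exp (su2 (u x)))ᴴ *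
      Matrix.of fun i j => fderiv ℝ (fun y => NormedSpace.exp (su2 (u y)) i j) x X) I =
      mcForm (u x) (fun i => u' i X) I := by
  obtain ⟨α', w', hα, hw, h⟩ := exists_hasFDerivAt_exp_components (u x)
  have hu' : HasFDerivAt u (ContinuousLinearMap.pi u') x := hasFDerivAt_pi.2 hu
  simp_rw [exp_su2]
  have hα' := hα.comp x hu'
  have hw' := hw.comp x hu'
  have := fderiv_quat_entry hα' hw' X
  simp only [Function.comp_apply] at this
  rw [this, quat_conjTranspose, quat_mul, suComp_quat, ← h]
  simp only [ContinuousLinearMap.comp_apply]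
  have hp : (ContinuousLinearMap.pi u') X = fun i => u' i X := rfl
  rw [hp]
  simp only [Pi.add_apply, Pi.sub_apply, Pi.smul_apply, smul_neg, Pi.neg_apply, smul_eq_mul,
    map_neg, LinearMap.neg_apply]
  ring

end Entries

/-- The holonomy-flux symplectic form of one edge with holonomy `exp (u^I τ_I)` and flux `p^I τ_I`,
on the two tangent vectors `(δu, δp)` given by `(d, q)` and `(d', q')`. -/
noncomputable def edgeForm (u p d q d' q' : Fin 3 → ℝ) : ℝ :=
  ∑ I, (mcForm u d I * q' I - mcForm u d' I * q I) +
    1 / 2 * ∑ I, ∑ J, ∑ K, leviCivita I J K * p I *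
      (mcForm u d J * mcForm u d' K - mcForm u d' J * mcForm u d K)

theorem edgeForm_eq (u p d q d' q' : Fin 3 → ℝ) :
    edgeForm u p d q d' q' = mcForm u d ⬝ᵥ q' - mcForm u d' ⬝ᵥ q +
      p ⬝ᵥ crossProduct (mcForm u d) (mcForm u d') := by
  simp [edgeForm, leviCivita, Fin.sum_univ_three, dotProduct, cross_apply]
  ring

theorem edgeForm_radial (u p d q d' q' : ℝ) :
    edgeForm ![u, 0, 0] ![p, 0, 0] ![d, 0, 0] ![q, 0, 0] ![d', 0, 0] ![q', 0, 0] =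
      d * q' - d' * q := by
  simp [edgeForm_eq, mcForm, dotProduct, Fin.sum_univ_three, cross_apply]

/-- The rescaled function `(1 - cos (ε √y)) / y`. -/
noncomputable def mcCScaled (ε y : ℝ) : ℝ := ε ^ 2 * mcC (ε ^ 2 * y)

/-- The rescaled function `(1 - sinc (ε √y)) / y`. -/
noncomputable def mcDScaled (ε y : ℝ) : ℝ := ε ^ 2 * mcD (ε ^ 2 * y)

theorem edgeForm_polar (ε q b P p D db dp D' db' dp' : ℝ) (hp : p ≠ 0) :
    edgeForm ![0, ε * b, ε * P] ![0, q * p, 0]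
      ![0, ε * db, ε * (D / (2 * p) - P * dp / p)] ![0, q * dp, 0]
      ![0, ε * db', ε * (D' / (2 * p) - P * dp' / p)] ![0, q * dp', 0] =
    ε * q * ((1 - P ^ 2 * mcDScaled ε (b ^ 2 + P ^ 2) + mcCScaled ε (b ^ 2 + P ^ 2) * P ^ 2) *
        (db * dp' - db' * dp) +
      1 / 2 * mcCScaled ε (b ^ 2 + P ^ 2) * P * (D * db' - D' * db) +
      1 / 2 * mcDScaled ε (b ^ 2 + P ^ 2) * P * (b / p) * (D * dp' - D' * dp)) := by
  have hu : (![0, ε * b, ε * P] : Fin 3 → ℝ) ⬝ᵥ ![0, ε * b, ε * P] = ε ^ 2 * (b ^ 2 + P ^ 2) := by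
    simp [dotProduct, Fin.sum_univ_three]; ring
  rw [edgeForm_eq]
  simp only [mcForm, hu, mcDScaled, mcCScaled]
  generalize mcC (ε ^ 2 * (b ^ 2 + P ^ 2)) = c
  generalize mcD (ε ^ 2 * (b ^ 2 + P ^ 2)) = g
  simp [dotProduct, Fin.sum_univ_three, cross_apply]
  field_simp
  ring

/-- The last summand is odd in `C = cos θ`, everything else is even. -/
theorem edgeForm_azimuthal (ε q C s b P p D db dp D' db' dp' : ℝ) (hp : p ≠ 0) :
    edgeForm ![ε * C, -(ε * (P * s)), ε * (b * s)] ![0, 0, q * p]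
      ![0, -(ε * s * (D / (2 * p) - P * dp / p)), ε * s * db] ![0, 0, q * dp]
      ![0, -(ε * s * (D' / (2 * p) - P * dp' / p)), ε * s * db'] ![0, 0, q * dp'] =
    ε * q * (((1 - (C ^ 2 + P ^ 2 * s ^ 2) * mcDScaled ε (C ^ 2 + (b ^ 2 + P ^ 2) * s ^ 2)) * s +
        mcCScaled ε (C ^ 2 + (b ^ 2 + P ^ 2) * s ^ 2) * s ^ 3 * P ^ 2) * (db * dp' - db' * dp) +
      1 / 2 * (mcCScaled ε (C ^ 2 + (b ^ 2 + P ^ 2) * s ^ 2) * s ^ 3) * P * (D * db' - D' * db) +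
      1 / 2 * (mcDScaled ε (C ^ 2 + (b ^ 2 + P ^ 2) * s ^ 2) * s ^ 3) * P * (b / p) *
        (D * dp' - D' * dp)) +
    C * (q * mcCScaled ε (C ^ 2 + (b ^ 2 + P ^ 2) * s ^ 2) * s *
        ((D / (2 * p) - P * dp / p) * dp' - (D' / (2 * p) - P * dp' / p) * dp) +
      q * p * s ^ 3 * b * (ε ^ 2 * mcDScaled ε (C ^ 2 + (b ^ 2 + P ^ 2) * s ^ 2) *
          (1 - mcDScaled ε (C ^ 2 + (b ^ 2 + P ^ 2) * s ^ 2) *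
            (C ^ 2 + (b ^ 2 + P ^ 2) * s ^ 2)) -
          mcCScaled ε (C ^ 2 + (b ^ 2 + P ^ 2) * s ^ 2) ^ 2) *
        ((D / (2 * p) - P * dp / p) * db' - (D' / (2 * p) - P * dp' / p) * db)) := by
  have hu : (![ε * C, -(ε * (P * s)), ε * (b * s)] : Fin 3 → ℝ) ⬝ᵥ
      ![ε * C, -(ε * (P * s)), ε * (b * s)] = ε ^ 2 * (C ^ 2 + (b ^ 2 + P ^ 2) * s ^ 2) := by
    simp [dotProduct, Fin.sum_univ_three]; ring
  rw [edgeForm_eq]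
  simp only [mcForm, hu, mcDScaled, mcCScaled]
  generalize mcC (ε ^ 2 * (C ^ 2 + (b ^ 2 + P ^ 2) * s ^ 2)) = c
  generalize mcD (ε ^ 2 * (C ^ 2 + (b ^ 2 + P ^ 2) * s ^ 2)) = g
  simp [dotProduct, Fin.sum_univ_three, cross_apply]
  field_simp
  ring

/-! ### The structure functions -/

theorem sqrt_sq_mul {ε : ℝ} (hε : 0 ≤ ε) (y : ℝ) : √(ε ^ 2 * y) = ε * √y := by
  rw [Real.sqrt_mul (sq_nonneg ε), Real.sqrt_sq hε]

theorem mul_mcDScaled {ε y : ℝ} (hε : 0 ≤ ε) (hy : 0 ≤ y) :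
    y * mcDScaled ε y = 1 - Real.sinc (ε * √y) := by
  rw [← sqrt_sq_mul hε, ← mul_mcD (by positivity), mcDScaled]; ring

theorem divSq_one_sub_sinc {ε y : ℝ} (hε : 0 ≤ ε) (hy : 0 ≤ y) :
    divSq (ε ^ 2 / 6) (1 - Real.sinc (ε * √y)) √y = mcDScaled ε y := by
  rw [divSq]
  split_ifs with h
  · have : y = 0 := (Real.sqrt_eq_zero hy).1 h
    simp [this, mcDScaled, mcD, divSq]; ring
  · have h2 : √y ^ 2 = y := Real.sq_sqrt hy
    have hy0 : y ≠ 0 := fun h0 => h (by simp [h0])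
    rw [← mul_mcDScaled hε hy, h2]; field_simp

theorem divSq_add_mul_sinc {ε N M : ℝ} (hε : 0 ≤ ε) (hN : 0 ≤ N) (hM : 0 ≤ M) :
    divSq 1 (N + M * Real.sinc (ε * √(N + M))) √(N + M) = 1 - M * mcDScaled ε (N + M) := by
  have hy : 0 ≤ N + M := add_nonneg hN hM
  rw [divSq]
  split_ifs with h
  · have : N + M = 0 := (Real.sqrt_eq_zero hy).1 h
    have : M = 0 := by linarith
    simp [this]
  · have h2 : √(N + M) ^ 2 = N + M := Real.sq_sqrt hy
    have hy0 : N + M ≠ 0 := fun h0 => h (by simp [h0])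
    have h3 := mul_mcDScaled hε hy
    rw [h2, div_eq_iff hy0]
    linear_combination M * h3

theorem mcCScaled_eq {ε : ℝ} (hε : 0 ≤ ε) (y : ℝ) :
    mcCScaled ε y = ε ^ 2 * Real.sinc (ε * √y / 2) ^ 2 / 2 := by
  rw [mcCScaled, mcC, sqrt_sq_mul hε]; ring

theorem epsTheta_nonneg (n : ℕ) : 0 ≤ epsTheta n := by unfold epsTheta; positivity

theorem epsPhi_nonneg (n : ℕ) : 0 ≤ epsPhi n := by unfold epsPhi; positivity

/-- The argument `λ_φ²` at polar angle `θ_j`. -/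
noncomputable def azimSq (n : ℕ) (j : Fin (n + 1)) (b P : ℝ) : ℝ :=
  Real.cos (polarAngle n j) ^ 2 + (b ^ 2 + P ^ 2) * Real.sin (polarAngle n j) ^ 2

theorem azimSq_nonneg (n : ℕ) (j : Fin (n + 1)) (b P : ℝ) : 0 ≤ azimSq n j b P := by
  unfold azimSq; positivity

theorem structF_eq (n : ℕ) (b P : ℝ) :
    structF n b P = epsTheta n *
      ((1 - P ^ 2 * mcDScaled (epsTheta n) (b ^ 2 + P ^ 2)) *
          (Real.cos (epsTheta n / 2) * Real.cot (epsTheta n / 2)) +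
        ∑ j : Fin (n + 1), (1 - (Real.cos (polarAngle n j) ^ 2 +
          P ^ 2 * Real.sin (polarAngle n j) ^ 2) * mcDScaled (epsPhi n) (azimSq n j b P)) *
          Real.sin (polarAngle n j)) := by
  rw [structF, lamTheta, divSq_add_mul_sinc (epsTheta_nonneg n) (sq_nonneg b) (sq_nonneg P),
    mul_assoc (1 - _)]
  congr 2
  refine Finset.sum_congr rfl fun j _ => ?_
  have h : azimSq n j b P = b ^ 2 * Real.sin (polarAngle n j) ^ 2 +
      (Real.cos (polarAngle n j) ^ 2 + P ^ 2 * Real.sin (polarAngle n j) ^ 2) := by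
    unfold azimSq; ring
  rw [lamPhi, show Real.cos (polarAngle n j) ^ 2 + (b ^ 2 + P ^ 2) * Real.sin (polarAngle n j) ^ 2
    = azimSq n j b P from rfl, h, divSq_add_mul_sinc (epsPhi_nonneg n) (by positivity)
    (by positivity)]

theorem structG_eq (n : ℕ) (b P : ℝ) :
    structG n b P = epsTheta n *
      (mcDScaled (epsTheta n) (b ^ 2 + P ^ 2) *
          (Real.cos (epsTheta n / 2) * Real.cot (epsTheta n / 2)) +
        ∑ j : Fin (n + 1), mcDScaled (epsPhi n) (azimSq n j b P) *
          Real.sin (polarAngle n j) ^ 3) := by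
  rw [structG, lamTheta, divSq_one_sub_sinc (epsTheta_nonneg n) (by positivity),
    mul_assoc (mcDScaled _ _)]
  congr 2
  refine Finset.sum_congr rfl fun j _ => ?_
  rw [lamPhi, divSq_one_sub_sinc (epsPhi_nonneg n) (by positivity), azimSq]

theorem structH_eq (n : ℕ) (b P : ℝ) :
    structH n b P = epsTheta n *
      (mcCScaled (epsTheta n) (b ^ 2 + P ^ 2) *
          (Real.cos (epsTheta n / 2) * Real.cot (epsTheta n / 2)) +
        ∑ j : Fin (n + 1), mcCScaled (epsPhi n) (azimSq n j b P) *
          Real.sin (polarAngle n j) ^ 3) := by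
  have h : ∑ j : Fin (n + 1), mcCScaled (epsPhi n) (azimSq n j b P) *
      Real.sin (polarAngle n j) ^ 3 = epsPhi n ^ 2 / 2 * ∑ j : Fin (n + 1),
        Real.sinc (epsPhi n / 2 * lamPhi (polarAngle n j) b P) ^ 2 *
          Real.sin (polarAngle n j) ^ 3 := by
    rw [Finset.mul_sum]
    refine Finset.sum_congr rfl fun j _ => ?_
    rw [mcCScaled_eq (epsPhi_nonneg n), lamPhi, azimSq, mul_div_right_comm (epsPhi n)]; ring
  rw [h, structH, mcCScaled_eq (epsTheta_nonneg n), lamTheta]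
  ring

/-- The differential equation of `D(y) = (1 - sinc (ε √y)) / y`, equivalent to
`d/dλ (λ³ D(λ²)) = 1 - cos (ε λ)`. -/
theorem exists_hasDerivAt_mcDScaled {ε y : ℝ} (hε : 0 < ε) (hy : 0 < y) :
    ∃ g' : ℝ, HasDerivAt (mcDScaled ε) g' y ∧
      2 * y * g' + 3 * mcDScaled ε y = mcCScaled ε y := by
  have hl : 0 < ε * √y := mul_pos hε (Real.sqrt_pos.2 hy)
  have h1 := (Real.hasDerivAt_sqrt hy.ne').const_mul ε
  have h2 := (hasDerivAt_sinc hl.ne').comp y h1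
  have h3 := (h2.const_sub 1).div (hasDerivAt_id y) hy.ne'
  have he : mcDScaled ε =ᶠ[nhds y] fun z => (1 - Real.sinc (ε * √z)) / z := by
    filter_upwards [lt_mem_nhds hy] with z hz
    rw [← mul_mcDScaled hε.le hz.le]; field_simp
  refine ⟨_, (HasDerivAt.congr_of_eventuallyEq h3 he), ?_⟩
  have hC : mcCScaled ε y = (1 - Real.cos (ε * √y)) / y := by
    have := mul_mcC (x := ε ^ 2 * y) (by positivity)
    rw [sqrt_sq_mul hε.le] at this
    rw [← this, mcCScaled]; field_simp
  have hD : mcDScaled ε y = (1 - Real.sinc (ε * √y)) / y := by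
    rw [← mul_mcDScaled hε.le hy.le]; field_simp
  have hs : √y ^ 2 = y := Real.sq_sqrt hy.le
  have hs0 : √y ≠ 0 := (Real.sqrt_pos.2 hy).ne'
  rw [hC, hD]
  simp only [id, Function.comp_apply]
  field_simp
  rw [hs]
  ring

theorem epsTheta_pos {n : ℕ} (hn : n ≠ 0) : 0 < epsTheta n := by unfold epsTheta; positivity

theorem epsPhi_pos {n : ℕ} (hn : n ≠ 0) : 0 < epsPhi n := by unfold epsPhi; positivity

theorem azimSq_pos {n : ℕ} (j : Fin (n + 1)) (b : ℝ) {P : ℝ} (hP : P ≠ 0) :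
    0 < azimSq n j b P := by
  have h := Real.cos_sq_add_sin_sq (polarAngle n j)
  have hp : 0 < P ^ 2 := by positivity
  unfold azimSq
  by_cases hs : Real.sin (polarAngle n j) = 0
  · rw [hs] at h ⊢; linarith
  · positivity

theorem structH_eq_structG_add {n : ℕ} (hn : n ≠ 0) (b P : ℝ) (hP : P ≠ 0) :
    ∃ Gb FP : ℝ, HasDerivAt (fun t => structG n t P) Gb b ∧
      HasDerivAt (fun t => structF n b t) FP P ∧
      structH n b P = structG n b P + b * Gb - 1 / P * FP := by
  obtain ⟨g, hg, hg'⟩ := exists_hasDerivAt_mcDScaled (epsTheta_pos hn)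
    (y := b ^ 2 + P ^ 2) (by positivity)
  choose k hk hk' using fun j => exists_hasDerivAt_mcDScaled (epsPhi_pos hn)
    (azimSq_pos (n := n) j b hP)
  have hb : HasDerivAt (fun t : ℝ => t ^ 2) (2 * b) b := by simpa using hasDerivAt_pow 2 b
  have hp : HasDerivAt (fun t : ℝ => t ^ 2) (2 * P) P := by simpa using hasDerivAt_pow 2 P
  have g1 : HasDerivAt (fun t => mcDScaled (epsTheta n) (t ^ 2 + P ^ 2)) (g * (2 * b)) b :=
    HasDerivAt.comp (h₂ := mcDScaled (epsTheta n)) b hg (hb.add_const (P ^ 2))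
  have g2 : HasDerivAt (fun t => mcDScaled (epsTheta n) (b ^ 2 + t ^ 2)) (g * (2 * P)) P :=
    HasDerivAt.comp (h₂ := mcDScaled (epsTheta n)) P hg (hp.const_add (b ^ 2))
  have k1 : ∀ j, HasDerivAt (fun t => mcDScaled (epsPhi n) (azimSq n j t P))
      (k j * (2 * b * Real.sin (polarAngle n j) ^ 2)) b := fun j =>
    HasDerivAt.comp (h₂ := mcDScaled (epsPhi n)) b (hk j)
      (((hb.add_const (P ^ 2)).mul_const _).const_add _)
  have k2 : ∀ j, HasDerivAt (fun t => mcDScaled (epsPhi n) (azimSq n j b t))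
      (k j * (2 * P * Real.sin (polarAngle n j) ^ 2)) P := fun j =>
    HasDerivAt.comp (h₂ := mcDScaled (epsPhi n)) P (hk j)
      (((hp.const_add (b ^ 2)).mul_const _).const_add _)
  have hG := ((g1.mul_const (Real.cos (epsTheta n / 2) * Real.cot (epsTheta n / 2))).add
    (HasDerivAt.fun_sum fun j (_ : j ∈ Finset.univ) =>
      (k1 j).mul_const (Real.sin (polarAngle n j) ^ 3))).const_mul (epsTheta n)
  have hF := (((((hp.mul g2).const_sub 1).mul_const
      (Real.cos (epsTheta n / 2) * Real.cot (epsTheta n / 2))).add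
    (HasDerivAt.fun_sum fun j (_ : j ∈ Finset.univ) =>
      (((((hp.mul_const (Real.sin (polarAngle n j) ^ 2)).const_add
        (Real.cos (polarAngle n j) ^ 2)).mul (k2 j)).const_sub 1).mul_const
          (Real.sin (polarAngle n j)))))).const_mul (epsTheta n)
  refine ⟨_, _, hG.congr_of_eventuallyEq (.of_forall fun t => structG_eq n t P),
    hF.congr_of_eventuallyEq (.of_forall fun t => structF_eq n b t), ?_⟩
  rw [structH_eq, structG_eq, ← hg']
  simp_rw [← hk']
  have hsum : ∑ j, (2 * azimSq n j b P * k j + 3 * mcDScaled (epsPhi n) (azimSq n j b P)) *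
      Real.sin (polarAngle n j) ^ 3 =
      ∑ j, mcDScaled (epsPhi n) (azimSq n j b P) * Real.sin (polarAngle n j) ^ 3 +
      b * ∑ j, k j * (2 * b * Real.sin (polarAngle n j) ^ 2) * Real.sin (polarAngle n j) ^ 3 -
      1 / P * ∑ j, -(2 * P * Real.sin (polarAngle n j) ^ 2 *
          mcDScaled (epsPhi n) (azimSq n j b P) +
        (Real.cos (polarAngle n j) ^ 2 + P ^ 2 * Real.sin (polarAngle n j) ^ 2) *
          (k j * (2 * P * Real.sin (polarAngle n j) ^ 2))) * Real.sin (polarAngle n j) := by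
    rw [Finset.mul_sum, Finset.mul_sum, ← Finset.sum_add_distrib, ← Finset.sum_sub_distrib]
    refine Finset.sum_congr rfl fun j _ => ?_
    generalize mcDScaled (epsPhi n) (azimSq n j b P) = d
    simp only [azimSq]
    field_simp
    ring
  have hpol : 2 * (b ^ 2 + P ^ 2) * g + 3 * mcDScaled (epsTheta n) (b ^ 2 + P ^ 2) =
      mcDScaled (epsTheta n) (b ^ 2 + P ^ 2) + b * (g * (2 * b)) -
      1 / P * -(2 * P * mcDScaled (epsTheta n) (b ^ 2 + P ^ 2) + P ^ 2 * (g * (2 * P))) := by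
    field_simp
    ring
  rw [hsum, hpol]
  ring

/-! ### Trigonometric sums over the polar angles -/

theorem two_mul_sin_half_mul_sum_sin (ε c : ℝ) (m : ℕ) :
    2 * Real.sin (ε / 2) * ∑ j ∈ Finset.range m, Real.sin (j * ε + c) =
      Real.cos (c - ε / 2) - Real.cos (m * ε + c - ε / 2) := by
  induction m with
  | zero => simp
  | succ m ih =>
    rw [Finset.sum_range_succ, mul_add, ih]
    have h1 := Real.cos_sub (m * ε + c) (ε / 2)
    have h2 := Real.cos_add (m * ε + c) (ε / 2)
    push_cast
    rw [show (m + 1) * ε + c - ε / 2 = m * ε + c + ε / 2 by ring, h1, h2]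
    ring

theorem sin_half_epsTheta_pos {n : ℕ} (hn : n ≠ 0) : 0 < Real.sin (epsTheta n / 2) := by
  apply Real.sin_pos_of_pos_of_lt_pi (half_pos (epsTheta_pos hn))
  have : epsTheta n ≤ Real.pi := div_le_self Real.pi_pos.le
    (by exact_mod_cast Nat.one_le_iff_ne_zero.2 hn)
  linarith [Real.pi_pos]

theorem natCast_mul_epsTheta {n : ℕ} (hn : n ≠ 0) : n * epsTheta n = Real.pi := by
  unfold epsTheta; field_simp

theorem sum_sin_polarAngle {n : ℕ} (hn : n ≠ 0) :
    ∑ j : Fin (n + 1), Real.sin (polarAngle n j) = Real.cot (epsTheta n / 2) := by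
  have h := two_mul_sin_half_mul_sum_sin (epsTheta n) 0 (n + 1)
  have hs := sin_half_epsTheta_pos hn
  push_cast at h
  rw [add_mul, natCast_mul_epsTheta hn, show Real.pi + 1 * epsTheta n + 0 - epsTheta n / 2 =
    epsTheta n / 2 + Real.pi by ring, Real.cos_add_pi, zero_sub, Real.cos_neg] at h
  simp only [polarAngle]
  rw [Fin.sum_univ_eq_sum_range (fun j => Real.sin (j * epsTheta n)) (n + 1),
    Real.cot_eq_cos_div_sin, eq_div_iff hs.ne']
  simp only [add_zero] at h
  linarith

theorem sum_sin_polarAngle_add_half {n : ℕ} (hn : n ≠ 0) :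
    ∑ j : Fin (n + 1), Real.sin (polarAngle n j + epsTheta n / 2) =
      Real.cos (epsTheta n / 2) * Real.cot (epsTheta n / 2) := by
  have h := two_mul_sin_half_mul_sum_sin (epsTheta n) (epsTheta n / 2) (n + 1)
  have hs := sin_half_epsTheta_pos hn
  push_cast at h
  rw [add_mul, natCast_mul_epsTheta hn, show Real.pi + 1 * epsTheta n + epsTheta n / 2 -
    epsTheta n / 2 = 2 * (epsTheta n / 2) + Real.pi by ring, Real.cos_add_pi, sub_self,
    Real.cos_zero, Real.cos_two_mul] at h
  simp only [polarAngle]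
  rw [Fin.sum_univ_eq_sum_range (fun j => Real.sin (j * epsTheta n + epsTheta n / 2)) (n + 1),
    Real.cot_eq_cos_div_sin, ← mul_div_assoc, eq_div_iff hs.ne']
  linarith

theorem polarAngle_rev {n : ℕ} (hn : n ≠ 0) (j : Fin (n + 1)) :
    polarAngle n j.rev = Real.pi - polarAngle n j := by
  have h : (j : ℕ) ≤ n := Nat.lt_succ_iff.1 j.2
  rw [polarAngle, polarAngle, ← natCast_mul_epsTheta hn, Fin.val_rev,
    show n + 1 - ((j : ℕ) + 1) = n - j by omega, Nat.cast_sub h]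
  ring

/-- Terms odd under the reflection `θ ↦ π - θ` cancel in the sum over the polar angles. -/
theorem sum_cos_polarAngle_mul_eq_zero {n : ℕ} (hn : n ≠ 0) (f : ℝ → ℝ → ℝ) :
    ∑ j : Fin (n + 1), Real.cos (polarAngle n j) *
      f (Real.cos (polarAngle n j) ^ 2) (Real.sin (polarAngle n j)) = 0 := by
  have h := Equiv.sum_comp Fin.revPerm fun j : Fin (n + 1) => Real.cos (polarAngle n j) *
      f (Real.cos (polarAngle n j) ^ 2) (Real.sin (polarAngle n j))
  simp only [Fin.revPerm_apply, polarAngle_rev hn, Real.cos_pi_sub, Real.sin_pi_sub, neg_sq,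
    neg_mul, Finset.sum_neg_distrib] at h
  linarith

theorem sin_polarAngle_nonneg (n : ℕ) (j : Fin (n + 1)) : 0 ≤ Real.sin (polarAngle n j) := by
  rcases eq_or_ne n 0 with rfl | hn
  · simp [polarAngle, epsTheta]
  · rw [polarAngle]
    apply Real.sin_nonneg_of_nonneg_of_le_pi (mul_nonneg (Nat.cast_nonneg _) (epsTheta_nonneg n))
    rw [← natCast_mul_epsTheta hn]
    exact mul_le_mul_of_nonneg_right (by exact_mod_cast Nat.lt_succ_iff.1 j.2) (epsTheta_nonneg n)

/-! ### The restricted symplectic form -/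

section PullBack

variable {n : ℕ}

/-- The coordinate function `c(v)` as a continuous linear map. -/
noncomputable def coordCLM (c : Coord) (v : Fin n) : Phase n →L[ℝ] ℝ :=
  (ContinuousLinearMap.proj (R := ℝ) (φ := fun _ : Fin n => ℝ) v).comp
    (ContinuousLinearMap.proj (R := ℝ) (φ := fun _ : Coord => Fin n → ℝ) c)

@[simp]
theorem coordCLM_apply (c : Coord) (v : Fin n) (X : Phase n) : coordCLM c v X = X c v := rfl

theorem hasFDerivAt_coord (c : Coord) (v : Fin n) (x : Phase n) :
    HasFDerivAt (fun y : Phase n => y c v) (coordCLM c v) x := (coordCLM c v).hasFDerivAt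

/-- The derivative of `p_a` at lattice index `k`, where the boundary values do not vary. -/
noncomputable def extendCLM (n k : ℕ) : Phase n →L[ℝ] ℝ :=
  if k = 0 then 0 else if h : k - 1 < n then coordCLM .pa ⟨k - 1, h⟩ else 0

theorem extendCLM_apply (k : ℕ) (X : Phase n) :
    extendCLM n k X = extendLattice 0 0 (X .pa) k := by
  unfold extendCLM extendLattice
  split_ifs <;> rfl

theorem hasFDerivAt_extendLattice (c₀ c₁ : ℝ) (k : ℕ) (x : Phase n) :
    HasFDerivAt (fun y : Phase n => extendLattice c₀ c₁ (y .pa) k) (extendCLM n k) x := by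
  unfold extendCLM extendLattice
  split_ifs
  · exact hasFDerivAt_const _ _
  · exact hasFDerivAt_coord _ _ _
  · exact hasFDerivAt_const _ _

/-- The derivative of `Π_ε(v)`. -/
noncomputable def capPiCLM (r₀ c₀ c₁ : ℝ) (x : Phase n) (v : Fin n) : Phase n →L[ℝ] ℝ :=
  (1 / (2 * x .pb v * (2 * epsR r₀ n))) • (extendCLM n (v + 2) - extendCLM n v) -
    (capPi r₀ c₀ c₁ x v / x .pb v) • coordCLM .pb v

theorem capPiCLM_apply (r₀ c₀ c₁ : ℝ) (x X : Phase n) (v : Fin n) :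
    capPiCLM r₀ c₀ c₁ x v X =
      centralDiff r₀ 0 0 (X .pa) v / (2 * x .pb v) - capPi r₀ c₀ c₁ x v * X .pb v / x .pb v := by
  simp only [capPiCLM, sub_apply, smul_apply,
    extendCLM_apply, coordCLM_apply, smul_eq_mul, centralDiff]
  ring

theorem hasFDerivAt_capPi (r₀ c₀ c₁ : ℝ) {x : Phase n} {v : Fin n} (hx : x .pb v ≠ 0) :
    HasFDerivAt (fun y => capPi r₀ c₀ c₁ y v) (capPiCLM r₀ c₀ c₁ x v) x := by
  have h1 := ((hasFDerivAt_extendLattice c₀ c₁ (v + 2) x).sub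
    (hasFDerivAt_extendLattice c₀ c₁ v x)).mul_const (1 / (2 * epsR r₀ n))
  have h2 := (hasFDerivAt_coord .pb v x).const_mul 2
  have h3 := (hasDerivAt_inv (x := 2 * x .pb v) (by simpa using hx)).comp_hasFDerivAt x h2
  refine ((h1.mul h3).congr_of_eventuallyEq (.of_forall fun y => ?_)).congr_fderiv ?_
  · simp [capPi, centralDiff, div_eq_mul_inv]
  · ext X
    simp [capPiCLM, capPi, centralDiff]
    field_simp
    ring

/-- The vectors `u_e` with `h_e = exp (u_e^I τ_I)`. -/
noncomputable def holVec (r₀ c₀ c₁ : ℝ) (x : Phase n) : Edge n → Fin 3 → ℝ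
  | (v, _, _, .radial) => ![epsR r₀ n * x .a v, 0, 0]
  | (v, _, _, .polar) => ![0, epsTheta n * x .b v, epsTheta n * capPi r₀ c₀ c₁ x v]
  | (v, j, _, .azimuthal) => ![epsPhi n * Real.cos (polarAngle n j),
        -(epsPhi n * (capPi r₀ c₀ c₁ x v * Real.sin (polarAngle n j))),
        epsPhi n * (x .b v * Real.sin (polarAngle n j))]

/-- The vectors `p_e` with `P_e = p_e^I τ_I`. -/
noncomputable def fluxVec (r₀ : ℝ) (x : Phase n) : Edge n → Fin 3 → ℝ
  | (v, j, _, .radial) => ![epsTheta n * epsPhi n * Real.sinc (epsTheta n / 2) * x .pa v *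
        Real.sin (polarAngle n j), 0, 0]
  | (v, j, _, .polar) =>
      ![0, epsPhi n * epsR r₀ n * x .pb v * Real.sin (polarAngle n j + epsTheta n / 2), 0]
  | (v, _, _, .azimuthal) => ![0, 0, epsR r₀ n * epsTheta n * x .pb v]

theorem holonomy_eq (r₀ c₀ c₁ : ℝ) (x : Phase n) (e : Edge n) :
    holonomy r₀ c₀ c₁ x e = NormedSpace.exp (su2 (holVec r₀ c₀ c₁ x e)) := by
  obtain ⟨v, j, k, d⟩ := e
  cases d <;> rfl

theorem flux_eq (r₀ : ℝ) (x : Phase n) (e : Edge n) : flux r₀ x e = su2 (fluxVec r₀ x e) := by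
  obtain ⟨v, j, k, d⟩ := e
  cases d <;> rfl

theorem symEmbed_mem_holonomyFluxSpace (r₀ c₀ c₁ : ℝ) (x : Phase n) :
    symEmbed r₀ c₀ c₁ x ∈ holonomyFluxSpace n := fun e => by
  refine ⟨?_, ?_, ?_⟩
  · rw [symEmbed, holonomy_eq]; exact exp_su2_mem_specialUnitaryGroup _
  · rw [symEmbed, flux_eq]; exact su2_conjTranspose _
  · rw [symEmbed, flux_eq]; exact su2_trace _

/-- The variation of `u_e`. -/
noncomputable def holVecDeriv (r₀ c₀ c₁ : ℝ) (x : Phase n) : Edge n → Fin 3 → Phase n →L[ℝ] ℝ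
  | (v, _, _, .radial) => ![epsR r₀ n • coordCLM .a v, 0, 0]
  | (v, _, _, .polar) => ![0, epsTheta n • coordCLM .b v, epsTheta n • capPiCLM r₀ c₀ c₁ x v]
  | (v, j, _, .azimuthal) => ![0,
        -((epsPhi n * Real.sin (polarAngle n j)) • capPiCLM r₀ c₀ c₁ x v),
        (epsPhi n * Real.sin (polarAngle n j)) • coordCLM .b v]

/-- The variation of `p_e`. -/
noncomputable def fluxVecDeriv (r₀ : ℝ) : Edge n → Fin 3 → Phase n →L[ℝ] ℝ
  | (v, j, _, .radial) => ![(epsTheta n * epsPhi n * Real.sinc (epsTheta n / 2) *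
        Real.sin (polarAngle n j)) • coordCLM .pa v, 0, 0]
  | (v, j, _, .polar) =>
      ![0, (epsPhi n * epsR r₀ n * Real.sin (polarAngle n j + epsTheta n / 2)) • coordCLM .pb v, 0]
  | (v, _, _, .azimuthal) => ![0, 0, (epsR r₀ n * epsTheta n) • coordCLM .pb v]

theorem hasFDerivAt_holVec (r₀ c₀ c₁ : ℝ) {x : Phase n} (hx : ∀ v, x .pb v ≠ 0) (e : Edge n)
    (I : Fin 3) :
    HasFDerivAt (fun y => holVec r₀ c₀ c₁ y e I) (holVecDeriv r₀ c₀ c₁ x e I) x := by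
  obtain ⟨v, j, k, d⟩ := e
  have hP := hasFDerivAt_capPi r₀ c₀ c₁ (hx v)
  have hb := hasFDerivAt_coord .b v x
  cases d <;> fin_cases I
  · exact (hasFDerivAt_coord .a v x).const_mul _
  · exact hasFDerivAt_const _ _
  · exact hasFDerivAt_const _ _
  · exact hasFDerivAt_const _ _
  · exact hb.const_mul _
  · exact hP.const_mul _
  · exact hasFDerivAt_const _ _
  · refine (((hP.mul_const (Real.sin (polarAngle n j))).const_mul
      (epsPhi n)).fun_neg).congr_fderiv ?_
    simp [holVecDeriv, smul_smul]
  · refine ((hb.mul_const (Real.sin (polarAngle n j))).const_mul (epsPhi n)).congr_fderiv ?_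
    simp [holVecDeriv, smul_smul]

theorem hasFDerivAt_fluxVec (r₀ : ℝ) (x : Phase n) (e : Edge n) (I : Fin 3) :
    HasFDerivAt (fun y => fluxVec r₀ y e I) (fluxVecDeriv r₀ e I) x := by
  obtain ⟨v, j, k, d⟩ := e
  have hb := hasFDerivAt_coord .pb v x
  cases d <;> fin_cases I
  · refine (((hasFDerivAt_coord .pa v x).const_mul _).mul_const _).congr_fderiv ?_
    simp [fluxVecDeriv, smul_smul, mul_comm]
  · exact hasFDerivAt_const _ _
  · exact hasFDerivAt_const _ _
  · exact hasFDerivAt_const _ _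
  · refine ((hb.const_mul _).mul_const _).congr_fderiv ?_
    simp [fluxVecDeriv, smul_smul, mul_comm]
  · exact hasFDerivAt_const _ _
  · exact hasFDerivAt_const _ _
  · exact hasFDerivAt_const _ _
  · exact hb.const_mul _

theorem maurerCartan_symEmbed (r₀ c₀ c₁ : ℝ) {x : Phase n} (hx : ∀ v, x .pb v ≠ 0)
    (X : Phase n) (e : Edge n) (I : Fin 3) :
    maurerCartan (symEmbed r₀ c₀ c₁ x) (tangentEmbed r₀ c₀ c₁ x X) e I =
      mcForm (holVec r₀ c₀ c₁ x e) (fun J => holVecDeriv r₀ c₀ c₁ x e J X) I := by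
  rw [← suComp_exp_mul_fderiv_exp (hasFDerivAt_holVec r₀ c₀ c₁ hx e)]
  simp only [maurerCartan, tangentEmbed, symEmbed, holonomy_eq]

theorem suComp_tangentEmbed (r₀ c₀ c₁ : ℝ) (x X : Phase n) (e : Edge n) (I : Fin 3) :
    suComp (tangentEmbed r₀ c₀ c₁ x X e).2 I = fluxVecDeriv r₀ e I X := by
  rw [← suComp_fderiv_su2 (hasFDerivAt_fluxVec r₀ x e)]
  simp only [tangentEmbed, symEmbed, flux_eq]

theorem omegaSym_eq_sum_edgeForm (κ β r₀ c₀ c₁ : ℝ) {x : Phase n} (hx : ∀ v, x .pb v ≠ 0)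
    (X Y : Phase n) :
    omegaSym κ β r₀ c₀ c₁ x X Y = 2 / (κ * β) * ∑ e : Edge n,
      edgeForm (holVec r₀ c₀ c₁ x e) (fluxVec r₀ x e)
        (fun I => holVecDeriv r₀ c₀ c₁ x e I X) (fun I => fluxVecDeriv r₀ e I X)
        (fun I => holVecDeriv r₀ c₀ c₁ x e I Y) (fun I => fluxVecDeriv r₀ e I Y) := by
  rw [omegaSym, omegaGamma]
  congr 1
  refine Finset.sum_congr rfl fun e _ => ?_
  have h : ∀ I, suComp (symEmbed r₀ c₀ c₁ x e).2 I = fluxVec r₀ x e I := fun I => by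
    rw [symEmbed, flux_eq, suComp_su2]
  simp only [maurerCartan_symEmbed r₀ c₀ c₁ hx, suComp_tangentEmbed, h, edgeForm]

theorem sum_dir (f : Dir → ℝ) : ∑ d, f d = f .radial + f .polar + f .azimuthal := by
  have : (Finset.univ : Finset Dir) = {.radial, .polar, .azimuthal} := rfl
  rw [this, Finset.sum_insert (by decide), Finset.sum_insert (by decide), Finset.sum_singleton,
    add_assoc]

/-- The restricted form in the coordinates of the reduced phase space. -/
noncomputable def reducedForm (κ β r₀ c₀ c₁ : ℝ) (x X Y : Phase n) : ℝ :=
  4 * Real.pi / (κ * β) * ∑ v : Fin n, epsR r₀ n *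
    (2 * Real.cos (epsTheta n / 2) * (X .a v * Y .pa v - Y .a v * X .pa v) +
      (FOm r₀ c₀ c₁ x v + HOm r₀ c₀ c₁ x v * capPi r₀ c₀ c₁ x v ^ 2) *
        (X .b v * Y .pb v - Y .b v * X .pb v) +
      1 / 2 * HOm r₀ c₀ c₁ x v * capPi r₀ c₀ c₁ x v *
        (centralDiff r₀ 0 0 (X .pa) v * Y .b v -
          centralDiff r₀ 0 0 (Y .pa) v * X .b v) +
      1 / 2 * GOm r₀ c₀ c₁ x v * capPi r₀ c₀ c₁ x v * (x .b v / x .pb v) *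
        (centralDiff r₀ 0 0 (X .pa) v * Y .pb v -
          centralDiff r₀ 0 0 (Y .pa) v * X .pb v))

/-- The contribution of all radial edges that start at radius `v`. -/
theorem sum_edgeForm_radial (r₀ c₀ c₁ : ℝ) (hn : n ≠ 0) (x X Y : Phase n) (v : Fin n) :
    ∑ j : Fin (n + 1), ∑ k : Fin n,
      edgeForm (holVec r₀ c₀ c₁ x (v, j, k, .radial)) (fluxVec r₀ x (v, j, k, .radial))
        (fun I => holVecDeriv r₀ c₀ c₁ x (v, j, k, .radial) I X)
        (fun I => fluxVecDeriv r₀ (v, j, k, .radial) I X)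
        (fun I => holVecDeriv r₀ c₀ c₁ x (v, j, k, .radial) I Y)
        (fun I => fluxVecDeriv r₀ (v, j, k, .radial) I Y) =
      2 * Real.pi * epsR r₀ n *
        (2 * Real.cos (epsTheta n / 2) * (X .a v * Y .pa v - Y .a v * X .pa v)) := by
  have h1 : ∀ (j : Fin (n + 1)) (k : Fin n) (Z : Phase n),
      (fun I => holVecDeriv r₀ c₀ c₁ x (v, j, k, .radial) I Z) = ![epsR r₀ n * Z .a v, 0, 0] := by
    intro j k Z; ext I; fin_cases I <;> simp [holVecDeriv]
  have h2 : ∀ (j : Fin (n + 1)) (k : Fin n) (Z : Phase n),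
      (fun I => fluxVecDeriv r₀ (v, j, k, .radial) I Z) =
        ![epsTheta n * epsPhi n * Real.sinc (epsTheta n / 2) * Real.sin (polarAngle n j) *
          Z .pa v, 0, 0] := by
    intro j k Z; ext I; fin_cases I <;> simp [fluxVecDeriv]
  have hp : n * epsPhi n = 2 * Real.pi := by unfold epsPhi; field_simp
  have hs := sin_half_epsTheta_pos hn
  have ht := epsTheta_pos hn
  have hc : epsTheta n * Real.sinc (epsTheta n / 2) * Real.cot (epsTheta n / 2) =
      2 * Real.cos (epsTheta n / 2) := by
    rw [Real.sinc_of_ne_zero (half_pos ht).ne', Real.cot_eq_cos_div_sin]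
    field_simp
  simp only [h1, h2, holVec, fluxVec, edgeForm_radial, Finset.sum_const, Finset.card_univ,
    Fintype.card_fin, nsmul_eq_mul]
  calc _ = (n * epsPhi n) * epsR r₀ n * (epsTheta n * Real.sinc (epsTheta n / 2) *
        ∑ j, Real.sin (polarAngle n j)) * (X .a v * Y .pa v - Y .a v * X .pa v) := by
        simp only [Finset.mul_sum, Finset.sum_mul]
        refine Finset.sum_congr rfl fun j _ => by ring
    _ = _ := by rw [sum_sin_polarAngle hn, hc, hp]; ring

/-- The contribution of all polar and azimuthal edges that start at radius `v`. -/
theorem sum_edgeForm_angular (r₀ c₀ c₁ : ℝ) (hn : n ≠ 0) {x : Phase n} (X Y : Phase n)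
    {v : Fin n} (hx : x .pb v ≠ 0) :
    ∑ j : Fin (n + 1), ∑ k : Fin n,
      (edgeForm (holVec r₀ c₀ c₁ x (v, j, k, .polar)) (fluxVec r₀ x (v, j, k, .polar))
        (fun I => holVecDeriv r₀ c₀ c₁ x (v, j, k, .polar) I X)
        (fun I => fluxVecDeriv r₀ (v, j, k, .polar) I X)
        (fun I => holVecDeriv r₀ c₀ c₁ x (v, j, k, .polar) I Y)
        (fun I => fluxVecDeriv r₀ (v, j, k, .polar) I Y) +
      edgeForm (holVec r₀ c₀ c₁ x (v, j, k, .azimuthal)) (fluxVec r₀ x (v, j, k, .azimuthal))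
        (fun I => holVecDeriv r₀ c₀ c₁ x (v, j, k, .azimuthal) I X)
        (fun I => fluxVecDeriv r₀ (v, j, k, .azimuthal) I X)
        (fun I => holVecDeriv r₀ c₀ c₁ x (v, j, k, .azimuthal) I Y)
        (fun I => fluxVecDeriv r₀ (v, j, k, .azimuthal) I Y)) =
      2 * Real.pi * epsR r₀ n *
        ((FOm r₀ c₀ c₁ x v + HOm r₀ c₀ c₁ x v * capPi r₀ c₀ c₁ x v ^ 2) *
          (X .b v * Y .pb v - Y .b v * X .pb v) +
        1 / 2 * HOm r₀ c₀ c₁ x v * capPi r₀ c₀ c₁ x v *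
          (centralDiff r₀ 0 0 (X .pa) v * Y .b v - centralDiff r₀ 0 0 (Y .pa) v * X .b v) +
        1 / 2 * GOm r₀ c₀ c₁ x v * capPi r₀ c₀ c₁ x v * (x .b v / x .pb v) *
          (centralDiff r₀ 0 0 (X .pa) v * Y .pb v -
            centralDiff r₀ 0 0 (Y .pa) v * X .pb v)) := by
  have h1 : ∀ (j : Fin (n + 1)) (k : Fin n) (Z : Phase n),
      (fun I => holVecDeriv r₀ c₀ c₁ x (v, j, k, .polar) I Z) =
        ![0, epsTheta n * Z .b v, epsTheta n * (centralDiff r₀ 0 0 (Z .pa) v / (2 * x .pb v) -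
          capPi r₀ c₀ c₁ x v * Z .pb v / x .pb v)] := by
    intro j k Z; ext I; fin_cases I <;> simp [holVecDeriv, capPiCLM_apply]
  have h2 : ∀ (j : Fin (n + 1)) (k : Fin n) (Z : Phase n),
      (fun I => fluxVecDeriv r₀ (v, j, k, .polar) I Z) =
        ![0, epsPhi n * epsR r₀ n * Real.sin (polarAngle n j + epsTheta n / 2) * Z .pb v, 0] := by
    intro j k Z; ext I; fin_cases I <;> simp [fluxVecDeriv]
  have h3 : ∀ (j : Fin (n + 1)) (k : Fin n) (Z : Phase n),
      (fun I => holVecDeriv r₀ c₀ c₁ x (v, j, k, .azimuthal) I Z) =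
        ![0, -(epsPhi n * Real.sin (polarAngle n j) *
          (centralDiff r₀ 0 0 (Z .pa) v / (2 * x .pb v) -
          capPi r₀ c₀ c₁ x v * Z .pb v / x .pb v)),
          epsPhi n * Real.sin (polarAngle n j) * Z .b v] := by
    intro j k Z; ext I; fin_cases I <;> simp [holVecDeriv, capPiCLM_apply]
  have h4 : ∀ (j : Fin (n + 1)) (k : Fin n) (Z : Phase n),
      (fun I => fluxVecDeriv r₀ (v, j, k, .azimuthal) I Z) =
        ![0, 0, epsR r₀ n * epsTheta n * Z .pb v] := by
    intro j k Z; ext I; fin_cases I <;> simp [fluxVecDeriv]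
  have h5 : ∀ j, epsPhi n * epsR r₀ n * x .pb v * Real.sin (polarAngle n j + epsTheta n / 2) =
      epsPhi n * epsR r₀ n * Real.sin (polarAngle n j + epsTheta n / 2) * x .pb v :=
    fun j => by ring
  have hp : n * epsPhi n = 2 * Real.pi := by unfold epsPhi; field_simp
  simp only [h1, h2, h3, h4, h5, holVec, fluxVec, edgeForm_polar _ _ _ _ _ _ _ _ _ _ _ hx,
    edgeForm_azimuthal _ _ _ _ _ _ _ _ _ _ _ _ _ hx, Finset.sum_const, Finset.card_univ,
    Fintype.card_fin, nsmul_eq_mul, FOm, GOm, HOm, structF_eq, structG_eq, structH_eq,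
    ← sum_sin_polarAngle_add_half hn, azimSq, ← hp]
  generalize capPi r₀ c₀ c₁ x v = P
  generalize centralDiff r₀ 0 0 (X .pa) v = D
  generalize centralDiff r₀ 0 0 (Y .pa) v = D'
  -- the part of the azimuthal contributions that is odd under `θ ↦ π - θ`
  have hO := sum_cos_polarAngle_mul_eq_zero hn fun c s =>
    epsR r₀ n * epsTheta n * mcCScaled (epsPhi n) (c + (x .b v ^ 2 + P ^ 2) * s ^ 2) * s *
        ((D / (2 * x .pb v) - P * X .pb v / x .pb v) * Y .pb v -
          (D' / (2 * x .pb v) - P * Y .pb v / x .pb v) * X .pb v) +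
      epsR r₀ n * epsTheta n * x .pb v * s ^ 3 * x .b v *
        (epsPhi n ^ 2 * mcDScaled (epsPhi n) (c + (x .b v ^ 2 + P ^ 2) * s ^ 2) *
          (1 - mcDScaled (epsPhi n) (c + (x .b v ^ 2 + P ^ 2) * s ^ 2) *
            (c + (x .b v ^ 2 + P ^ 2) * s ^ 2)) -
          mcCScaled (epsPhi n) (c + (x .b v ^ 2 + P ^ 2) * s ^ 2) ^ 2) *
        ((D / (2 * x .pb v) - P * X .pb v / x .pb v) * Y .b v -
          (D' / (2 * x .pb v) - P * Y .pb v / x .pb v) * X .b v)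
  rw [← sub_eq_zero, ← mul_zero (n : ℝ), ← hO]
  simp only [mul_add, add_mul, Finset.mul_sum, Finset.sum_mul, ← Finset.sum_add_distrib,
    ← Finset.sum_sub_distrib]
  refine Finset.sum_congr rfl fun j _ => ?_
  ring

/-- The pull-back of the holonomy-flux symplectic form. -/
theorem omegaSym_eq_reducedForm (κ β r₀ c₀ c₁ : ℝ) (hn : n ≠ 0) {x : Phase n}
    (hx : ∀ v, x .pb v ≠ 0) (X Y : Phase n) :
    omegaSym κ β r₀ c₀ c₁ x X Y = reducedForm κ β r₀ c₀ c₁ x X Y := by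
  rw [omegaSym_eq_sum_edgeForm κ β r₀ c₀ c₁ hx, reducedForm, Fintype.sum_prod_type]
  rw [Finset.mul_sum, Finset.mul_sum]
  refine Finset.sum_congr rfl fun v _ => ?_
  simp only [Fintype.sum_prod_type, sum_dir, add_assoc]
  have h := sum_edgeForm_radial r₀ c₀ c₁ hn x X Y v
  have h' := sum_edgeForm_angular r₀ c₀ c₁ hn X Y (hx v)
  rw [Finset.sum_congr rfl fun j _ => Finset.sum_add_distrib, Finset.sum_add_distrib, h, h']
  ring

end PullBack

/-! ### Hamiltonian vectors of a block-triangular symplectic form -/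

section BlockForm

variable {n : ℕ}

/-- The pairing of a covector with a tangent vector. -/
def pairing (ℓ X : Phase n) : ℝ := ∑ c, ∑ v, ℓ c v * X c v

theorem sum_coord (f : Coord → ℝ) : ∑ c, f c = f .a + f .b + f .pa + f .pb := by
  have : (Finset.univ : Finset Coord) = {.a, .b, .pa, .pb} := rfl
  rw [this, Finset.sum_insert (by decide), Finset.sum_insert (by decide),
    Finset.sum_insert (by decide), Finset.sum_singleton]
  ring

/-- The covector with only components of kind `c`, given by `F`. -/
def singleCovector (c : Coord) (F : Fin n → ℝ) : Phase n := Pi.single c F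

theorem pairing_singleCovector (c : Coord) (F : Fin n → ℝ) (X : Phase n) :
    pairing (singleCovector c F) X = ∑ v, F v * X c v := by
  rw [pairing, Finset.sum_eq_single c]
  · simp [singleCovector]
  · intro c' _ h; simp [singleCovector, Pi.single_eq_of_ne h]
  · simp

theorem pairing_left_injective {ℓ ℓ' : Phase n} (h : ∀ Y, pairing ℓ Y = pairing ℓ' Y) :
    ℓ = ℓ' := by
  have key : ∀ (m : Phase n) c v, pairing m (singleCovector c (Pi.single v 1)) = m c v := by
    intro m c v
    rw [show pairing m (singleCovector c (Pi.single v 1)) =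
      pairing (singleCovector c (Pi.single v 1)) m by simp only [pairing, mul_comm],
      pairing_singleCovector]
    simp [Pi.single_apply]
  ext c v
  rw [← key ℓ, ← key ℓ', h]

theorem exists_pairing_eq (L : Phase n →L[ℝ] ℝ) : ∃ ℓ : Phase n, ∀ Y, L Y = pairing ℓ Y := by
  refine ⟨fun c v => L (singleCovector c (Pi.single v 1)), fun Y => ?_⟩
  have hY : Y = ∑ c, ∑ v, Y c v • singleCovector c (Pi.single v 1) := by
    ext c v
    simp [singleCovector, Pi.single_apply, Finset.sum_apply, apply_ite, ite_apply]
  conv_lhs => rw [hY]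
  simp [pairing, map_sum, mul_comm]

variable (K A : ℝ) (Φ S T : Fin n → ℝ) (D : (Fin n → ℝ) →ₗ[ℝ] (Fin n → ℝ))

/-- A two-form in which `p_a` also enters through `D p_a`. -/
def blockForm (X Y : Phase n) : ℝ :=
  K * ∑ v, (A * (X .a v * Y .pa v - Y .a v * X .pa v) +
    Φ v * (X .b v * Y .pb v - Y .b v * X .pb v) +
    S v * (D (X .pa) v * Y .b v - D (Y .pa) v * X .b v) +
    T v * (D (X .pa) v * Y .pb v - D (Y .pa) v * X .pb v))

/-- The covector `ι_X ω` of `blockForm`. -/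
def blockFlat (X : Phase n) : Phase n
  | .a, v => -(K * A * X .pa v)
  | .b, v => K * (S v * D (X .pa) v - Φ v * X .pb v)
  | .pa, v => K * (A * X .a v + D (S * X .b) v + D (T * X .pb) v)
  | .pb, v => K * (Φ v * X .b v + T v * D (X .pa) v)

/-- The inverse of `blockFlat`, found by solving for `p_a`, then `b` and `p_b`, then `a`. -/
noncomputable def blockSharp (ℓ : Phase n) : Phase n :=
  let pa : Fin n → ℝ := fun v => -(ℓ .a v / (K * A))
  let b : Fin n → ℝ := fun v => (ℓ .pb v / K - T v * D pa v) / Φ v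
  let pb : Fin n → ℝ := fun v => (S v * D pa v - ℓ .b v / K) / Φ v
  fun
  | .a => fun v => (ℓ .pa v / K - D (S * b) v - D (T * pb) v) / A
  | .b => b
  | .pa => pa
  | .pb => pb

variable {K A Φ S T D}

theorem blockForm_eq_pairing (hD : ∀ f g : Fin n → ℝ, ∑ v, f v * D g v = -∑ v, D f v * g v)
    (X Y : Phase n) : blockForm K A Φ S T D X Y = pairing (blockFlat K A Φ S T D X) Y := by
  have h1 := hD (S * X .b) (Y .pa)
  have h2 := hD (T * X .pb) (Y .pa)
  simp only [Pi.mul_apply] at h1 h2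
  rw [pairing, sum_coord]
  simp only [blockFlat]
  have h3 : blockForm K A Φ S T D X Y = K * ∑ v, (A * (X .a v * Y .pa v - Y .a v * X .pa v) +
      Φ v * (X .b v * Y .pb v - Y .b v * X .pb v) + S v * D (X .pa) v * Y .b v +
      T v * D (X .pa) v * Y .pb v) -
      K * ∑ v, S v * X .b v * D (Y .pa) v - K * ∑ v, T v * X .pb v * D (Y .pa) v := by
    rw [blockForm]
    simp only [Finset.mul_sum, ← Finset.sum_sub_distrib]
    exact Finset.sum_congr rfl fun v _ => by ring
  rw [h3, h1, h2]
  simp only [mul_neg, sub_neg_eq_add, Finset.mul_sum, ← Finset.sum_add_distrib]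
  exact Finset.sum_congr rfl fun v _ => by ring

theorem blockFlat_eq_iff (hK : K ≠ 0) (hA : A ≠ 0) (hΦ : ∀ v, Φ v ≠ 0) (X ℓ : Phase n) :
    blockFlat K A Φ S T D X = ℓ ↔ X = blockSharp K A Φ S T D ℓ := by
  constructor
  · rintro rfl
    have hpa : X .pa = fun v => -(blockFlat K A Φ S T D X .a v / (K * A)) := by
      funext v; simp only [blockFlat]; field_simp
    have hb : X .b = blockSharp K A Φ S T D (blockFlat K A Φ S T D X) .b := by
      funext v
      have := hΦ v
      simp only [blockSharp, ← hpa]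
      simp only [blockFlat]; field_simp; ring
    have hpb : X .pb = blockSharp K A Φ S T D (blockFlat K A Φ S T D X) .pb := by
      funext v
      have := hΦ v
      simp only [blockSharp, ← hpa]
      simp only [blockFlat]; field_simp; ring
    funext c
    cases c
    · funext v
      have h : blockSharp K A Φ S T D (blockFlat K A Φ S T D X) .a v =
        (blockFlat K A Φ S T D X .pa v / K -
          D (S * blockSharp K A Φ S T D (blockFlat K A Φ S T D X) .b) v -
          D (T * blockSharp K A Φ S T D (blockFlat K A Φ S T D X) .pb) v) / A := rfl
      rw [h, ← hb, ← hpb]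
      simp only [blockFlat]; field_simp; ring
    · exact hb
    · exact hpa
    · exact hpb
  · rintro rfl
    funext c v
    have := hΦ v
    cases c <;> simp only [blockFlat, blockSharp] <;> field_simp <;> ring

/-- The bracket of two functions with gradients `ℓ` and `m`. -/
theorem poissonBracket_of_blockForm {ω : Phase n → Phase n → Phase n → ℝ} {x : Phase n}
    (hω : ω x = blockForm K A Φ S T D)
    (hD : ∀ f g : Fin n → ℝ, ∑ v, f v * D g v = -∑ v, D f v * g v)
    (hK : K ≠ 0) (hA : A ≠ 0) (hΦ : ∀ v, Φ v ≠ 0) {f g : Phase n → ℝ} {ℓ m : Phase n}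
    (hf : ∀ Y, fderiv ℝ f x Y = pairing ℓ Y) (hg : ∀ Y, fderiv ℝ g x Y = pairing m Y) :
    poissonBracket ω f g x = pairing ℓ (blockSharp K A Φ S T D m) := by
  have key : ∀ (f : Phase n → ℝ) (ℓ : Phase n), (∀ Y, fderiv ℝ f x Y = pairing ℓ Y) →
      ∀ X, IsHamiltonianVector ω f x X ↔ X = blockSharp K A Φ S T D ℓ := by
    intro f ℓ hf X
    rw [← blockFlat_eq_iff hK hA hΦ, IsHamiltonianVector]
    simp only [hω, hf, blockForm_eq_pairing hD]
    exact ⟨pairing_left_injective, fun h Y => by rw [h]⟩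
  have hv : ∀ (f : Phase n → ℝ) (ℓ : Phase n), (∀ Y, fderiv ℝ f x Y = pairing ℓ Y) →
      hamiltonianVector ω f x = blockSharp K A Φ S T D ℓ := by
    intro f ℓ hf
    have hex : ∃! X, IsHamiltonianVector ω f x X :=
      ⟨_, (key f ℓ hf _).2 rfl, fun X hX => (key f ℓ hf X).1 hX⟩
    rw [hamiltonianVector, dif_pos hex]
    exact (key f ℓ hf _).1 hex.choose_spec.1
  rw [poissonBracket, hv f ℓ hf, hv g m hg, (key f ℓ hf _).2 rfl, hf]

theorem existsUnique_isHamiltonianVector_of_blockForm {ω : Phase n → Phase n → Phase n → ℝ}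
    {x : Phase n} (hω : ω x = blockForm K A Φ S T D)
    (hD : ∀ f g : Fin n → ℝ, ∑ v, f v * D g v = -∑ v, D f v * g v)
    (hK : K ≠ 0) (hA : A ≠ 0) (hΦ : ∀ v, Φ v ≠ 0) (f : Phase n → ℝ) :
    ∃! X, IsHamiltonianVector ω f x X := by
  obtain ⟨ℓ, hℓ⟩ := exists_pairing_eq (fderiv ℝ f x)
  have key : ∀ X, IsHamiltonianVector ω f x X ↔ X = blockSharp K A Φ S T D ℓ := by
    intro X
    rw [← blockFlat_eq_iff hK hA hΦ, IsHamiltonianVector]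
    simp only [hω, hℓ, blockForm_eq_pairing hD]
    exact ⟨pairing_left_injective, fun h Y => by rw [h]⟩
  exact ⟨_, (key _).2 rfl, fun X hX => (key X).1 hX⟩

theorem blockForm_nondegenerate
    (hD : ∀ f g : Fin n → ℝ, ∑ v, f v * D g v = -∑ v, D f v * g v)
    (hK : K ≠ 0) (hA : A ≠ 0) (hΦ : ∀ v, Φ v ≠ 0) (X : Phase n) :
    (∀ Y, blockForm K A Φ S T D X Y = 0) ↔ X = 0 := by
  constructor
  · intro h
    have h0 : blockFlat K A Φ S T D X = 0 := pairing_left_injective fun Y => by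
      rw [← blockForm_eq_pairing hD, h]; simp [pairing]
    have h1 : blockFlat K A Φ S T D 0 = 0 := by
      funext c v; cases c <;> simp [blockFlat]
    rw [(blockFlat_eq_iff hK hA hΦ X 0).1 h0, ← (blockFlat_eq_iff hK hA hΦ 0 0).1 h1]
  · rintro rfl Y; simp [blockForm]

variable (K A Φ S T D)

theorem blockSharp_single_a (G : Fin n → ℝ) :
    blockSharp K A Φ S T D (singleCovector .a G) = fun
      | .a => 0
      | .b => fun v => T v * D G v / (K * A) / Φ v
      | .pa => fun v => -(G v / (K * A))
      | .pb => fun v => -(S v * D G v / (K * A) / Φ v) := by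
  have hp : (fun v => -(G v / (K * A))) = (-(K * A)⁻¹) • G := by
    funext v; simp [div_eq_mul_inv, mul_comm]
  have hz : (S * fun v => (-(T v * D (fun v => -(G v / (K * A))) v)) / Φ v) =
      -(T * fun v => (S v * D (fun v => -(G v / (K * A))) v) / Φ v) := by
    funext v; simp; ring
  funext c v
  cases c
  · simp [blockSharp, singleCovector, hz]
  · simp [blockSharp, singleCovector, hp]; ring
  · simp [blockSharp, singleCovector]
  · simp [blockSharp, singleCovector, hp]; ring

theorem blockSharp_single_b (G : Fin n → ℝ) :
    blockSharp K A Φ S T D (singleCovector .b G) = fun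
      | .a => fun v => D (fun w => T w * G w / (K * Φ w)) v / A
      | .b => 0
      | .pa => 0
      | .pb => fun v => -(G v / (K * Φ v)) := by
  have hz : (T * fun v => -(G v / K) / Φ v) = -(fun w => T w * G w / (K * Φ w)) := by
    funext v; simp; ring
  have h0 : (fun _ : Fin n => (0 : ℝ)) = 0 := rfl
  have h1 : S * (0 : Fin n → ℝ) = 0 := mul_zero _
  funext c v
  cases c
  · simp [blockSharp, singleCovector, hz, h0, h1]
  · simp [blockSharp, singleCovector, h0]
  · simp [blockSharp, singleCovector]
  · simp [blockSharp, singleCovector, h0]; ring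

theorem blockSharp_single_pa (G : Fin n → ℝ) :
    blockSharp K A Φ S T D (singleCovector .pa G) = fun
      | .a => fun v => G v / (K * A)
      | .b => 0
      | .pa => 0
      | .pb => 0 := by
  have h0 : (fun _ : Fin n => (0 : ℝ)) = 0 := rfl
  have h1 : S * (0 : Fin n → ℝ) = 0 := mul_zero _
  have h2 : T * (0 : Fin n → ℝ) = 0 := mul_zero _
  funext c v
  cases c <;> simp [blockSharp, singleCovector, h0, h1, h2]
  ring

theorem blockSharp_single_pb (G : Fin n → ℝ) :
    blockSharp K A Φ S T D (singleCovector .pb G) = fun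
      | .a => fun v => -(D (fun w => S w * G w / (K * Φ w)) v / A)
      | .b => fun v => G v / (K * Φ v)
      | .pa => 0
      | .pb => 0 := by
  have hz : (S * fun v => (G v / K) / Φ v) = (fun w => S w * G w / (K * Φ w)) := by
    funext v; simp; ring
  have h0 : (fun _ : Fin n => (0 : ℝ)) = 0 := rfl
  have h1 : T * (0 : Fin n → ℝ) = 0 := mul_zero _
  funext c v
  cases c
  · simp [blockSharp, singleCovector, hz, h0, h1]; ring
  · simp [blockSharp, singleCovector, h0]; ring
  · simp [blockSharp, singleCovector]
  · simp [blockSharp, singleCovector, h0]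

end BlockForm

/-! ### The Poisson algebra on the lattice -/

section LatticeAlgebra

variable {n : ℕ}

theorem extendLattice_zero_eq_sum_kronSucc (f : Fin n → ℝ) (v : Fin n) :
    extendLattice 0 0 f ((v : ℕ) + 2) = ∑ w, kronSucc w v * f w := by
  rw [extendLattice, if_neg (by omega)]
  split_ifs with h
  · rw [Finset.sum_eq_single ⟨(v : ℕ) + 1, h⟩]
    · simp [kronSucc]
    · intro w _ hw
      have : (w : ℕ) ≠ v + 1 := fun h' => hw (Fin.ext h')
      simp [kronSucc, this]
    · simp
  · symm
    refine Finset.sum_eq_zero fun w _ => ?_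
    have : (w : ℕ) ≠ v + 1 := fun h' => h (by have := w.2; omega)
    simp [kronSucc, this]

theorem extendLattice_zero_eq_sum_kronSucc' (f : Fin n → ℝ) (v : Fin n) :
    extendLattice 0 0 f (v : ℕ) = ∑ w, kronSucc v w * f w := by
  rw [extendLattice]
  split_ifs with h0 h
  · symm
    refine Finset.sum_eq_zero fun w _ => ?_
    simp [kronSucc, h0]
  · rw [Finset.sum_eq_single ⟨(v : ℕ) - 1, h⟩]
    · have : (v : ℕ) = v - 1 + 1 := by omega
      simp [kronSucc, ← this]
    · intro w _ hw
      have : (v : ℕ) ≠ w + 1 := fun h' => hw (Fin.ext (by simp [h']))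
      simp [kronSucc, this]
    · simp
  · exact absurd v.2 (by omega)

theorem centralDiff_zero_eq_sum (r₀ : ℝ) (f : Fin n → ℝ) (v : Fin n) :
    centralDiff r₀ 0 0 f v = ∑ w, (kronSucc w v - kronSucc v w) / (2 * epsR r₀ n) * f w := by
  rw [centralDiff, extendLattice_zero_eq_sum_kronSucc, extendLattice_zero_eq_sum_kronSucc',
    ← Finset.sum_sub_distrib, Finset.sum_div]
  exact Finset.sum_congr rfl fun w _ => by ring

/-- The central difference with vanishing boundary values. -/
noncomputable def centralDiffLM (r₀ : ℝ) (n : ℕ) : (Fin n → ℝ) →ₗ[ℝ] (Fin n → ℝ) where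
  toFun f := centralDiff r₀ 0 0 f
  map_add' f g := by
    funext v
    simp [centralDiff_zero_eq_sum, mul_add, Finset.sum_add_distrib]
  map_smul' c f := by
    funext v
    simp only [centralDiff_zero_eq_sum, Pi.smul_apply, smul_eq_mul, RingHom.id_apply,
      Finset.mul_sum]
    exact Finset.sum_congr rfl fun w _ => by ring

theorem centralDiffLM_apply (r₀ : ℝ) (f : Fin n → ℝ) (v : Fin n) :
    centralDiffLM r₀ n f v = ∑ w, (kronSucc w v - kronSucc v w) / (2 * epsR r₀ n) * f w :=
  centralDiff_zero_eq_sum r₀ f v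

/-- Summation by parts. -/
theorem sum_mul_centralDiffLM (r₀ : ℝ) (f g : Fin n → ℝ) :
    ∑ v, f v * centralDiffLM r₀ n g v = -∑ v, centralDiffLM r₀ n f v * g v := by
  simp only [centralDiffLM_apply, Finset.mul_sum, Finset.sum_mul]
  rw [Finset.sum_comm, ← Finset.sum_neg_distrib]
  refine Finset.sum_congr rfl fun v _ => ?_
  rw [← Finset.sum_neg_distrib]
  exact Finset.sum_congr rfl fun w _ => by ring

/-- `(4π/κβ) ε_r`. -/
noncomputable def formScale (κ β r₀ : ℝ) (n : ℕ) : ℝ := 4 * Real.pi / (κ * β) * epsR r₀ n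

/-- `F_Ω + H_Ω Π_ε²`. -/
noncomputable def phiCoeff (r₀ c₀ c₁ : ℝ) (x : Phase n) (v : Fin n) : ℝ :=
  FOm r₀ c₀ c₁ x v + HOm r₀ c₀ c₁ x v * capPi r₀ c₀ c₁ x v ^ 2

/-- The coefficient of `Δ_r(δp_a) ∧ δb`. -/
noncomputable def bCoeff (r₀ c₀ c₁ : ℝ) (x : Phase n) (v : Fin n) : ℝ :=
  1 / 2 * HOm r₀ c₀ c₁ x v * capPi r₀ c₀ c₁ x v

/-- The coefficient of `Δ_r(δp_a) ∧ δp_b`. -/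
noncomputable def pbCoeff (r₀ c₀ c₁ : ℝ) (x : Phase n) (v : Fin n) : ℝ :=
  1 / 2 * GOm r₀ c₀ c₁ x v * capPi r₀ c₀ c₁ x v * (x .b v / x .pb v)

theorem omegaSym_eq_blockForm (κ β r₀ c₀ c₁ : ℝ) (hn : n ≠ 0) {x : Phase n}
    (hx : ∀ v, x .pb v ≠ 0) :
    omegaSym κ β r₀ c₀ c₁ x = blockForm (formScale κ β r₀ n) (2 * Real.cos (epsTheta n / 2))
      (phiCoeff r₀ c₀ c₁ x) (bCoeff r₀ c₀ c₁ x) (pbCoeff r₀ c₀ c₁ x) (centralDiffLM r₀ n) := by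
  funext X Y
  rw [omegaSym_eq_reducedForm κ β r₀ c₀ c₁ hn hx, reducedForm, blockForm, formScale,
    mul_assoc (4 * Real.pi / (κ * β)), ← Finset.mul_sum]
  rfl

theorem Fbpb_eq (κ β r₀ c₀ c₁ : ℝ) (x : Phase n) (v : Fin n) :
    Fbpb κ β r₀ c₀ c₁ x v = formScale κ β r₀ n * phiCoeff r₀ c₀ c₁ x v := rfl

theorem cos_half_epsTheta_pos (hn : 2 ≤ n) : 0 < Real.cos (epsTheta n / 2) := by
  have h2 : (2 : ℝ) ≤ n := by exact_mod_cast hn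
  have h := natCast_mul_epsTheta (n := n) (by omega)
  have h0 := epsTheta_nonneg n
  apply Real.cos_pos_of_mem_Ioo
  constructor <;> nlinarith [Real.pi_pos]

theorem epsR_pos {r₀ : ℝ} (hr₀ : 0 < r₀) (hn : n ≠ 0) : 0 < epsR r₀ n := by
  unfold epsR; positivity

theorem formScale_ne_zero {κ β r₀ : ℝ} (hκ : 0 < κ) (hβ : β ≠ 0) (hr₀ : 0 < r₀) (hn : n ≠ 0) :
    formScale κ β r₀ n ≠ 0 := by
  have := epsR_pos hr₀ hn
  unfold formScale; positivity

/-- A linear function of the coordinates of kind `c`. -/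
def linearFunction (c : Coord) (F : Fin n → ℝ) (y : Phase n) : ℝ := ∑ v, F v * y c v

theorem fderiv_linearFunction (c : Coord) (F : Fin n → ℝ) (x Y : Phase n) :
    fderiv ℝ (linearFunction c F) x Y = pairing (singleCovector c F) Y := by
  have h : HasFDerivAt (linearFunction c F) (∑ v, F v • coordCLM c v) x :=
    HasFDerivAt.fun_sum fun v _ => (hasFDerivAt_coord c v x).const_mul (F v)
  rw [h.fderiv, pairing_singleCovector]
  simp

/-- The bracket of two linear functions of one kind of coordinate each. -/
theorem poissonBracket_linearFunction {κ β r₀ : ℝ} (hκ : 0 < κ) (hβ : β ≠ 0) (hr₀ : 0 < r₀)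
    (c₀ c₁ : ℝ) (hn : 2 ≤ n) {x : Phase n} (hx : ∀ v, x .pb v ≠ 0)
    (hF : ∀ v, Fbpb κ β r₀ c₀ c₁ x v ≠ 0) (c c' : Coord) (F G : Fin n → ℝ) :
    poissonBracket (omegaSym κ β r₀ c₀ c₁) (linearFunction c F) (linearFunction c' G) x =
      ∑ v, F v * blockSharp (formScale κ β r₀ n) (2 * Real.cos (epsTheta n / 2))
        (phiCoeff r₀ c₀ c₁ x) (bCoeff r₀ c₀ c₁ x) (pbCoeff r₀ c₀ c₁ x) (centralDiffLM r₀ n)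
        (singleCovector c' G) c v := by
  have hn0 : n ≠ 0 := by omega
  rw [poissonBracket_of_blockForm (omegaSym_eq_blockForm κ β r₀ c₀ c₁ hn0 hx)
    (sum_mul_centralDiffLM r₀) (formScale_ne_zero hκ hβ hr₀ hn0)
    (mul_ne_zero two_ne_zero (cos_half_epsTheta_pos hn).ne')
    (fun v h => hF v (by rw [Fbpb_eq, h, mul_zero])) (fderiv_linearFunction c F x)
    (fderiv_linearFunction c' G x), pairing_singleCovector]

theorem coord_eq_linearFunction (c : Coord) (v : Fin n) :
    (fun y : Phase n => y c v) = linearFunction c (kron v) := by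
  funext y
  simp [linearFunction, kron]

theorem coordBracket_eq {κ β r₀ : ℝ} (hκ : 0 < κ) (hβ : β ≠ 0) (hr₀ : 0 < r₀)
    (c₀ c₁ : ℝ) (hn : 2 ≤ n) {x : Phase n} (hx : ∀ v, x .pb v ≠ 0)
    (hF : ∀ v, Fbpb κ β r₀ c₀ c₁ x v ≠ 0) (c c' : Coord) (v v' : Fin n) :
    coordBracket κ β r₀ c₀ c₁ x c v c' v' =
      blockSharp (formScale κ β r₀ n) (2 * Real.cos (epsTheta n / 2))
        (phiCoeff r₀ c₀ c₁ x) (bCoeff r₀ c₀ c₁ x) (pbCoeff r₀ c₀ c₁ x) (centralDiffLM r₀ n)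
        (singleCovector c' (kron v')) c v := by
  rw [coordBracket, coord_eq_linearFunction, coord_eq_linearFunction,
    poissonBracket_linearFunction hκ hβ hr₀ c₀ c₁ hn hx hF]
  simp [kron]

theorem kron_comm (v v' : Fin n) : kron v v' = kron v' v := by
  simp [kron, eq_comm]

theorem centralDiffLM_mul_kron_div (r₀ : ℝ) (T : Fin n → ℝ) (d : Fin n → ℝ) (v v' : Fin n) :
    centralDiffLM r₀ n (fun w => T w * kron v' w / d w) v =
      (kronSucc v' v - kronSucc v v') / (2 * epsR r₀ n) * (T v' / d v') := by
  rw [centralDiffLM_apply, Finset.sum_eq_single v']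
  · simp [kron]
  · intro w _ hw; simp [kron, hw.symm]
  · simp

/-! ### Positivity of the structure functions -/

theorem mcD_pos {x : ℝ} (hx : 0 ≤ x) : 0 < mcD x := by
  rcases hx.eq_or_lt with rfl | hx
  · simp [mcD, divSq]
  · have hs := Real.sqrt_pos.2 hx
    have h : Real.sinc √x < 1 := by
      rw [Real.sinc_of_ne_zero hs.ne', div_lt_one hs]
      exact Real.sin_lt hs
    have := mul_mcD hx.le
    exact pos_of_mul_pos_right (by linarith) hx.le

theorem mcDScaled_pos {ε y : ℝ} (hε : 0 < ε) (hy : 0 ≤ y) : 0 < mcDScaled ε y :=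
  mul_pos (by positivity) (mcD_pos (by positivity))

theorem mcCScaled_nonneg (ε y : ℝ) : 0 ≤ mcCScaled ε y := by
  unfold mcCScaled mcC; positivity

theorem cos_mul_cot_pos (hn : 2 ≤ n) :
    0 < Real.cos (epsTheta n / 2) * Real.cot (epsTheta n / 2) := by
  rw [Real.cot_eq_cos_div_sin]
  exact mul_pos (cos_half_epsTheta_pos hn)
    (div_pos (cos_half_epsTheta_pos hn) (sin_half_epsTheta_pos (by omega)))

theorem structG_pos (hn : 2 ≤ n) (b P : ℝ) : 0 < structG n b P := by
  have hn0 : n ≠ 0 := by omega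
  rw [structG_eq]
  refine mul_pos (epsTheta_pos hn0) (add_pos_of_pos_of_nonneg
    (mul_pos (mcDScaled_pos (epsTheta_pos hn0) (by positivity)) (cos_mul_cot_pos hn))
    (Finset.sum_nonneg fun j _ => mul_nonneg
      (mcDScaled_pos (epsPhi_pos hn0) (azimSq_nonneg n j b P)).le
      (pow_nonneg (sin_polarAngle_nonneg n j) 3)))

theorem structH_nonneg (hn : 2 ≤ n) (b P : ℝ) : 0 ≤ structH n b P := by
  rw [structH_eq]
  exact mul_nonneg (epsTheta_nonneg n) (add_nonneg
    (mul_nonneg (mcCScaled_nonneg _ _) (cos_mul_cot_pos hn).le)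
    (Finset.sum_nonneg fun j _ => mul_nonneg (mcCScaled_nonneg _ _)
      (pow_nonneg (sin_polarAngle_nonneg n j) 3)))

/-- For `b² + Π² ≤ 1` the arguments of all `sinc` in `F_Ω` are at most `π`. -/
theorem structF_pos (hn : 2 ≤ n) {b P : ℝ} (hb : b ≠ 0) (h : b ^ 2 + P ^ 2 ≤ 1) :
    0 < structF n b P := by
  have hn0 : n ≠ 0 := by omega
  have h2 : (2 : ℝ) ≤ n := by exact_mod_cast hn
  have hpi := natCast_mul_epsTheta (n := n) hn0
  have ht := epsTheta_pos hn0
  have hp : epsPhi n = 2 * epsTheta n := by unfold epsPhi epsTheta; ring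
  have hp0 := epsPhi_pos hn0
  have hple : epsPhi n ≤ Real.pi := by rw [hp]; nlinarith
  have hsinc : ∀ ε y : ℝ, 0 ≤ ε → ε ≤ Real.pi → 0 ≤ y → y ≤ 1 → y * mcDScaled ε y ≤ 1 := by
    intro ε y hε hεp hy hy1
    rw [mul_mcDScaled hε hy]
    have hs : √y ≤ 1 := Real.sqrt_le_one.2 hy1
    have hle : ε * √y ≤ Real.pi := by nlinarith [Real.sqrt_nonneg y]
    have h0 : 0 ≤ ε * √y := mul_nonneg hε (Real.sqrt_nonneg y)
    have : 0 ≤ Real.sinc (ε * √y) := by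
      by_cases hz : ε * √y = 0
      · simp [hz]
      · rw [Real.sinc_of_ne_zero hz]
        exact div_nonneg (Real.sin_nonneg_of_nonneg_of_le_pi h0 hle) h0
    linarith
  rw [structF_eq]
  refine mul_pos ht (add_pos_of_pos_of_nonneg (mul_pos ?_ (cos_mul_cot_pos hn))
    (Finset.sum_nonneg fun j _ => mul_nonneg ?_ (sin_polarAngle_nonneg n j)))
  · have h1 := hsinc (epsTheta n) (b ^ 2 + P ^ 2) ht.le (by linarith) (by positivity) h
    have h3 := mcDScaled_pos ht (y := b ^ 2 + P ^ 2) (by positivity)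
    have : 0 < b ^ 2 * mcDScaled (epsTheta n) (b ^ 2 + P ^ 2) := by positivity
    linarith
  · have hcs := Real.cos_sq_add_sin_sq (polarAngle n j)
    have hy1 : azimSq n j b P ≤ 1 := by
      unfold azimSq
      nlinarith [sq_nonneg (Real.sin (polarAngle n j))]
    have h1 := hsinc (epsPhi n) (azimSq n j b P) hp0.le hple (azimSq_nonneg n j b P) hy1
    have h3 := mcDScaled_pos hp0 (azimSq_nonneg n j b P)
    have h4 : 0 ≤ b ^ 2 * Real.sin (polarAngle n j) ^ 2 *
      mcDScaled (epsPhi n) (azimSq n j b P) := by positivity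
    have h5 : azimSq n j b P = b ^ 2 * Real.sin (polarAngle n j) ^ 2 +
      (Real.cos (polarAngle n j) ^ 2 + P ^ 2 * Real.sin (polarAngle n j) ^ 2) := by
      unfold azimSq; ring
    have h6 : azimSq n j b P * mcDScaled (epsPhi n) (azimSq n j b P) =
      b ^ 2 * Real.sin (polarAngle n j) ^ 2 * mcDScaled (epsPhi n) (azimSq n j b P) +
      (Real.cos (polarAngle n j) ^ 2 + P ^ 2 * Real.sin (polarAngle n j) ^ 2) *
        mcDScaled (epsPhi n) (azimSq n j b P) := by
      rw [← add_mul, ← h5]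
    linarith

/-! ### The coordinate brackets -/

theorem phiCoeff_ne_zero {κ β r₀ c₀ c₁ : ℝ} {x : Phase n} {v : Fin n}
    (hF : Fbpb κ β r₀ c₀ c₁ x v ≠ 0) : phiCoeff r₀ c₀ c₁ x v ≠ 0 :=
  fun h => hF (by rw [Fbpb_eq, h, mul_zero])

theorem coordBracket_a_b {κ β r₀ : ℝ} (hκ : 0 < κ) (hβ : β ≠ 0) (hr₀ : 0 < r₀) (c₀ c₁ : ℝ)
    (hn : 2 ≤ n) {x : Phase n} (hx : ∀ v, x .pb v ≠ 0) (hF : ∀ v, Fbpb κ β r₀ c₀ c₁ x v ≠ 0)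
    (v v' : Fin n) :
    coordBracket κ β r₀ c₀ c₁ x .a v .b v' =
      κ * β / (32 * Real.pi * epsR r₀ n ^ 2) * (Real.cos (epsTheta n / 2))⁻¹ *
        (GOm r₀ c₀ c₁ x v' * capPi r₀ c₀ c₁ x v' /
          (FOm r₀ c₀ c₁ x v' + HOm r₀ c₀ c₁ x v' * capPi r₀ c₀ c₁ x v' ^ 2)) *
        (x .b v' / x .pb v') * (kronSucc v' v - kronSucc v v') := by
  have hΦ := phiCoeff_ne_zero (hF v')
  have hε := epsR_pos (n := n) hr₀ (by omega)
  have hc := cos_half_epsTheta_pos hn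
  rw [coordBracket_eq hκ hβ hr₀ c₀ c₁ hn hx hF, blockSharp_single_b]
  simp only [centralDiffLM_mul_kron_div]
  rw [← phiCoeff, pbCoeff, formScale]
  field_simp
  ring

theorem coordBracket_a_pb {κ β r₀ : ℝ} (hκ : 0 < κ) (hβ : β ≠ 0) (hr₀ : 0 < r₀) (c₀ c₁ : ℝ)
    (hn : 2 ≤ n) {x : Phase n} (hx : ∀ v, x .pb v ≠ 0) (hF : ∀ v, Fbpb κ β r₀ c₀ c₁ x v ≠ 0)
    (v v' : Fin n) :
    coordBracket κ β r₀ c₀ c₁ x .a v .pb v' =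
      κ * β / (32 * Real.pi * epsR r₀ n ^ 2) * (Real.cos (epsTheta n / 2))⁻¹ *
        (HOm r₀ c₀ c₁ x v' * capPi r₀ c₀ c₁ x v' /
          (FOm r₀ c₀ c₁ x v' + HOm r₀ c₀ c₁ x v' * capPi r₀ c₀ c₁ x v' ^ 2)) *
        (kronSucc v v' - kronSucc v' v) := by
  have hΦ := phiCoeff_ne_zero (hF v')
  have hε := epsR_pos (n := n) hr₀ (by omega)
  have hc := cos_half_epsTheta_pos hn
  rw [coordBracket_eq hκ hβ hr₀ c₀ c₁ hn hx hF, blockSharp_single_pb]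
  simp only [centralDiffLM_mul_kron_div]
  rw [← phiCoeff, bCoeff, formScale]
  field_simp
  ring

theorem coordBracket_a_pa {κ β r₀ : ℝ} (hκ : 0 < κ) (hβ : β ≠ 0) (hr₀ : 0 < r₀) (c₀ c₁ : ℝ)
    (hn : 2 ≤ n) {x : Phase n} (hx : ∀ v, x .pb v ≠ 0) (hF : ∀ v, Fbpb κ β r₀ c₀ c₁ x v ≠ 0)
    (v v' : Fin n) :
    coordBracket κ β r₀ c₀ c₁ x .a v .pa v' =
      κ * β / (8 * Real.pi * epsR r₀ n) * (Real.cos (epsTheta n / 2))⁻¹ * kron v v' := by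
  have hε := epsR_pos (n := n) hr₀ (by omega)
  have hc := cos_half_epsTheta_pos hn
  rw [coordBracket_eq hκ hβ hr₀ c₀ c₁ hn hx hF, blockSharp_single_pa, kron_comm v v']
  simp only [formScale]
  field_simp
  ring

theorem coordBracket_b_pb {κ β r₀ : ℝ} (hκ : 0 < κ) (hβ : β ≠ 0) (hr₀ : 0 < r₀) (c₀ c₁ : ℝ)
    (hn : 2 ≤ n) {x : Phase n} (hx : ∀ v, x .pb v ≠ 0) (hF : ∀ v, Fbpb κ β r₀ c₀ c₁ x v ≠ 0)
    (v v' : Fin n) :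
    coordBracket κ β r₀ c₀ c₁ x .b v .pb v' =
      κ * β / (4 * Real.pi * epsR r₀ n) *
        (1 / (FOm r₀ c₀ c₁ x v + HOm r₀ c₀ c₁ x v * capPi r₀ c₀ c₁ x v ^ 2)) * kron v v' := by
  have hΦ := phiCoeff_ne_zero (hF v)
  have hε := epsR_pos (n := n) hr₀ (by omega)
  rw [coordBracket_eq hκ hβ hr₀ c₀ c₁ hn hx hF, blockSharp_single_pb, kron_comm v v',
    ← phiCoeff]
  simp only [formScale]
  field_simp

theorem coordBracket_a_b_ne_zero_iff {κ β r₀ : ℝ} (hκ : 0 < κ) (hβ : β ≠ 0) (hr₀ : 0 < r₀)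
    (c₀ c₁ : ℝ) (hn : 2 ≤ n) {x : Phase n} (hx : ∀ v, x .pb v ≠ 0)
    (hF : ∀ v, Fbpb κ β r₀ c₀ c₁ x v ≠ 0) (v v' : Fin n) :
    coordBracket κ β r₀ c₀ c₁ x .a v .b v' ≠ 0 ↔
      ((v : ℕ) = v' + 1 ∨ (v' : ℕ) = v + 1) ∧ x .b v' ≠ 0 ∧ capPi r₀ c₀ c₁ x v' ≠ 0 := by
  have hΦ := phiCoeff_ne_zero (hF v')
  have hε := epsR_pos (n := n) hr₀ (by omega)
  have hc := cos_half_epsTheta_pos hn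
  have hG : GOm r₀ c₀ c₁ x v' ≠ 0 := (structG_pos hn _ _).ne'
  have hk : kronSucc v' v - kronSucc v v' ≠ 0 ↔ ((v : ℕ) = v' + 1 ∨ (v' : ℕ) = v + 1) := by
    unfold kronSucc
    split_ifs with h1 h2 h2
    · omega
    · simp [h1]
    · simp [h2]
    · simp [h1, h2]
  rw [coordBracket_a_b hκ hβ hr₀ c₀ c₁ hn hx hF, ← hk, ← phiCoeff]
  have hπ := Real.pi_pos.ne'
  have := hx v'
  simp only [ne_eq, mul_eq_zero, div_eq_zero_iff, inv_eq_zero, hκ.ne', hβ, hΦ, hG, hc.ne',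
    pow_eq_zero_iff, hε.ne', hπ, this, OfNat.ofNat_ne_zero, not_false_eq_true, or_false,
    false_or, not_or]
  tauto

/-- On every lattice with `n ≥ 2` some configuration variables fail to commute: take `b = 1/2`,
`p_a` constant but different from its value at radius `0`, and `p_b` so large that
`b² + Π² ≤ 1`. -/
theorem exists_coordBracket_a_b_ne_zero {κ β r₀ : ℝ} (hκ : 0 < κ) (hβ : β ≠ 0) (hr₀ : 0 < r₀)
    (c₀ c₁ : ℝ) (hn : 2 ≤ n) :
    ∃ x : Phase n, (∀ v, x .pb v ≠ 0) ∧ (∀ v, Fbpb κ β r₀ c₀ c₁ x v ≠ 0) ∧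
      ∃ v v' : Fin n, coordBracket κ β r₀ c₀ c₁ x .a v .b v' ≠ 0 := by
  have hn0 : n ≠ 0 := by omega
  have hε := epsR_pos hr₀ hn0
  let pa : Fin n → ℝ := fun _ => c₀ + 1
  let B : ℝ := 1 + ∑ v, |centralDiff r₀ c₀ c₁ pa v|
  have hB1 : ∀ v, |centralDiff r₀ c₀ c₁ pa v| ≤ B := fun v => by
    have := Finset.single_le_sum (f := fun v => |centralDiff r₀ c₀ c₁ pa v|)
      (fun _ _ => abs_nonneg _) (Finset.mem_univ v)
    simp only [B]; linarith
  have hB0 : 0 < B := by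
    have : 0 ≤ ∑ v, |centralDiff r₀ c₀ c₁ pa v| := Finset.sum_nonneg fun _ _ => abs_nonneg _
    simp only [B]; linarith
  let x : Phase n := fun
    | .a => 0
    | .b => fun _ => 1 / 2
    | .pa => pa
    | .pb => fun _ => B
  have hx : ∀ v, x .pb v ≠ 0 := fun v => hB0.ne'
  have hcap : ∀ v, |capPi r₀ c₀ c₁ x v| ≤ 1 / 2 := fun v => by
    have : capPi r₀ c₀ c₁ x v = centralDiff r₀ c₀ c₁ pa v / (2 * B) := rfl
    rw [this, abs_div, abs_of_pos (by positivity : (0 : ℝ) < 2 * B), div_le_iff₀ (by positivity)]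
    linarith [hB1 v]
  have hF : ∀ v, Fbpb κ β r₀ c₀ c₁ x v ≠ 0 := fun v => by
    rw [Fbpb_eq]
    refine mul_ne_zero (formScale_ne_zero hκ hβ hr₀ hn0) (ne_of_gt ?_)
    have h1 : (capPi r₀ c₀ c₁ x v) ^ 2 ≤ (1 / 2) ^ 2 := sq_le_sq' (by linarith [abs_le.1 (hcap v)])
      (abs_le.1 (hcap v)).2
    have h2 : 0 < structF n (1 / 2) (capPi r₀ c₀ c₁ x v) :=
      structF_pos hn (by norm_num) (by linarith)
    exact add_pos_of_pos_of_nonneg h2 (mul_nonneg (structH_nonneg hn _ _) (sq_nonneg _))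
  refine ⟨x, hx, hF, ⟨1, by omega⟩, ⟨0, by omega⟩, ?_⟩
  rw [coordBracket_a_b_ne_zero_iff hκ hβ hr₀ c₀ c₁ hn hx hF]
  refine ⟨Or.inl rfl, by norm_num [x], ?_⟩
  have h1 : extendLattice c₀ c₁ pa 2 = c₀ + 1 := by
    rw [extendLattice, if_neg (by norm_num), dif_pos (by omega)]
  have h2 : extendLattice c₀ c₁ pa 0 = c₀ := by simp [extendLattice]
  have h3 : capPi r₀ c₀ c₁ x ⟨0, by omega⟩ =
      (extendLattice c₀ c₁ pa 2 - extendLattice c₀ c₁ pa 0) / (2 * epsR r₀ n) / (2 * B) := rfl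
  rw [h3, h1, h2, add_sub_cancel_left]
  positivity

end LatticeAlgebra

/-! ### Uniform limits of the structure functions -/

section UniformLimits

open Filter Topology

theorem mcD_le {x : ℝ} (hx : 0 ≤ x) : mcD x ≤ 1 / 6 := by
  rcases hx.eq_or_lt with rfl | hx
  · simp [mcD, divSq]
  · have hs := Real.sqrt_pos.2 hx
    have hsq := Real.sq_sqrt hx.le
    have hm := mul_mcD hx.le
    have h := Real.sin_gt_sub_cube hs
    have h2 : 1 - x / 6 ≤ Real.sinc √x := by
      rw [Real.sinc_of_ne_zero hs.ne', le_div_iff₀ hs]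
      nlinarith
    nlinarith

theorem mcDScaled_le {ε y : ℝ} (hy : 0 ≤ y) : mcDScaled ε y ≤ 2 * ε ^ 2 := by
  have := mcD_le (x := ε ^ 2 * y) (by positivity)
  unfold mcDScaled
  nlinarith [sq_nonneg ε]

theorem mcCScaled_le (ε y : ℝ) : mcCScaled ε y ≤ 2 * ε ^ 2 := by
  have h : mcC (ε ^ 2 * y) ≤ 2 := by
    unfold mcC
    have := (sq_le_one_iff_abs_le_one _).2 (Real.abs_sinc_le_one (√(ε ^ 2 * y) / 2))
    linarith
  unfold mcCScaled
  nlinarith [sq_nonneg ε]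

/-- The polar weight `ε_θ cos (ε_θ/2) cot (ε_θ/2)`. -/
noncomputable def polarWeight (n : ℕ) : ℝ :=
  epsTheta n * (Real.cos (epsTheta n / 2) * Real.cot (epsTheta n / 2))

/-- The azimuthal weight `ε_θ ∑_j sin θ_j`. -/
noncomputable def azimWeight (n : ℕ) : ℝ :=
  epsTheta n * ∑ j : Fin (n + 1), Real.sin (polarAngle n j)

theorem tendsto_epsTheta : Tendsto epsTheta atTop (𝓝 0) :=
  tendsto_const_div_atTop_nhds_zero_nat Real.pi

theorem tendsto_epsPhi : Tendsto epsPhi atTop (𝓝 0) :=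
  tendsto_const_div_atTop_nhds_zero_nat (2 * Real.pi)

theorem tendsto_cos_half_epsTheta : Tendsto (fun n => Real.cos (epsTheta n / 2)) atTop (𝓝 1) := by
  have h := (Real.continuous_cos.tendsto 0).comp (by simpa using tendsto_epsTheta.div_const 2)
  simpa [Function.comp_def] using h

theorem tendsto_sinc_half_epsTheta :
    Tendsto (fun n => Real.sinc (epsTheta n / 2)) atTop (𝓝 1) := by
  have h := (Real.continuous_sinc.tendsto 0).comp (by simpa using tendsto_epsTheta.div_const 2)
  simpa [Function.comp_def] using h

theorem epsTheta_mul_cot {n : ℕ} (hn : n ≠ 0) : epsTheta n * Real.cot (epsTheta n / 2) =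
    2 * Real.cos (epsTheta n / 2) / Real.sinc (epsTheta n / 2) := by
  have ht := epsTheta_pos hn
  have hs := sin_half_epsTheta_pos hn
  rw [Real.sinc_of_ne_zero (half_pos ht).ne', Real.cot_eq_cos_div_sin]
  field_simp

theorem tendsto_azimWeight : Tendsto azimWeight atTop (𝓝 2) := by
  have h := (tendsto_cos_half_epsTheta.const_mul 2).div tendsto_sinc_half_epsTheta one_ne_zero
  rw [mul_one, div_one] at h
  refine h.congr' ?_
  filter_upwards [eventually_ne_atTop 0] with n hn
  simp only [Pi.div_apply]
  rw [azimWeight, sum_sin_polarAngle hn, epsTheta_mul_cot hn]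

theorem tendsto_polarWeight : Tendsto polarWeight atTop (𝓝 2) := by
  have h := tendsto_cos_half_epsTheta.mul tendsto_azimWeight
  rw [one_mul] at h
  refine h.congr' ?_
  filter_upwards [eventually_ne_atTop 0] with n hn
  rw [azimWeight, polarWeight, sum_sin_polarAngle hn]
  ring

/-- A bound on `G_Ω` and `H_Ω`, of order `1/n²`. -/
noncomputable def smallBound (n : ℕ) : ℝ := 2 * epsPhi n ^ 2 * (polarWeight n + azimWeight n)

theorem tendsto_natCast_mul_smallBound : Tendsto (fun n : ℕ => n * smallBound n) atTop (𝓝 0) := by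
  have h := ((tendsto_epsPhi.const_mul (4 * Real.pi)).mul
    (tendsto_polarWeight.add tendsto_azimWeight))
  rw [mul_zero, zero_mul] at h
  refine h.congr' ?_
  filter_upwards [eventually_ne_atTop 0] with n hn
  have : n * epsPhi n = 2 * Real.pi := by unfold epsPhi; field_simp
  rw [smallBound]
  linear_combination (-2 * epsPhi n * (polarWeight n + azimWeight n)) * this

theorem tendsto_smallBound : Tendsto smallBound atTop (𝓝 0) := by
  have h := ((tendsto_epsPhi.pow 2).const_mul 2).mul (tendsto_polarWeight.add tendsto_azimWeight)
  rw [zero_pow two_ne_zero, mul_zero, zero_mul] at h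
  exact h

variable {n : ℕ}

theorem polarWeight_pos (hn : 2 ≤ n) : 0 < polarWeight n :=
  mul_pos (epsTheta_pos (by omega)) (cos_mul_cot_pos hn)

theorem epsTheta_sq_le (n : ℕ) : epsTheta n ^ 2 ≤ epsPhi n ^ 2 := by
  have hp : epsPhi n = 2 * epsTheta n := by unfold epsPhi epsTheta; ring
  rw [hp]; nlinarith [sq_nonneg (epsTheta n)]

/-- A combination of a polar and an azimuthal contribution as in `G_Ω` and `H_Ω`. -/
theorem weighted_sum_le (hn : 2 ≤ n) {u : ℝ} {w : Fin (n + 1) → ℝ} {M : ℝ} (hM : 0 ≤ M)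
    (hu : u ≤ M * (2 * epsTheta n ^ 2)) (hw : ∀ j, w j ≤ M * (2 * epsPhi n ^ 2)) :
    epsTheta n * (u * (Real.cos (epsTheta n / 2) * Real.cot (epsTheta n / 2)) +
      ∑ j, w j * Real.sin (polarAngle n j)) ≤ M * smallBound n := by
  have h1 : u * polarWeight n ≤ M * (2 * epsPhi n ^ 2) * polarWeight n := by
    refine mul_le_mul_of_nonneg_right (hu.trans ?_) (polarWeight_pos hn).le
    have := epsTheta_sq_le n
    gcongr
  have h2 : epsTheta n * ∑ j, w j * Real.sin (polarAngle n j) ≤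
      M * (2 * epsPhi n ^ 2) * azimWeight n := by
    rw [azimWeight, mul_left_comm]
    refine mul_le_mul_of_nonneg_left ?_ (epsTheta_nonneg n)
    rw [Finset.mul_sum]
    exact Finset.sum_le_sum fun j _ =>
      mul_le_mul_of_nonneg_right (hw j) (sin_polarAngle_nonneg n j)
  calc _ = u * polarWeight n + epsTheta n * ∑ j, w j * Real.sin (polarAngle n j) := by
        rw [polarWeight]; ring
    _ ≤ _ := add_le_add h1 h2
    _ = _ := by rw [smallBound]; ring

theorem sin_polarAngle_sq_le (j : Fin (n + 1)) : Real.sin (polarAngle n j) ^ 2 ≤ 1 :=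
  Real.sin_sq_le_one _

theorem structG_le (hn : 2 ≤ n) (b P : ℝ) : structG n b P ≤ smallBound n := by
  have h := weighted_sum_le hn (u := mcDScaled (epsTheta n) (b ^ 2 + P ^ 2))
    (w := fun j => mcDScaled (epsPhi n) (azimSq n j b P) * Real.sin (polarAngle n j) ^ 2)
    zero_le_one (by rw [one_mul]; exact mcDScaled_le (by positivity)) (fun j => by
      have h1 := mcDScaled_le (ε := epsPhi n) (azimSq_nonneg n j b P)
      have h2 := sin_polarAngle_sq_le j
      nlinarith [sq_nonneg (epsPhi n), sq_nonneg (Real.sin (polarAngle n j))])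
  rw [one_mul] at h
  rw [structG_eq]
  refine le_of_eq_of_le ?_ h
  congr 2
  exact Finset.sum_congr rfl fun j _ => by ring

theorem structH_le (hn : 2 ≤ n) (b P : ℝ) : structH n b P ≤ smallBound n := by
  have h := weighted_sum_le hn (u := mcCScaled (epsTheta n) (b ^ 2 + P ^ 2))
    (w := fun j => mcCScaled (epsPhi n) (azimSq n j b P) * Real.sin (polarAngle n j) ^ 2)
    zero_le_one (by rw [one_mul]; exact mcCScaled_le _ _) (fun j => by
      have h1 := mcCScaled_le (epsPhi n) (azimSq n j b P)
      have h2 := sin_polarAngle_sq_le j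
      nlinarith [sq_nonneg (epsPhi n), sq_nonneg (Real.sin (polarAngle n j))])
  rw [one_mul] at h
  rw [structH_eq]
  refine le_of_eq_of_le ?_ h
  congr 2
  exact Finset.sum_congr rfl fun j _ => by ring

/-- `F_Ω` is the sum of the two weights, up to a small correction. -/
theorem abs_structF_sub_le (hn : 2 ≤ n) {b P M : ℝ} (hP : |P| ≤ M) :
    |structF n b P - (polarWeight n + azimWeight n)| ≤ (1 + M ^ 2) * smallBound n := by
  have hn0 : n ≠ 0 := by omega
  have hP2 : P ^ 2 ≤ M ^ 2 := sq_le_sq' (by linarith [abs_le.1 hP]) (abs_le.1 hP).2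
  have hw0 : ∀ j, 0 ≤ Real.cos (polarAngle n j) ^ 2 + P ^ 2 * Real.sin (polarAngle n j) ^ 2 :=
    fun j => by positivity
  have hw1 : ∀ j, Real.cos (polarAngle n j) ^ 2 + P ^ 2 * Real.sin (polarAngle n j) ^ 2 ≤
      1 + M ^ 2 := fun j => by
    have h1 := Real.cos_sq_le_one (polarAngle n j)
    have h2 := sin_polarAngle_sq_le j
    nlinarith [sq_nonneg (Real.sin (polarAngle n j)), sq_nonneg P]
  have hDp := mcDScaled_pos (epsTheta_pos hn0) (y := b ^ 2 + P ^ 2) (by positivity)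
  have hDa := fun j => mcDScaled_pos (epsPhi_pos hn0) (azimSq_nonneg n j b P)
  have h := weighted_sum_le hn (u := P ^ 2 * mcDScaled (epsTheta n) (b ^ 2 + P ^ 2))
    (w := fun j => (Real.cos (polarAngle n j) ^ 2 + P ^ 2 * Real.sin (polarAngle n j) ^ 2) *
      mcDScaled (epsPhi n) (azimSq n j b P)) (M := 1 + M ^ 2) (by positivity)
    (mul_le_mul (by linarith) (mcDScaled_le (by positivity)) hDp.le (by positivity))
    (fun j => mul_le_mul (hw1 j) (mcDScaled_le (azimSq_nonneg n j b P)) (hDa j).le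
      (by positivity))
  have h0 : 0 ≤ epsTheta n * (P ^ 2 * mcDScaled (epsTheta n) (b ^ 2 + P ^ 2) *
      (Real.cos (epsTheta n / 2) * Real.cot (epsTheta n / 2)) +
      ∑ j : Fin (n + 1), (Real.cos (polarAngle n j) ^ 2 + P ^ 2 * Real.sin (polarAngle n j) ^ 2) *
        mcDScaled (epsPhi n) (azimSq n j b P) * Real.sin (polarAngle n j)) :=
    mul_nonneg (epsTheta_nonneg n) (add_nonneg
      (mul_nonneg (mul_nonneg (sq_nonneg P) hDp.le) (cos_mul_cot_pos hn).le)
      (Finset.sum_nonneg fun j _ => mul_nonneg (mul_nonneg (hw0 j) (hDa j).le)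
        (sin_polarAngle_nonneg n j)))
  have he : structF n b P - (polarWeight n + azimWeight n) =
      -(epsTheta n * (P ^ 2 * mcDScaled (epsTheta n) (b ^ 2 + P ^ 2) *
      (Real.cos (epsTheta n / 2) * Real.cot (epsTheta n / 2)) +
      ∑ j : Fin (n + 1), (Real.cos (polarAngle n j) ^ 2 + P ^ 2 * Real.sin (polarAngle n j) ^ 2) *
        mcDScaled (epsPhi n) (azimSq n j b P) * Real.sin (polarAngle n j))) := by
    rw [structF_eq, polarWeight, azimWeight]
    simp only [sub_mul, one_mul, Finset.sum_sub_distrib]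
    ring
  rw [he, abs_neg, abs_of_nonneg h0]
  exact h

theorem eventually_structure_functions_close (M δ : ℝ) (hδ : 0 < δ) :
    ∀ᶠ n : ℕ in atTop, ∀ b P : ℝ, |b| ≤ M → |P| ≤ M →
      |structF n b P - 4| < δ ∧ |structG n b P| < δ ∧ |structH n b P| < δ := by
  have h1 : Tendsto (fun n => |polarWeight n + azimWeight n - 4| + (1 + M ^ 2) * smallBound n)
      atTop (𝓝 0) := by
    have := (((tendsto_polarWeight.add tendsto_azimWeight).sub_const 4).abs).add
      (tendsto_smallBound.const_mul (1 + M ^ 2))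
    norm_num at this
    exact this
  filter_upwards [eventually_ge_atTop 2, h1.eventually_lt_const hδ,
    tendsto_smallBound.eventually_lt_const hδ] with n hn hF hS b P _ hP
  refine ⟨?_, ?_, ?_⟩
  · have h2 := abs_structF_sub_le hn (b := b) hP
    calc |structF n b P - 4| = |(structF n b P - (polarWeight n + azimWeight n)) +
          (polarWeight n + azimWeight n - 4)| := by ring_nf
      _ ≤ _ := abs_add_le _ _
      _ < δ := by linarith
  · rw [abs_of_pos (structG_pos hn b P)]
    exact (structG_le hn b P).trans_lt hS
  · rw [abs_of_nonneg (structH_nonneg hn b P)]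
    exact (structH_le hn b P).trans_lt hS

end UniformLimits

/-! ### Riemann sums over the radial lattice -/

section RiemannSums

open Filter Topology

theorem tendsto_epsR (r₀ : ℝ) : Tendsto (epsR r₀) atTop (𝓝 0) :=
  tendsto_const_div_atTop_nhds_zero_nat r₀

theorem natCast_mul_epsR (r₀ : ℝ) {n : ℕ} (hn : n ≠ 0) : n * epsR r₀ n = r₀ := by
  unfold epsR; field_simp

theorem radius_mem_Ioc {r₀ : ℝ} (hr₀ : 0 < r₀) {n : ℕ} (v : Fin n) :
    radius r₀ v ∈ Set.Ioc 0 r₀ := by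
  have hn : n ≠ 0 := by have := v.2; omega
  have hε := epsR_pos hr₀ hn
  refine ⟨by unfold radius; positivity, ?_⟩
  have : ((v : ℕ) : ℝ) + 1 ≤ n := by exact_mod_cast v.2
  calc radius r₀ v ≤ n * epsR r₀ n := mul_le_mul_of_nonneg_right this hε.le
    _ = r₀ := natCast_mul_epsR r₀ hn

theorem tendsto_riemann_sum {r₀ : ℝ} (hr₀ : 0 < r₀) {h : ℝ → ℝ} (hh : Continuous h) :
    Tendsto (fun n : ℕ => ∑ v : Fin n, epsR r₀ n * h (radius r₀ v)) atTop
      (𝓝 (∫ r in (0 : ℝ)..r₀, h r)) := by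
  rw [Metric.tendsto_nhds]
  intro δ hδ
  have huc := isCompact_Icc.uniformContinuousOn_of_continuous (hh.continuousOn (s := Set.Icc 0 r₀))
  obtain ⟨η, hη, huc⟩ := Metric.uniformContinuousOn_iff.1 huc (δ / (2 * r₀)) (by positivity)
  filter_upwards [eventually_ne_atTop 0, (tendsto_epsR r₀).eventually_lt_const hη] with n hn hlt
  have hε := epsR_pos hr₀ hn
  have hsplit : ∫ r in (0 : ℝ)..r₀, h r =
      ∑ k ∈ Finset.range n, ∫ r in ((k : ℕ) * epsR r₀ n)..((k + 1 : ℕ) * epsR r₀ n), h r := by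
    rw [intervalIntegral.sum_integral_adjacent_intervals (a := fun k : ℕ => k * epsR r₀ n)
      fun k _ => hh.intervalIntegrable _ _, natCast_mul_epsR r₀ hn]
    simp
  have hsum : ∑ v : Fin n, epsR r₀ n * h (radius r₀ v) =
      ∑ k ∈ Finset.range n, epsR r₀ n * h (((k + 1 : ℕ) : ℝ) * epsR r₀ n) := by
    rw [← Fin.sum_univ_eq_sum_range
      (fun k => epsR r₀ n * h (((k + 1 : ℕ) : ℝ) * epsR r₀ n)) n]
    simp [radius]
  rw [hsplit, hsum, Real.dist_eq, ← Finset.sum_sub_distrib]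
  have hterm : ∀ k ∈ Finset.range n, |epsR r₀ n * h (((k + 1 : ℕ) : ℝ) * epsR r₀ n) -
      ∫ r in ((k : ℕ) * epsR r₀ n)..((k + 1 : ℕ) * epsR r₀ n), h r| ≤
        δ / (2 * r₀) * epsR r₀ n := by
    intro k hk
    have hk' : (((k + 1 : ℕ) : ℝ)) ≤ n := by exact_mod_cast Finset.mem_range.1 hk
    have hlen : ((k + 1 : ℕ) : ℝ) * epsR r₀ n - (k : ℕ) * epsR r₀ n = epsR r₀ n := by
      push_cast; ring
    have hle : (k : ℝ) * epsR r₀ n ≤ ((k + 1 : ℕ) : ℝ) * epsR r₀ n := by linarith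
    have hr : ((k + 1 : ℕ) : ℝ) * epsR r₀ n ≤ r₀ :=
      (mul_le_mul_of_nonneg_right hk' hε.le).trans_eq (natCast_mul_epsR r₀ hn)
    have hc : epsR r₀ n * h (((k + 1 : ℕ) : ℝ) * epsR r₀ n) =
        ∫ r in ((k : ℕ) * epsR r₀ n)..((k + 1 : ℕ) * epsR r₀ n),
          h (((k + 1 : ℕ) : ℝ) * epsR r₀ n) := by
      rw [intervalIntegral.integral_const, hlen, smul_eq_mul]
    rw [hc, ← intervalIntegral.integral_sub (by simp) (hh.intervalIntegrable _ _),
      ← Real.norm_eq_abs]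
    refine (intervalIntegral.norm_integral_le_of_norm_le_const (C := δ / (2 * r₀)) ?_).trans ?_
    · intro r hr'
      rw [Set.uIoc_of_le hle] at hr'
      have h0 : 0 ≤ (k : ℝ) * epsR r₀ n := by positivity
      have := huc (((k + 1 : ℕ) : ℝ) * epsR r₀ n) ⟨by positivity, hr⟩ r
        ⟨by linarith [hr'.1], hr'.2.trans hr⟩
        (by rw [Real.dist_eq, abs_of_nonneg (by linarith [hr'.2])]; linarith [hr'.1])
      exact this.le
    · rw [hlen, abs_of_pos hε]
  calc _ ≤ ∑ k ∈ Finset.range n, δ / (2 * r₀) * epsR r₀ n :=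
        (Finset.abs_sum_le_sum_abs _ _).trans (Finset.sum_le_sum hterm)
    _ = δ / (2 * r₀) * (n * epsR r₀ n) := by simp; ring
    _ = δ / 2 := by rw [natCast_mul_epsR r₀ hn]; field_simp
    _ < δ := by linarith

theorem exists_abs_le_on_Icc {h : ℝ → ℝ} (hh : Continuous h) (r₀ : ℝ) :
    ∃ C : ℝ, 0 ≤ C ∧ ∀ r ∈ Set.Icc 0 r₀, |h r| ≤ C := by
  obtain ⟨C, hC⟩ := isCompact_Icc.exists_bound_of_continuousOn (hh.continuousOn (s := Set.Icc 0 r₀))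
  exact ⟨max C 0, le_max_right _ _, fun r hr => (hC r hr).trans (le_max_left _ _)⟩

/-- Riemann sums with lattice weights that converge uniformly on the support of `h`. -/
theorem tendsto_weighted_riemann_sum {r₀ : ℝ} (hr₀ : 0 < r₀) {h : ℝ → ℝ} (hh : Continuous h)
    {q : ∀ n, Fin n → ℝ} {q₀ : ℝ}
    (hq : ∀ δ > 0, ∀ᶠ n in atTop, ∀ v : Fin n, h (radius r₀ v) ≠ 0 → |q n v - q₀| < δ) :
    Tendsto (fun n : ℕ => ∑ v : Fin n, epsR r₀ n * h (radius r₀ v) * q n v) atTop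
      (𝓝 (q₀ * ∫ r in (0 : ℝ)..r₀, h r)) := by
  have h1 := (tendsto_riemann_sum hr₀ hh).const_mul q₀
  obtain ⟨C, hC0, hC⟩ := exists_abs_le_on_Icc hh r₀
  have h2 : Tendsto (fun n : ℕ => ∑ v : Fin n, epsR r₀ n * h (radius r₀ v) * (q n v - q₀)) atTop
      (𝓝 0) := by
    rw [Metric.tendsto_nhds]
    intro δ hδ
    filter_upwards [hq (δ / (2 * (C + 1) * r₀)) (by positivity), eventually_ne_atTop 0]
      with n hn hn0
    have hε := epsR_pos hr₀ hn0
    rw [Real.dist_eq, sub_zero]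
    have hterm : ∀ v : Fin n, |epsR r₀ n * h (radius r₀ v) * (q n v - q₀)| ≤
        epsR r₀ n * (C * (δ / (2 * (C + 1) * r₀))) := by
      intro v
      have hv := radius_mem_Ioc hr₀ v
      rw [abs_mul, abs_mul, abs_of_pos hε, mul_assoc]
      refine mul_le_mul_of_nonneg_left ?_ hε.le
      by_cases h0 : h (radius r₀ v) = 0
      · rw [h0]; simp; positivity
      · exact mul_le_mul (hC _ ⟨hv.1.le, hv.2⟩) (hn v h0).le (abs_nonneg _) hC0
    calc _ ≤ ∑ v : Fin n, epsR r₀ n * (C * (δ / (2 * (C + 1) * r₀))) :=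
          (Finset.abs_sum_le_sum_abs _ _).trans (Finset.sum_le_sum fun v _ => hterm v)
      _ = (n * epsR r₀ n) * (C * (δ / (2 * (C + 1) * r₀))) := by simp; ring
      _ = C / (C + 1) * (δ / 2) := by rw [natCast_mul_epsR r₀ hn0]; field_simp
      _ ≤ 1 * (δ / 2) := by gcongr; rw [div_le_one (by positivity)]; linarith
      _ < δ := by linarith
  have h3 := h1.add h2
  rw [add_zero] at h3
  refine h3.congr fun n => ?_
  rw [Finset.mul_sum, ← Finset.sum_add_distrib]
  exact Finset.sum_congr rfl fun v _ => by ring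

theorem abs_kronSucc_sum_le {n : ℕ} (F : Fin n → ℝ) (C : ℝ) (hC : 0 ≤ C) (hF : ∀ v, |F v| ≤ C)
    (v : Fin n) : |∑ w, kronSucc w v * F w| ≤ C ∧ |∑ w, kronSucc v w * F w| ≤ C := by
  rw [← extendLattice_zero_eq_sum_kronSucc, ← extendLattice_zero_eq_sum_kronSucc']
  have : ∀ k, |extendLattice 0 0 F k| ≤ C := by
    intro k
    unfold extendLattice
    split_ifs
    · simpa using hC
    · exact hF _
    · simpa using hC
  exact ⟨this _, this _⟩

theorem abs_centralDiffLM_le {r₀ : ℝ} (hr₀ : 0 < r₀) {n : ℕ} (hn : n ≠ 0) {F : Fin n → ℝ} {C : ℝ}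
    (hC : 0 ≤ C) (hF : ∀ v, |F v| ≤ epsR r₀ n * C) (v : Fin n) : |centralDiffLM r₀ n F v| ≤ C := by
  have hε := epsR_pos hr₀ hn
  obtain ⟨h1, h2⟩ := abs_kronSucc_sum_le F _ (by positivity) hF v
  have he : centralDiffLM r₀ n F v = centralDiff r₀ 0 0 F v := rfl
  rw [he, centralDiff, extendLattice_zero_eq_sum_kronSucc, extendLattice_zero_eq_sum_kronSucc',
    abs_div, abs_of_pos (by positivity : 0 < 2 * epsR r₀ n), div_le_iff₀ (by positivity)]
  have := abs_sub (∑ w, kronSucc w v * F w) (∑ w, kronSucc v w * F w)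
  linarith

/-- The off-diagonal brackets: a sum of `n` terms of order `1/n²`. -/
theorem tendsto_off_diagonal_sum {κ β r₀ : ℝ} (hκ : 0 < κ) (hβ : β ≠ 0) (hr₀ : 0 < r₀)
    {F G T Φ : ∀ n, Fin n → ℝ} {Cf Cg M : ℝ} (hCf : 0 ≤ Cf) (hCg : 0 ≤ Cg) (hM : 0 ≤ M)
    (hF : ∀ᶠ n in atTop, ∀ v, |F n v| ≤ epsR r₀ n * Cf)
    (hG : ∀ᶠ n in atTop, ∀ v, |G n v| ≤ epsR r₀ n * Cg)
    (hT : ∀ᶠ n in atTop, ∀ v, F n v ≠ 0 → |T n v| ≤ M * smallBound n ∧ 1 ≤ Φ n v) :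
    Tendsto (fun n : ℕ => ∑ v : Fin n, F n v * (T n v * centralDiffLM r₀ n (G n) v /
      (formScale κ β r₀ n * (2 * Real.cos (epsTheta n / 2))) / Φ n v)) atTop (𝓝 0) := by
  have hlim := tendsto_natCast_mul_smallBound.const_mul
    (Cf * M * Cg / |4 * Real.pi / (κ * β)|)
  rw [mul_zero] at hlim
  refine squeeze_zero_norm' ?_ hlim
  have hcos := tendsto_cos_half_epsTheta.eventually_const_lt (by norm_num : (1 / 2 : ℝ) < 1)
  filter_upwards [hF, hG, hT, eventually_ge_atTop 2, hcos] with n hF hG hT hn hcos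
  have hn0 : n ≠ 0 := by omega
  have hε := epsR_pos hr₀ hn0
  have hk : 0 < |4 * Real.pi / (κ * β)| := by positivity
  have hS : 0 ≤ smallBound n := (structH_nonneg hn 0 0).trans (structH_le hn 0 0)
  have hterm : ∀ v : Fin n, |F n v * (T n v * centralDiffLM r₀ n (G n) v /
      (formScale κ β r₀ n * (2 * Real.cos (epsTheta n / 2))) / Φ n v)| ≤
      Cf * M * Cg / |4 * Real.pi / (κ * β)| * smallBound n := by
    intro v
    by_cases h0 : F n v = 0
    · rw [h0]; simp; positivity
    obtain ⟨h1, h2⟩ := hT v h0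
    have hD := abs_centralDiffLM_le hr₀ hn0 hCg hG v
    have hden : |4 * Real.pi / (κ * β)| * epsR r₀ n ≤
        |formScale κ β r₀ n * (2 * Real.cos (epsTheta n / 2))| := by
      rw [formScale, abs_mul, abs_mul, abs_of_pos hε,
        abs_of_pos (by linarith : 0 < 2 * Real.cos (epsTheta n / 2))]
      exact le_mul_of_one_le_right (by positivity) (by linarith)
    have hden2 : |4 * Real.pi / (κ * β)| * epsR r₀ n * 1 ≤
        |formScale κ β r₀ n * (2 * Real.cos (epsTheta n / 2))| * |Φ n v| :=
      mul_le_mul hden (h2.trans (le_abs_self _)) zero_le_one (abs_nonneg _)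
    rw [div_div, abs_mul, abs_div, abs_mul, abs_mul (formScale _ _ _ _ * _)]
    calc |F n v| * (|T n v| * |centralDiffLM r₀ n (G n) v| /
          (|formScale κ β r₀ n * (2 * Real.cos (epsTheta n / 2))| * |Φ n v|))
        ≤ epsR r₀ n * Cf * (M * smallBound n * Cg /
          (|4 * Real.pi / (κ * β)| * epsR r₀ n * 1)) := by
          gcongr
          exact hF v
      _ = _ := by field_simp
  calc _ ≤ ∑ v : Fin n, Cf * M * Cg / |4 * Real.pi / (κ * β)| * smallBound n :=
        (Finset.abs_sum_le_sum_abs _ _).trans (Finset.sum_le_sum fun v _ => hterm v)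
    _ = _ := by simp; ring

end RiemannSums

/-! ### Sampling a continuum configuration -/

section Sampling

open Filter Topology

variable {φ : ContinuumFields} {r₀ R : ℝ}

theorem exists_sign_eq {p : ℝ → ℝ} {R : ℝ} (hp : ContinuousOn p (Set.Ioo 0 R))
    (h0 : ∀ r ∈ Set.Ioo 0 R, p r ≠ 0) :
    ∃ σ : ℝ, (σ = 1 ∨ σ = -1) ∧ ∀ r ∈ Set.Ioo 0 R, Real.sign (p r) = σ := by
  by_cases hpos : ∀ r ∈ Set.Ioo 0 R, 0 < p r
  · exact ⟨1, Or.inl rfl, fun r hr => Real.sign_of_pos (hpos r hr)⟩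
  · push Not at hpos
    obtain ⟨s, hs, hs0⟩ := hpos
    refine ⟨-1, Or.inr rfl, fun r hr => Real.sign_of_neg ?_⟩
    by_contra hr0
    obtain ⟨t, ht, ht0⟩ := isPreconnected_Ioo.intermediate_value hs hr hp ⟨hs0, not_lt.1 hr0⟩
    exact h0 t ht ht0

theorem exists_pos_le_abs {p : ℝ → ℝ} {c d : ℝ} (hp : ContinuousOn p (Set.Icc c d))
    (h0 : ∀ r ∈ Set.Icc c d, p r ≠ 0) : ∃ m : ℝ, 0 < m ∧ ∀ r ∈ Set.Icc c d, m ≤ |p r| := by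
  obtain ⟨C, hC⟩ := isCompact_Icc.exists_bound_of_continuousOn (hp.inv₀ h0)
  refine ⟨(max C 1)⁻¹, by positivity, fun r hr => ?_⟩
  have h1 : |p r|⁻¹ ≤ max C 1 := by
    have := hC r hr
    rw [Pi.inv_apply, norm_inv, Real.norm_eq_abs] at this
    exact this.trans (le_max_left _ _)
  exact inv_le_of_inv_le₀ (abs_pos.2 (h0 r hr)) h1

theorem le_pbEps {ε r c d m : ℝ} (hε : 0 ≤ ε) (hp : ContinuousOn φ.pb (Set.Icc c d))
    (hc : c ≤ r - ε / 2) (hd : r + ε / 2 ≤ d) (hm : ∀ t ∈ Set.Icc c d, m ≤ |φ.pb t|) :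
    m ≤ pbEps φ ε r := by
  have hmem : ∀ s ∈ Set.Icc (-(1 / 2) : ℝ) (1 / 2), r + s * ε ∈ Set.Icc c d := fun s hs =>
    ⟨by nlinarith [hs.1], by nlinarith [hs.2]⟩
  have hcont : ContinuousOn (fun s : ℝ => |φ.pb (r + s * ε)|) (Set.Icc (-(1 / 2)) (1 / 2)) :=
    (hp.comp (by fun_prop) hmem).abs
  have hle : (-(1 / 2) : ℝ) ≤ 1 / 2 := by norm_num
  have h := intervalIntegral.integral_mono_on (μ := MeasureTheory.volume) (f := fun _ : ℝ => m) hle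
    (continuous_const.intervalIntegrable _ _)
    (hcont.intervalIntegrable_of_Icc hle) fun s hs => hm _ (hmem s hs)
  rw [intervalIntegral.integral_const, show (1 / 2 - -(1 / 2) : ℝ) = 1 by norm_num, one_smul] at h
  exact h

theorem eventually_samplePoint_pb_pos (hr₀ : 0 < r₀) (hR : r₀ < R)
    (hpb : ContinuousOn φ.pb (Set.Ioo 0 R)) (h0 : ∀ r ∈ Set.Ioo 0 R, φ.pb r ≠ 0) :
    ∀ᶠ n : ℕ in atTop, ∀ v : Fin n, 0 < samplePoint φ r₀ n .pb v := by
  filter_upwards [eventually_ne_atTop 0, (tendsto_epsR r₀).eventually_lt_const (sub_pos.2 hR)]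
    with n hn hlt v
  have hε := epsR_pos hr₀ hn
  have hsub : Set.Icc (epsR r₀ n / 2) (r₀ + epsR r₀ n / 2) ⊆ Set.Ioo 0 R := fun r hr =>
    ⟨by linarith [hr.1], by linarith [hr.2]⟩
  obtain ⟨m, hm, hm'⟩ := exists_pos_le_abs (hpb.mono hsub) fun r hr => h0 r (hsub hr)
  refine hm.trans_le (le_pbEps hε.le (hpb.mono hsub) ?_ ?_ hm')
  · have : epsR r₀ n ≤ radius r₀ v := by
      have : (0 : ℝ) ≤ (v : ℕ) := Nat.cast_nonneg _
      unfold radius; nlinarith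
    linarith
  · linarith [(radius_mem_Ioc hr₀ v).2]

theorem extendLattice_samplePoint {n : ℕ} (hn : n ≠ 0) {k : ℕ} (hk : k ≤ n + 1) :
    extendLattice (innerValue φ r₀ n) (outerValue φ r₀ n) (samplePoint φ r₀ n .pa) k =
      paEps φ (epsR r₀ n) (k * epsR r₀ n) := by
  unfold extendLattice
  split_ifs with h0 h
  · simp [h0, innerValue]
  · have : ((k - 1 : ℕ) : ℝ) + 1 = k := by
      rw [← Nat.cast_succ]; congr 1; omega
    simp only [samplePoint, radius, this]
  · have : k = n + 1 := by omega
    rw [this, outerValue]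
    congr 1
    push_cast
    rw [add_mul, natCast_mul_epsR r₀ hn, one_mul]

/-- On compact subsets of `(0, r₀)` the sampled `b_ε`, `Π_ε` and `1 / p_b^ε` stay bounded. -/
theorem exists_samplePoint_bounds (hr₀ : 0 < r₀) (hR : r₀ < R)
    (hb : ContinuousOn φ.b (Set.Ioo 0 R)) (hpa : ContDiffOn ℝ 1 φ.pa (Set.Ioo 0 R))
    (hpb : ContinuousOn φ.pb (Set.Ioo 0 R)) (h0 : ∀ r ∈ Set.Ioo 0 R, φ.pb r ≠ 0)
    {α γ : ℝ} (hα : 0 < α) (hγ : γ < r₀) :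
    ∃ M m : ℝ, 0 ≤ M ∧ 0 < m ∧ ∀ᶠ n : ℕ in atTop, ∀ v : Fin n, radius r₀ v ∈ Set.Icc α γ →
      |samplePoint φ r₀ n .b v| ≤ M ∧
      |capPi r₀ (innerValue φ r₀ n) (outerValue φ r₀ n) (samplePoint φ r₀ n) v| ≤ M ∧
      m ≤ samplePoint φ r₀ n .pb v := by
  have hJ : Set.Icc (α / 2) r₀ ⊆ Set.Ioo 0 R := fun r hr =>
    ⟨by linarith [hr.1], by linarith [hr.2]⟩
  obtain ⟨σ, hσ, hsign⟩ := exists_sign_eq hpb h0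
  obtain ⟨B, hB⟩ := isCompact_Icc.exists_bound_of_continuousOn (hb.mono hJ)
  obtain ⟨m, hm, hm'⟩ := exists_pos_le_abs (hpb.mono hJ) fun r hr => h0 r (hJ hr)
  obtain ⟨L, hL⟩ := isCompact_Icc.exists_bound_of_continuousOn
    ((hpa.continuousOn_deriv_of_isOpen isOpen_Ioo le_rfl).mono hJ)
  refine ⟨max (max B 0) (L / (2 * m)), m, le_max_of_le_left (le_max_right _ _), hm, ?_⟩
  filter_upwards [eventually_ne_atTop 0, (tendsto_epsR r₀).eventually_lt_const hα,
    (tendsto_epsR r₀).eventually_lt_const (half_pos (sub_pos.2 hγ))] with n hn h1 h2 v hv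
  have hε := epsR_pos hr₀ hn
  have hpbv : m ≤ samplePoint φ r₀ n .pb v :=
    le_pbEps hε.le (hpb.mono hJ) (by linarith [hv.1]) (by linarith [hv.2]) hm'
  refine ⟨?_, ?_, hpbv⟩
  · exact (hB _ ⟨by linarith [hv.1], by linarith [hv.2]⟩).trans
      ((le_max_left _ _).trans (le_max_left _ _))
  · refine le_trans ?_ (le_max_right _ _)
    have hv2 := v.2
    have hrad : radius r₀ v = ((v : ℕ) + 1) * epsR r₀ n := rfl
    rw [capPi, centralDiff, extendLattice_samplePoint hn (by omega),
      extendLattice_samplePoint hn (by omega), paEps, paEps]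
    have e1 : ((v + 2 : ℕ) : ℝ) * epsR r₀ n + epsR r₀ n / 2 = radius r₀ v + 3 * epsR r₀ n / 2 := by
      rw [hrad]; push_cast; ring
    have e2 : ((v : ℕ) : ℝ) * epsR r₀ n + epsR r₀ n / 2 = radius r₀ v - epsR r₀ n / 2 := by
      rw [hrad]; ring
    have m1 : radius r₀ v + 3 * epsR r₀ n / 2 ∈ Set.Icc (α / 2) r₀ :=
      ⟨by linarith [hv.1], by linarith [hv.2]⟩
    have m2 : radius r₀ v - epsR r₀ n / 2 ∈ Set.Icc (α / 2) r₀ :=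
      ⟨by linarith [hv.1], by linarith [hv.2]⟩
    rw [e1, e2, hsign _ (hJ m1), hsign _ (hJ m2), ← mul_sub]
    have hmv := (convex_Icc (α / 2) r₀).norm_image_sub_le_of_norm_deriv_le
      (fun t ht => (hpa.differentiableOn one_ne_zero).differentiableAt
        (isOpen_Ioo.mem_nhds (hJ ht))) hL m2 m1
    rw [show radius r₀ v + 3 * epsR r₀ n / 2 - (radius r₀ v - epsR r₀ n / 2) = 2 * epsR r₀ n by
      ring, Real.norm_eq_abs, Real.norm_eq_abs, abs_of_pos (by positivity : 0 < 2 * epsR r₀ n)]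
      at hmv
    have hσ1 : |σ| = 1 := by rcases hσ with rfl | rfl <;> simp
    have hpos : 0 < samplePoint φ r₀ n .pb v := hm.trans_le hpbv
    have hL0 : 0 ≤ L := (norm_nonneg _).trans (hL _ m1)
    rw [abs_div, abs_div, abs_mul, hσ1, one_mul, abs_of_pos (by positivity : 0 < 2 * epsR r₀ n),
      abs_of_pos (by positivity : 0 < 2 * samplePoint φ r₀ n .pb v)]
    gcongr
    rw [div_le_iff₀ (by positivity)]
    exact hmv

/-- On compact subsets of `(0, r₀)` the coefficient of `δb ∧ δp_b` tends to `4`. -/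
theorem eventually_phiCoeff_close (hr₀ : 0 < r₀) (hR : r₀ < R)
    (hb : ContinuousOn φ.b (Set.Ioo 0 R)) (hpa : ContDiffOn ℝ 1 φ.pa (Set.Ioo 0 R))
    (hpb : ContinuousOn φ.pb (Set.Ioo 0 R)) (h0 : ∀ r ∈ Set.Ioo 0 R, φ.pb r ≠ 0)
    {α γ : ℝ} (hα : 0 < α) (hγ : γ < r₀) {δ : ℝ} (hδ : 0 < δ) :
    ∀ᶠ n : ℕ in atTop, ∀ v : Fin n, radius r₀ v ∈ Set.Icc α γ →
      |phiCoeff r₀ (innerValue φ r₀ n) (outerValue φ r₀ n) (samplePoint φ r₀ n) v - 4| < δ := by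
  obtain ⟨M, m, hM, hm, hbd⟩ := exists_samplePoint_bounds hr₀ hR hb hpa hpb h0 hα hγ
  filter_upwards [hbd, eventually_structure_functions_close M (δ / (1 + M ^ 2)) (by positivity)]
    with n hbd hcl v hv
  obtain ⟨h1, h2, -⟩ := hbd v hv
  obtain ⟨hF, -, hH⟩ := hcl _ _ h1 h2
  set P := capPi r₀ (innerValue φ r₀ n) (outerValue φ r₀ n) (samplePoint φ r₀ n) v
  set b := samplePoint φ r₀ n .b v
  have hP2 : P ^ 2 ≤ M ^ 2 := sq_le_sq' (by linarith [abs_le.1 h2]) (abs_le.1 h2).2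
  have he : phiCoeff r₀ (innerValue φ r₀ n) (outerValue φ r₀ n) (samplePoint φ r₀ n) v =
    structF n b P + structH n b P * P ^ 2 := rfl
  rw [he]
  calc |structF n b P + structH n b P * P ^ 2 - 4|
      = |(structF n b P - 4) + structH n b P * P ^ 2| := by ring_nf
    _ ≤ |structF n b P - 4| + |structH n b P| * P ^ 2 := by
      refine (abs_add_le _ _).trans_eq ?_
      rw [abs_mul, abs_of_nonneg (sq_nonneg P)]
    _ < δ / (1 + M ^ 2) + δ / (1 + M ^ 2) * M ^ 2 :=
      add_lt_add_of_lt_of_le hF (mul_le_mul hH.le hP2 (sq_nonneg P) (by positivity))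
    _ = δ := by field_simp

theorem abs_signFactor_le_one (φ : ContinuumFields) (c : Coord) (r : ℝ) :
    |signFactor φ c r| ≤ 1 := by
  have h : ∀ t : ℝ, |Real.sign t| ≤ 1 := fun t => by
    rcases Real.sign_apply_eq t with h | h | h <;> rw [h] <;> simp
  cases c
  · simp [signFactor]
  · simp [signFactor]
  · exact h _
  · exact h _

/-- The coefficients of the smeared field. -/
noncomputable def smearCoeff (φ : ContinuumFields) (r₀ : ℝ) (c : Coord) (f : ℝ → ℝ) (n : ℕ)
    (v : Fin n) : ℝ := epsR r₀ n * f (radius r₀ v) * signFactor φ c (radius r₀ v)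

theorem smeared_eq_linearFunction (c : Coord) (f : ℝ → ℝ) (n : ℕ) :
    (smeared φ r₀ c f : Phase n → ℝ) = linearFunction c (smearCoeff φ r₀ c f n) := by
  funext y
  exact Finset.sum_congr rfl fun v _ => by rw [smearCoeff]; ring

theorem abs_smearCoeff_le (hr₀ : 0 < r₀) {f : ℝ → ℝ} {C : ℝ}
    (hC : ∀ r ∈ Set.Icc 0 r₀, |f r| ≤ C) (c : Coord) {n : ℕ} (v : Fin n) :
    |smearCoeff φ r₀ c f n v| ≤ epsR r₀ n * C := by
  have hn : n ≠ 0 := by have := v.2; omega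
  have hv := radius_mem_Ioc hr₀ v
  have hfv := hC _ ⟨hv.1.le, hv.2⟩
  rw [smearCoeff, abs_mul, abs_mul, abs_of_pos (epsR_pos hr₀ hn), mul_assoc]
  refine mul_le_mul_of_nonneg_left ?_ (epsR_pos hr₀ hn).le
  calc _ ≤ |f (radius r₀ v)| * 1 :=
        mul_le_mul_of_nonneg_left (abs_signFactor_le_one _ _ _) (abs_nonneg _)
    _ ≤ C := by rwa [mul_one]

theorem exists_Icc_of_tsupport_subset {f g : ℝ → ℝ} (hr₀ : 0 < r₀)
    (hf : tsupport f ⊆ Set.Ioo 0 r₀) (hg : tsupport g ⊆ Set.Ioo 0 r₀) :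
    ∃ α γ : ℝ, 0 < α ∧ γ < r₀ ∧ ∀ r, f r ≠ 0 ∨ g r ≠ 0 → r ∈ Set.Icc α γ := by
  set S : Set ℝ := tsupport f ∪ tsupport g ∪ {r₀ / 2} with hS
  have hsub : S ⊆ Set.Ioo 0 r₀ := Set.union_subset (Set.union_subset hf hg)
    (Set.singleton_subset_iff.2 ⟨by positivity, by linarith⟩)
  have hcl : IsClosed S := ((isClosed_tsupport f).union (isClosed_tsupport g)).union
    isClosed_singleton
  have hcomp : IsCompact S := (isCompact_Icc (a := 0) (b := r₀)).of_isClosed_subset hcl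
    (hsub.trans Set.Ioo_subset_Icc_self)
  have hne : S.Nonempty := ⟨r₀ / 2, Or.inr rfl⟩
  obtain ⟨α, hα, hα'⟩ := hcomp.exists_isLeast hne
  obtain ⟨γ, hγ, hγ'⟩ := hcomp.exists_isGreatest hne
  refine ⟨α, γ, (hsub hα).1, (hsub hγ).2, fun r hr => ?_⟩
  have : r ∈ S := by
    rcases hr with h | h
    · exact Or.inl (Or.inl (subset_tsupport f h))
    · exact Or.inl (Or.inr (subset_tsupport g h))
  exact ⟨hα' this, hγ' this⟩

theorem sum_mul_centralDiffLM_div {n : ℕ} (K A : ℝ) (Φ T F G : Fin n → ℝ) :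
    ∑ v, F v * (centralDiffLM r₀ n (fun w => T w * G w / (K * Φ w)) v / A) =
      -∑ v, G v * (T v * centralDiffLM r₀ n F v / (K * A) / Φ v) := by
  have h := sum_mul_centralDiffLM r₀ F fun w => T w * G w / (K * Φ w)
  calc _ = (∑ v, F v * centralDiffLM r₀ n (fun w => T w * G w / (K * Φ w)) v) / A := by
        rw [Finset.sum_div]; exact Finset.sum_congr rfl fun v _ => by ring
    _ = _ := by
        rw [h, neg_div, Finset.sum_div]
        congr 1
        exact Finset.sum_congr rfl fun v _ => by ring

end Sampling

/-! ### The continuum limit of the Poisson algebra -/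

section ContinuumLimit

open Filter Topology

/-- Continuum fields on `(0, R)` and test functions supported in `[α, γ] ⊆ (0, r₀)`, for which the
lattice brackets converge; `σ` is the constant sign of `p_b`. -/
structure ContinuumData (κ β r₀ R α γ σ : ℝ) (φ : ContinuumFields) (f g : ℝ → ℝ) : Prop where
  kappa_pos : 0 < κ
  beta_ne_zero : β ≠ 0
  r₀_pos : 0 < r₀
  r₀_lt : r₀ < R
  continuousOn_b : ContinuousOn φ.b (Set.Ioo 0 R)
  contDiffOn_pa : ContDiffOn ℝ 1 φ.pa (Set.Ioo 0 R)
  continuousOn_pb : ContinuousOn φ.pb (Set.Ioo 0 R)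
  pb_ne_zero : ∀ r ∈ Set.Ioo 0 R, φ.pb r ≠ 0
  sign_eq : ∀ r ∈ Set.Ioo 0 R, Real.sign (φ.pb r) = σ
  Fbpb_ne_zero : ∀ᶠ n : ℕ in atTop, ∀ v : Fin n,
    Fbpb κ β r₀ (innerValue φ r₀ n) (outerValue φ r₀ n) (samplePoint φ r₀ n) v ≠ 0
  continuous_f : Continuous f
  continuous_g : Continuous g
  α_pos : 0 < α
  γ_lt : γ < r₀
  mem_Icc : ∀ r, f r ≠ 0 ∨ g r ≠ 0 → r ∈ Set.Icc α γ

/-- `F_Ω + H_Ω Π_ε²` at the sampled configuration. -/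
noncomputable def samplePhi (φ : ContinuumFields) (r₀ : ℝ) (n : ℕ) : Fin n → ℝ :=
  phiCoeff r₀ (innerValue φ r₀ n) (outerValue φ r₀ n) (samplePoint φ r₀ n)

/-- The coefficient of `Δ_r(δp_a) ∧ δb` at the sampled configuration. -/
noncomputable def sampleS (φ : ContinuumFields) (r₀ : ℝ) (n : ℕ) : Fin n → ℝ :=
  bCoeff r₀ (innerValue φ r₀ n) (outerValue φ r₀ n) (samplePoint φ r₀ n)

/-- The coefficient of `Δ_r(δp_a) ∧ δp_b` at the sampled configuration. -/
noncomputable def sampleT (φ : ContinuumFields) (r₀ : ℝ) (n : ℕ) : Fin n → ℝ :=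
  pbCoeff r₀ (innerValue φ r₀ n) (outerValue φ r₀ n) (samplePoint φ r₀ n)

namespace ContinuumData

variable {κ β r₀ R α γ σ : ℝ} {φ : ContinuumFields} {f g : ℝ → ℝ}

theorem symm (d : ContinuumData κ β r₀ R α γ σ φ f g) : ContinuumData κ β r₀ R α γ σ φ g f :=
  { d with
    continuous_f := d.continuous_g
    continuous_g := d.continuous_f
    mem_Icc := fun r hr => d.mem_Icc r hr.symm }

theorem sign_pb_radius (d : ContinuumData κ β r₀ R α γ σ φ f g) {n : ℕ} (v : Fin n) :
    Real.sign (φ.pb (radius r₀ v)) = σ := by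
  have hv := radius_mem_Ioc d.r₀_pos v
  exact d.sign_eq _ ⟨hv.1, hv.2.trans_lt d.r₀_lt⟩

theorem eventually_bracket_eq (d : ContinuumData κ β r₀ R α γ σ φ f g) (c c' : Coord) :
    ∀ᶠ n : ℕ in atTop, ∑ v, smearCoeff φ r₀ c f n v *
        blockSharp (formScale κ β r₀ n) (2 * Real.cos (epsTheta n / 2))
          (samplePhi φ r₀ n) (sampleS φ r₀ n) (sampleT φ r₀ n) (centralDiffLM r₀ n)
          (singleCovector c' (smearCoeff φ r₀ c' g n)) c v =
      poissonBracket (omegaSym κ β r₀ (innerValue φ r₀ n) (outerValue φ r₀ n))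
        (smeared φ r₀ c f) (smeared φ r₀ c' g) (samplePoint φ r₀ n) := by
  filter_upwards [eventually_ge_atTop 2, d.Fbpb_ne_zero,
    eventually_samplePoint_pb_pos d.r₀_pos d.r₀_lt d.continuousOn_pb d.pb_ne_zero] with n hn hF hx
  rw [smeared_eq_linearFunction, smeared_eq_linearFunction,
    poissonBracket_linearFunction d.kappa_pos d.beta_ne_zero d.r₀_pos _ _ hn
      (fun v => (hx v).ne') hF]
  rfl

theorem integral_sign_mul (d : ContinuumData κ β r₀ R α γ σ φ f g) :
    ∫ r in (0 : ℝ)..r₀, Real.sign (φ.pb r) * f r * g r = σ * ∫ r in (0 : ℝ)..r₀, f r * g r := by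
  rw [← intervalIntegral.integral_const_mul]
  congr 1
  funext r
  by_cases hf : f r = 0
  · simp [hf]
  · have hr := d.mem_Icc r (Or.inl hf)
    rw [d.sign_eq r ⟨d.α_pos.trans_le hr.1, hr.2.trans_lt (d.γ_lt.trans d.r₀_lt)⟩, mul_assoc]

theorem tendsto_a_pa (d : ContinuumData κ β r₀ R α γ σ φ f g) :
    Tendsto (fun n : ℕ => ∑ v, smearCoeff φ r₀ .a f n v * (smearCoeff φ r₀ .pa g n v /
      (formScale κ β r₀ n * (2 * Real.cos (epsTheta n / 2))))) atTop
      (𝓝 (κ * β / (8 * Real.pi) * ∫ r in (0 : ℝ)..r₀, Real.sign (φ.pb r) * f r * g r)) := by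
  have hκ := d.kappa_pos.ne'
  have hβ := d.beta_ne_zero
  have hq : Tendsto (fun n => κ * β / (8 * Real.pi) * σ / Real.cos (epsTheta n / 2)) atTop
      (𝓝 (κ * β / (8 * Real.pi) * σ)) := by
    have := (tendsto_const_nhds (x := κ * β / (8 * Real.pi) * σ)).div
      tendsto_cos_half_epsTheta one_ne_zero
    rwa [div_one] at this
  have h := tendsto_weighted_riemann_sum (h := fun r => f r * g r) d.r₀_pos
    (d.continuous_f.mul d.continuous_g)
    (q := fun n _ => κ * β / (8 * Real.pi) * σ / Real.cos (epsTheta n / 2))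
    (q₀ := κ * β / (8 * Real.pi) * σ) (fun δ hδ => by
      filter_upwards [Metric.tendsto_nhds.1 hq δ hδ] with n hn v _ using hn)
  rw [d.integral_sign_mul, ← mul_assoc]
  refine h.congr' ?_
  filter_upwards [eventually_ge_atTop 2] with n hn
  have hc := cos_half_epsTheta_pos hn
  have hε := epsR_pos d.r₀_pos (n := n) (by omega)
  refine Finset.sum_congr rfl fun v _ => ?_
  simp only [smearCoeff, signFactor, d.sign_pb_radius, formScale]
  field_simp
  ring

theorem tendsto_b_pb (d : ContinuumData κ β r₀ R α γ σ φ f g) :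
    Tendsto (fun n : ℕ => ∑ v, smearCoeff φ r₀ .b f n v * (smearCoeff φ r₀ .pb g n v /
      (formScale κ β r₀ n * samplePhi φ r₀ n v))) atTop
      (𝓝 (κ * β / (16 * Real.pi) * ∫ r in (0 : ℝ)..r₀, Real.sign (φ.pb r) * f r * g r)) := by
  have hκ := d.kappa_pos.ne'
  have hβ := d.beta_ne_zero
  have h := tendsto_weighted_riemann_sum (h := fun r => f r * g r) d.r₀_pos
    (d.continuous_f.mul d.continuous_g)
    (q := fun n v => κ * β / (4 * Real.pi) * σ / samplePhi φ r₀ n v)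
    (q₀ := κ * β / (16 * Real.pi) * σ) (fun δ hδ => by
      have hlim : Tendsto (fun t : ℝ => κ * β / (4 * Real.pi) * σ / t) (𝓝 4)
          (𝓝 (κ * β / (16 * Real.pi) * σ)) := by
        have := (tendsto_const_nhds (x := κ * β / (4 * Real.pi) * σ)).div
          (tendsto_id (x := 𝓝 (4 : ℝ))) four_ne_zero
        convert! this using 2
        field_simp; ring
      obtain ⟨η, hη, hη'⟩ := Metric.tendsto_nhds_nhds.1 hlim δ hδ
      filter_upwards [eventually_phiCoeff_close d.r₀_pos d.r₀_lt d.continuousOn_b d.contDiffOn_pa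
        d.continuousOn_pb d.pb_ne_zero d.α_pos d.γ_lt hη] with n hn v hv
      exact hη' (hn v (d.mem_Icc _ (Or.inl (left_ne_zero_of_mul hv)))))
  rw [d.integral_sign_mul, ← mul_assoc]
  refine h.congr' ?_
  filter_upwards [eventually_ge_atTop 2, d.Fbpb_ne_zero] with n hn hF
  have hε := epsR_pos d.r₀_pos (n := n) (by omega)
  refine Finset.sum_congr rfl fun v _ => ?_
  have hΦ : samplePhi φ r₀ n v ≠ 0 := phiCoeff_ne_zero (hF v)
  simp only [smearCoeff, signFactor, d.sign_pb_radius, formScale]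
  field_simp

theorem tendsto_off_diagonal (d : ContinuumData κ β r₀ R α γ σ φ f g) (c c' : Coord)
    {T : ∀ n, Fin n → ℝ} (hT : T = sampleS φ r₀ ∨ T = sampleT φ r₀) :
    Tendsto (fun n : ℕ => ∑ v, smearCoeff φ r₀ c f n v *
      (T n v * centralDiffLM r₀ n (smearCoeff φ r₀ c' g n) v /
        (formScale κ β r₀ n * (2 * Real.cos (epsTheta n / 2))) / samplePhi φ r₀ n v))
      atTop (𝓝 0) := by
  obtain ⟨Cf, hCf, hf⟩ := exists_abs_le_on_Icc d.continuous_f r₀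
  obtain ⟨Cg, hCg, hg⟩ := exists_abs_le_on_Icc d.continuous_g r₀
  obtain ⟨M, m, hM, hm, hbd⟩ := exists_samplePoint_bounds d.r₀_pos d.r₀_lt d.continuousOn_b
    d.contDiffOn_pa d.continuousOn_pb d.pb_ne_zero d.α_pos d.γ_lt
  refine tendsto_off_diagonal_sum (M := M * (1 + M / m)) d.kappa_pos d.beta_ne_zero d.r₀_pos
    hCf hCg (by positivity) (.of_forall fun n v => abs_smearCoeff_le d.r₀_pos hf c v)
    (.of_forall fun n v => abs_smearCoeff_le d.r₀_pos hg c' v) ?_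
  filter_upwards [eventually_ge_atTop 2, hbd, eventually_phiCoeff_close d.r₀_pos d.r₀_lt
    d.continuousOn_b d.contDiffOn_pa d.continuousOn_pb d.pb_ne_zero d.α_pos d.γ_lt one_pos]
    with n hn hbd hΦ v hv
  have hfv : f (radius r₀ v) ≠ 0 := fun h => hv (by rw [smearCoeff, h]; ring)
  have hr := d.mem_Icc _ (Or.inl hfv)
  obtain ⟨hb, hP, hpb⟩ := hbd v hr
  refine ⟨?_, ?_⟩
  · set P := capPi r₀ (innerValue φ r₀ n) (outerValue φ r₀ n) (samplePoint φ r₀ n) v with hPdef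
    set b := samplePoint φ r₀ n .b v with hbdef
    have hp0 : 0 < samplePoint φ r₀ n .pb v := hm.trans_le hpb
    have hS0 : 0 ≤ smallBound n := (structH_nonneg hn 0 0).trans (structH_le hn 0 0)
    have hbp : |b / samplePoint φ r₀ n .pb v| ≤ M / m := by
      rw [abs_div, abs_of_pos hp0]; gcongr
    have key : ∀ w : ℝ, 0 ≤ w → w ≤ smallBound n → |1 / 2 * w * P| ≤ smallBound n * M := by
      intro w h0 h1
      rw [abs_mul, abs_of_nonneg (by positivity)]
      exact mul_le_mul (by linarith) hP (abs_nonneg _) hS0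
    rcases hT with rfl | rfl
    · have h1 := key _ (structH_nonneg hn b P) (structH_le hn b P)
      have h2 : sampleS φ r₀ n v = 1 / 2 * structH n b P * P := rfl
      rw [h2]
      refine h1.trans ?_
      have : 0 ≤ M / m * (smallBound n * M) := by positivity
      linarith
    · have h1 := key _ (structG_pos hn b P).le (structG_le hn b P)
      have h2 : sampleT φ r₀ n v =
        1 / 2 * structG n b P * P * (b / samplePoint φ r₀ n .pb v) := rfl
      rw [h2, abs_mul]
      refine (mul_le_mul h1 hbp (abs_nonneg _) (by positivity)).trans ?_
      have : 0 ≤ smallBound n * M := by positivity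
      linarith
  · have := abs_lt.1 (hΦ v hr)
    rw [samplePhi]
    linarith

theorem tendsto_poissonBracket (d : ContinuumData κ β r₀ R α γ σ φ f g) (c c' : Coord) :
    Tendsto (fun n : ℕ => poissonBracket
        (omegaSym κ β r₀ (innerValue φ r₀ n) (outerValue φ r₀ n))
        (smeared φ r₀ c f) (smeared φ r₀ c' g) (samplePoint φ r₀ n)) atTop
      (𝓝 (continuumCoeff κ β c c' *
        ∫ r in (0 : ℝ)..r₀, Real.sign (φ.pb r) * f r * g r)) := by
  refine Tendsto.congr' (d.eventually_bracket_eq c c') ?_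
  have hcomm : ∫ r in (0 : ℝ)..r₀, Real.sign (φ.pb r) * f r * g r =
      ∫ r in (0 : ℝ)..r₀, Real.sign (φ.pb r) * g r * f r := by
    congr 1; funext r; ring
  cases c <;> cases c' <;>
    simp only [blockSharp_single_a, blockSharp_single_b, blockSharp_single_pa, blockSharp_single_pb,
      continuumCoeff, Pi.zero_apply, mul_zero, zero_mul, Finset.sum_const_zero, tendsto_const_nhds,
      mul_neg, Finset.sum_neg_distrib, sum_mul_centralDiffLM_div]
  · simpa using (d.symm.tendsto_off_diagonal .b .a (Or.inr rfl)).neg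
  · exact d.tendsto_a_pa
  · simpa using d.symm.tendsto_off_diagonal .pb .a (Or.inl rfl)
  · exact d.tendsto_off_diagonal .b .a (Or.inr rfl)
  · exact d.tendsto_b_pb
  · rw [neg_mul, hcomm]
    refine d.symm.tendsto_a_pa.neg.congr fun n => ?_
    congr 1
    exact Finset.sum_congr rfl fun v _ => by ring
  · simpa using (d.tendsto_off_diagonal .pb .a (Or.inl rfl)).neg
  · rw [neg_mul, hcomm]
    refine d.symm.tendsto_b_pb.neg.congr fun n => ?_
    congr 1
    exact Finset.sum_congr rfl fun v _ => by ring

end ContinuumData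

end ContinuumLimit

end SphericalLattice

theorem mainTheorem2 (κ β r₀ : ℝ) (hκ : 0 < κ) (hβ : β ≠ 0) (hr₀ : 0 < r₀) :
    -- finite lattices
    (∀ n : ℕ, 2 ≤ n → ∀ c₀ c₁ : ℝ,
      -- the two expressions for `H_Ω`
      (∀ b P : ℝ, P ≠ 0 → ∃ Gb FP : ℝ,
        HasDerivAt (fun t => structG n t P) Gb b ∧
        HasDerivAt (fun t => structF n b t) FP P ∧
        structH n b P = structG n b P + b * Gb - 1 / P * FP) ∧
      -- the restricted symplectic form
      (∀ x : Phase n, (∀ v, x .pb v ≠ 0) →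
        symEmbed r₀ c₀ c₁ x ∈ holonomyFluxSpace n ∧
        ∀ X Y : Phase n,
          omegaSym κ β r₀ c₀ c₁ x X Y =
            4 * Real.pi / (κ * β) * ∑ v : Fin n, epsR r₀ n *
              (2 * Real.cos (epsTheta n / 2) * (X .a v * Y .pa v - Y .a v * X .pa v) +
                (FOm r₀ c₀ c₁ x v + HOm r₀ c₀ c₁ x v * capPi r₀ c₀ c₁ x v ^ 2) *
                  (X .b v * Y .pb v - Y .b v * X .pb v) +
                1 / 2 * HOm r₀ c₀ c₁ x v * capPi r₀ c₀ c₁ x v *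
                  (centralDiff r₀ 0 0 (X .pa) v * Y .b v -
                    centralDiff r₀ 0 0 (Y .pa) v * X .b v) +
                1 / 2 * GOm r₀ c₀ c₁ x v * capPi r₀ c₀ c₁ x v * (x .b v / x .pb v) *
                  (centralDiff r₀ 0 0 (X .pa) v * Y .pb v -
                    centralDiff r₀ 0 0 (Y .pa) v * X .pb v))) ∧
      -- non-degeneracy and the Poisson algebra
      (∀ x : Phase n, (∀ v, x .pb v ≠ 0) → (∀ v, Fbpb κ β r₀ c₀ c₁ x v ≠ 0) →
        (∀ X : Phase n, (∀ Y, omegaSym κ β r₀ c₀ c₁ x X Y = 0) ↔ X = 0) ∧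
        (∀ f : Phase n → ℝ, DifferentiableAt ℝ f x →
          ∃! X, IsHamiltonianVector (omegaSym κ β r₀ c₀ c₁) f x X) ∧
        ∀ v v' : Fin n,
          coordBracket κ β r₀ c₀ c₁ x .a v .pa v' =
            κ * β / (8 * Real.pi * epsR r₀ n) * (Real.cos (epsTheta n / 2))⁻¹ * kron v v' ∧
          coordBracket κ β r₀ c₀ c₁ x .b v .pb v' =
            κ * β / (4 * Real.pi * epsR r₀ n) *
              (1 / (FOm r₀ c₀ c₁ x v + HOm r₀ c₀ c₁ x v * capPi r₀ c₀ c₁ x v ^ 2)) *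
              kron v v' ∧
          coordBracket κ β r₀ c₀ c₁ x .a v .pb v' =
            κ * β / (32 * Real.pi * epsR r₀ n ^ 2) * (Real.cos (epsTheta n / 2))⁻¹ *
              (HOm r₀ c₀ c₁ x v' * capPi r₀ c₀ c₁ x v' /
                (FOm r₀ c₀ c₁ x v' + HOm r₀ c₀ c₁ x v' * capPi r₀ c₀ c₁ x v' ^ 2)) *
              (kronSucc v v' - kronSucc v' v) ∧
          coordBracket κ β r₀ c₀ c₁ x .a v .b v' =
            κ * β / (32 * Real.pi * epsR r₀ n ^ 2) * (Real.cos (epsTheta n / 2))⁻¹ *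
              (GOm r₀ c₀ c₁ x v' * capPi r₀ c₀ c₁ x v' /
                (FOm r₀ c₀ c₁ x v' + HOm r₀ c₀ c₁ x v' * capPi r₀ c₀ c₁ x v' ^ 2)) *
              (x .b v' / x .pb v') * (kronSucc v' v - kronSucc v v') ∧
          coordBracket κ β r₀ c₀ c₁ x .a v .a v' = 0 ∧
          coordBracket κ β r₀ c₀ c₁ x .b v .b v' = 0 ∧
          coordBracket κ β r₀ c₀ c₁ x .pa v .pa v' = 0 ∧
          coordBracket κ β r₀ c₀ c₁ x .pb v .pb v' = 0 ∧
          coordBracket κ β r₀ c₀ c₁ x .pa v .pb v' = 0 ∧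
          coordBracket κ β r₀ c₀ c₁ x .b v .pa v' = 0 ∧
          -- the configuration variables at neighbouring vertices do not commute
          (coordBracket κ β r₀ c₀ c₁ x .a v .b v' ≠ 0 ↔
            ((v : ℕ) = v' + 1 ∨ (v' : ℕ) = v + 1) ∧
              x .b v' ≠ 0 ∧ capPi r₀ c₀ c₁ x v' ≠ 0)) ∧
      (∃ x : Phase n, (∀ v, x .pb v ≠ 0) ∧ (∀ v, Fbpb κ β r₀ c₀ c₁ x v ≠ 0) ∧
        ∃ v v' : Fin n, coordBracket κ β r₀ c₀ c₁ x .a v .b v' ≠ 0)) ∧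
    -- continuum limit of the structure functions, uniformly on bounded sets
    (∀ M δ : ℝ, 0 < δ → ∀ᶠ n : ℕ in Filter.atTop, ∀ b P : ℝ, |b| ≤ M → |P| ≤ M →
      |structF n b P - 4| < δ ∧ |structG n b P| < δ ∧ |structH n b P| < δ) ∧
    -- continuum limit of the Poisson algebra
    (∀ (φ : ContinuumFields) (R : ℝ), r₀ < R →
      ContinuousOn φ.a (Set.Ioo 0 R) → ContinuousOn φ.b (Set.Ioo 0 R) →
      ContDiffOn ℝ 1 φ.pa (Set.Ioo 0 R) → ContinuousOn φ.pb (Set.Ioo 0 R) →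
      (∀ r ∈ Set.Ioo 0 R, φ.pb r ≠ 0) →
      (∀ᶠ n : ℕ in Filter.atTop, ∀ v : Fin n,
        Fbpb κ β r₀ (innerValue φ r₀ n) (outerValue φ r₀ n) (samplePoint φ r₀ n) v ≠ 0) →
      ∀ f g : ℝ → ℝ, Continuous f → Continuous g →
        tsupport f ⊆ Set.Ioo 0 r₀ → tsupport g ⊆ Set.Ioo 0 r₀ →
        ∀ c c' : Coord,
          Filter.Tendsto
            (fun n : ℕ => poissonBracket
              (omegaSym κ β r₀ (innerValue φ r₀ n) (outerValue φ r₀ n))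
              (smeared φ r₀ c f) (smeared φ r₀ c' g) (samplePoint φ r₀ n))
            Filter.atTop
            (nhds (continuumCoeff κ β c c' *
              ∫ r in (0 : ℝ)..r₀, Real.sign (φ.pb r) * f r * g r))) := by
  refine ⟨fun n hn c₀ c₁ => ⟨?_, ?_, ?_, ?_⟩, eventually_structure_functions_close, ?_⟩
  · exact structH_eq_structG_add (by omega)
  · exact fun x hx => ⟨symEmbed_mem_holonomyFluxSpace r₀ c₀ c₁ x,
      omegaSym_eq_reducedForm κ β r₀ c₀ c₁ (by omega) hx⟩
  · intro x hx hF
    have hn0 : n ≠ 0 := by omega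
    have hω := omegaSym_eq_blockForm κ β r₀ c₀ c₁ hn0 hx
    have hD := sum_mul_centralDiffLM (n := n) r₀
    have hK := formScale_ne_zero hκ hβ hr₀ hn0
    have hA := mul_ne_zero two_ne_zero (cos_half_epsTheta_pos hn).ne'
    have hΦ := fun v => phiCoeff_ne_zero (hF v)
    have hco := coordBracket_eq hκ hβ hr₀ c₀ c₁ hn hx hF
    refine ⟨fun X => ?_, fun f _ =>
      existsUnique_isHamiltonianVector_of_blockForm hω hD hK hA hΦ f, fun v v' =>
      ⟨coordBracket_a_pa hκ hβ hr₀ c₀ c₁ hn hx hF v v',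
        coordBracket_b_pb hκ hβ hr₀ c₀ c₁ hn hx hF v v',
        coordBracket_a_pb hκ hβ hr₀ c₀ c₁ hn hx hF v v',
        coordBracket_a_b hκ hβ hr₀ c₀ c₁ hn hx hF v v', ?_, ?_, ?_, ?_, ?_, ?_,
        coordBracket_a_b_ne_zero_iff hκ hβ hr₀ c₀ c₁ hn hx hF v v'⟩⟩
    · rw [hω]
      exact blockForm_nondegenerate hD hK hA hΦ X
    · rw [hco, blockSharp_single_a]; rfl
    · rw [hco, blockSharp_single_b]; rfl
    · rw [hco, blockSharp_single_pa]; rfl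
    · rw [hco, blockSharp_single_pb]; rfl
    · rw [hco, blockSharp_single_pb]; rfl
    · rw [hco, blockSharp_single_pa]; rfl
  · exact exists_coordBracket_a_b_ne_zero hκ hβ hr₀ c₀ c₁ hn
  · intro φ R hR _ hb hpa hpb h0 hF f g hf hg hfs hgs c c'
    obtain ⟨σ, -, hsign⟩ := exists_sign_eq hpb h0
    obtain ⟨α, γ, hα, hγ, hmem⟩ := exists_Icc_of_tsupport_subset hr₀ hfs hgs
    exact ContinuumData.tendsto_poissonBracket
      ⟨hκ, hβ, hr₀, hR, hb, hpa, hpb, h0, hsign, hF, hf, hg, hα, hγ, hmem⟩ c c'
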